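/- **Conventions.** All gradings are by $\mathbb Z_2$, formulas containing a degree $|\cdot|$ are for homogeneous elements and are extended additively. $K$ is a unital supercommutative superring with $\frac12\in K$, $A$ is a superextension of $K$ (a unital associative supercommutative $K$-superalgebra), and for an $A$-supermodule $M$ the left and right actions are related by $am=(-1)^{|a||m|}ma$; $\operatorname{End}_KM$ (resp. $\operatorname{End}_AM$) consists of the additive maps with $f(ma)=f(m)a$ for $a\in K$ (resp. $a\in A$), with bracket $[f,g]=fg-(-1)^{|f||g|}gf$, and $a\cdot\mathrm{Id}$ is left multiplication by $a$. An $A$-quadratic form on $M$ is an $A$-bilinear supersymmetric map $q:M\times M\to A$ of degree $\bar 0$. For such $q$ put $\mathbf E_{m,n}(p)=m\,q(n,p)-(-1)^{|n||p|}q(m,p)\,n$; $\operatorname{eosp}(q)$ is the $\mathbb Z$-span of all $\mathbf E_{m,n}$; $\operatorname{osp}(q)$ is the set of $x\in\operatorname{End}_AM$ with $q(x(m),n)+(-1)^{|m||n|}q(x(n),m)=0$. For a set $X$ of endomorphisms, $\overline X$ is the set of all $\sum_ix_i$ with $x_i\in X$ such that for each $m$ only finitely many $x_i(m)$ are nonzero.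 $\mathcal S^{(1)}$, $\mathcal S^{(2)}$, $\mathcal S^{(3)}$ are the spans of the homogeneous $S\in\operatorname{End}_KM$ satisfying respectively $[S,A\cdot\mathrm{Id}]\subset A\cdot\mathrm{Id}$; $[S,q(m,n)\cdot\mathrm{Id}]=(q(S(m),n)+(-1)^{|m||n|}q(S(n),m))\cdot\mathrm{Id}$ for all homogeneous $m,n$; $[S,\mathcal E]\subset\mathcal E$. Put $\mathcal S_{\mathcal E}=\mathcal S^{(1)}\cap\mathcal S^{(2)}\cap\mathcal S^{(3)}$. If $\operatorname{Ann}_AM=0$ and $S\in\mathcal S^{(1)}$, then $\mathbf{ad}_AS:A\to A$ is the map $\Delta$ with $[S,a\cdot\mathrm{Id}]=\Delta(a)\cdot\mathrm{Id}$. For $\operatorname{eosp}(q)\subset\mathcal E\subset\operatorname{osp}(q)$, $\mathcal E_\infty=\{(a,m,n,x)\mid a\in A,\ m,n\in M,\ x\in\mathcal E\}$ has the bracket $$[(a,m,n,x),(a',m',n',x')]=\bigl(q(m,n')-q(n,m'),\ am'+xm'-ma'-(-1)^{|x'||m|}x'm,\ -an'+xn'+na'-(-1)^{|x'||n|}x'n,\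 \mathbf E_{m,n'}+\mathbf E_{n,m'}+[x,x']\bigr).$$ $\operatorname{Der}_K\mathcal E_\infty$ is the superalgebra of its $K$-derivations, $\mathbf{ad}(\mathcal E_\infty)$ the inner ones, and $\mathbf{ad_{loc}}(\mathcal E_\infty)$ the derivations that on every finite subset agree with some inner derivation. **Statement.** Let $N$ and $P$ be $A$-supermodules with $A$-quadratic forms $q_N$ and $q_P$, let $M=N\oplus P$, $q=q_N\oplus q_P$, and assume $\operatorname{Ann}_AP=0$. Let $N$ be free with a homogeneous basis $\{n_i\mid i\in I\}$ with respect to which $q_N$ is almost diagonalizable: for each $i$ there is $\underline i\in I$ with $q(n_i,n_{\underline i})$ invertible and $q(n_i,n_j)=0$ for $j\ne\underline i$. For $\Delta:A\to A$ let $$\Delta_N\Bigl(\sum_ia_in_i\Bigr)=\sum_i\Bigl(\tfrac12\Delta(q(n_i,n_{\underline i}))\,q(n_i,n_{\underline i})^{-1}a_i+\Delta(a_i)\Bigr)n_i ,$$ and let $\operatorname{eosp}(q_N,q_P)$ be the $A$-span of the $\mathbf E_{n,p}$ with $n\in N$, $p\in P$. For $S\in\operatorname{End}_KP$ in $\mathcal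 S^{(1)}_P\cap\mathcal S^{(2)}_P$ write $\hat S=(\mathbf{ad}_AS)_N\oplus S\in\operatorname{End}_KM$. (A subscript $P$ means: formed from $(P,q_P)$.) (1) The map $$\overline{\operatorname{eosp}(q_N)}\oplus\overline{\operatorname{eosp}(q_N,q_P)}\oplus(\mathcal S^{(1)}_P\cap\mathcal S^{(2)}_P)\to\mathcal S^{(1)}\cap\mathcal S^{(2)},\qquad x\oplus S\mapsto x+\hat S,$$ is an isomorphism of Lie superalgebras over $K$. Here endomorphisms of $N$ are extended by $0$ on $P$, and the bracket on the left is $$[x\oplus S,\,x'\oplus S']=\bigl([x,x']-[x,x']_P+[\hat S,x']+[x,\hat S']\bigr)\oplus\bigl([S,S']+[x,x']_P\bigr),$$ where $[x,x']_P$ is the $P\to P$ block of $[x,x']$; in particular it is well defined. (2) If $\mathcal E$ is one of $\operatorname{eosp}(q)$, $\overline{\operatorname{eosp}(q)}$, $\operatorname{osp}(q)$ and $\mathcal S_P$ denotes $\mathcal S_{\mathcal E_P}$ for $(P,q_P)$, with $\mathcal E_P$ any of $\operatorname{eosp}(q_P)$, $\overline{\operatorname{eosp}(q_P)}$, $\operatorname{osp}(q_P)$,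 then the same map is an isomorphism of Lie superalgebras over $K$ $$\overline{\operatorname{eosp}(q_N)}\oplus\overline{\operatorname{eosp}(q_N,q_P)}\oplus\mathcal S_P\;\cong\;\mathcal S_{\mathcal E}.$$ (3) Suppose moreover that $q$ has an invertibly diagonalizable orthogonal summand of rank $2$ whose orthogonal complement has zero annihilator in $A$; that is, there are homogeneous $h_0,h_1\in M$ with $q(h_0,h_0)$, $q(h_1,h_1)$ invertible, $q(h_0,h_1)=0=q(h_1,h_0)$ and $\operatorname{Ann}_A\{h_0,h_1\}^{\perp}=0$ (the last condition is automatic if $h_0,h_1\in N$). Then for $\mathcal E$ and $\mathcal S_P$ as in (2) the map $S\mapsto d_{\hat S}$, with $d_{\hat S}(a,m,n,x)=((\mathbf{ad}_A\hat S)(a),\hat S(m),\hat S(n),[\hat S,x])$, is an injective homomorphism $\mathcal S_P\to\operatorname{Der}_K\mathcal E_\infty$ of Lie superalgebras over $K$, and, identifying $\mathcal S_P$ with its image, $$\operatorname{Der}_K\mathcal E_\infty=\begin{cases}\mathbf{ad_{loc}}(\mathcal E_\infty)+\mathcal S_P&\text{if }\mathcal E=\operatorname{eosp}(q),\\ \mathbf{ad}(\mathcal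 E_\infty)+\mathcal S_P&\text{if }\mathcal E=\overline{\operatorname{eosp}(q)}\text{ or }\operatorname{osp}(q).\end{cases}$$ -/

import Mathlib

namespace OspDer

universe u v w

/-! ### Signs, gradings, right actions -/

/-- The sign `(-1)^{αβ}` for `α, β` in `ℤ/2`. -/
def sgn (α β : ZMod 2) : ℤ := (-1) ^ (α.val * β.val)

/-- A `ℤ/2`-graded ring is supercommutative if `ab = (-1)^{|a||b|} ba` for homogeneous `a, b`. -/
def IsSupercommutative {R : Type*} [Ring R] (gr : ZMod 2 → AddSubgroup R) : Prop :=
  ∀ (α β : ZMod 2) (a b : R), a ∈ gr α → b ∈ gr β → a * b = sgn α β • (b * a)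

/-- The component of degree `α` of an element of a `ℤ/2`-graded group. -/
noncomputable def proj {M : Type*} [AddCommGroup M] (ℳ : ZMod 2 → AddSubgroup M)
    [DirectSum.Decomposition ℳ] (α : ZMod 2) : M →+ M :=
  (ℳ α).subtype.comp
    ((DFinsupp.evalAddMonoidHom α).comp (DirectSum.decomposeAddEquiv ℳ).toAddMonoidHom)

theorem proj_mem {M : Type*} [AddCommGroup M] (ℳ : ZMod 2 → AddSubgroup M)
    [DirectSum.Decomposition ℳ] (α : ZMod 2) (m : M) : proj ℳ α m ∈ ℳ α :=
  (DirectSum.decompose ℳ m α).2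

theorem sum_proj {M : Type*} [AddCommGroup M] (ℳ : ZMod 2 → AddSubgroup M)
    [DirectSum.Decomposition ℳ] (m : M) : ∑ α, proj ℳ α m = m := by
  have h := (DirectSum.decomposeAddEquiv ℳ).symm_apply_apply m
  conv_rhs => rw [← h]
  rw [DirectSum.decomposeAddEquiv_apply, ← DirectSum.sum_univ_of (DirectSum.decompose ℳ m), map_sum]
  refine Finset.sum_congr rfl fun α _ => ?_
  change _ = (DirectSum.decompose ℳ).symm _
  rw [DirectSum.decompose_symm_of]
  rfl

/-- The grading of a direct sum `N ⊕ P` of graded groups. -/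
def prodGr {N P : Type*} [AddCommGroup N] [AddCommGroup P]
    (𝒩 : ZMod 2 → AddSubgroup N) (𝓟 : ZMod 2 → AddSubgroup P) (α : ZMod 2) :
    AddSubgroup (N × P) :=
  (𝒩 α).prod (𝓟 α)

theorem proj_same {M : Type*} [AddCommGroup M] (ℳ : ZMod 2 → AddSubgroup M)
    [DirectSum.Decomposition ℳ] {α : ZMod 2} {m : M} (hm : m ∈ ℳ α) : proj ℳ α m = m :=
  DirectSum.decompose_of_mem_same ℳ hm

theorem proj_ne {M : Type*} [AddCommGroup M] (ℳ : ZMod 2 → AddSubgroup M)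
    [DirectSum.Decomposition ℳ] {α β : ZMod 2} (h : α ≠ β) {m : M} (hm : m ∈ ℳ α) :
    proj ℳ β m = 0 :=
  DirectSum.decompose_of_mem_ne ℳ hm h

/-- The component of degree `α` of an element of `N ⊕ P`. -/
noncomputable def prodProj {N P : Type*} [AddCommGroup N] [AddCommGroup P]
    (𝒩 : ZMod 2 → AddSubgroup N) (𝓟 : ZMod 2 → AddSubgroup P)
    [DirectSum.Decomposition 𝒩] [DirectSum.Decomposition 𝓟] (α : ZMod 2) :
    N × P →+ prodGr 𝒩 𝓟 α :=
  AddMonoidHom.codRestrict ((proj 𝒩 α).prodMap (proj 𝓟 α)) (prodGr 𝒩 𝓟 α)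
    fun x => AddSubgroup.mem_prod.2 ⟨proj_mem 𝒩 α x.1, proj_mem 𝓟 α x.2⟩

noncomputable instance prodGr.decomposition {N P : Type*} [AddCommGroup N] [AddCommGroup P]
    (𝒩 : ZMod 2 → AddSubgroup N) (𝓟 : ZMod 2 → AddSubgroup P)
    [DirectSum.Decomposition 𝒩] [DirectSum.Decomposition 𝓟] :
    DirectSum.Decomposition (prodGr 𝒩 𝓟) :=
  DirectSum.Decomposition.ofAddHom (prodGr 𝒩 𝓟)
    ((∑ α, (DirectSum.of (fun α => prodGr 𝒩 𝓟 α) α).comp (prodProj 𝒩 𝓟 α) :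
      N × P →+ DirectSum (ZMod 2) fun α => prodGr 𝒩 𝓟 α))
    (by
      ext x : 1
      simp only [AddMonoidHom.comp_apply, AddMonoidHom.finsetSum_apply, map_sum,
        DirectSum.coeAddMonoidHom_of, AddMonoidHom.id_apply]
      apply Prod.ext
      · rw [Prod.fst_sum]; exact sum_proj 𝒩 x.1
      · rw [Prod.snd_sum]; exact sum_proj 𝓟 x.2)
    (by
      ext i x : 2
      simp only [AddMonoidHom.comp_apply, AddMonoidHom.finsetSum_apply,
        DirectSum.coeAddMonoidHom_of, AddMonoidHom.id_apply]
      have hx := AddSubgroup.mem_prod.1 x.2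
      rw [Finset.sum_eq_single i]
      · congr 1
        apply Subtype.ext
        exact Prod.ext (proj_same 𝒩 hx.1) (proj_same 𝓟 hx.2)
      · intro j _ hj
        have h0 : prodProj 𝒩 𝓟 j x.1 = 0 := by
          apply Subtype.ext
          exact Prod.ext (proj_ne 𝒩 hj.symm hx.1) (proj_ne 𝓟 hj.symm hx.2)
        rw [h0, map_zero]
      · simp)

instance prodGr.gradedSMul {A N P : Type*} [Ring A] [AddCommGroup N] [AddCommGroup P]
    [Module A N] [Module A P] (𝒜 : ZMod 2 → AddSubgroup A)
    (𝒩 : ZMod 2 → AddSubgroup N) (𝓟 : ZMod 2 → AddSubgroup P)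
    [SetLike.GradedSMul 𝒜 𝒩] [SetLike.GradedSMul 𝒜 𝓟] :
    SetLike.GradedSMul 𝒜 (prodGr 𝒩 𝓟) where
  smul_mem i j a x ha hx := by
    have h := AddSubgroup.mem_prod.1 hx
    have h1 : a • x.1 ∈ 𝒩 (i +ᵥ j) := SetLike.GradedSMul.smul_mem ha h.1
    have h2 : a • x.2 ∈ 𝓟 (i +ᵥ j) := SetLike.GradedSMul.smul_mem ha h.2
    exact AddSubgroup.mem_prod.2 ⟨h1, h2⟩

section Modules

variable {R : Type*} [Ring R] (ℛ : ZMod 2 → AddSubgroup R) [DirectSum.Decomposition ℛ]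
  {M : Type*} [AddCommGroup M] [Module R M] (ℳ : ZMod 2 → AddSubgroup M)
  [DirectSum.Decomposition ℳ]

/-- The right action `a ↦ m a` on a supermodule: `m a = (-1)^{|a||m|} a m` for homogeneous
`a` and `m`, extended biadditively. -/
noncomputable def rmul (m : M) : R →+ M :=
  ∑ α, ∑ β, sgn α β • ((smulAddHom R M).flip (proj ℳ β m)).comp (proj ℛ α)

theorem rmul_add (m n : M) : rmul ℛ ℳ (m + n) = rmul ℛ ℳ m + rmul ℛ ℳ n := by
  ext a
  simp [rmul, Finset.sum_add_distrib]

/-- `End_R M`: the additive maps `f` with `f (m a) = f(m) a`. -/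
noncomputable def endLin : AddSubgroup (M →+ M) where
  carrier := {f | ∀ m a, f (rmul ℛ ℳ m a) = rmul ℛ ℳ (f m) a}
  zero_mem' m a := by
    have h := rmul_add ℛ ℳ (0 : M) 0
    simp only [add_zero, left_eq_add] at h
    simp [h]
  add_mem' {f g} hf hg m a := by
    simp [hf m a, hg m a, rmul_add]
  neg_mem' {f} hf m a := by
    have h := rmul_add ℛ ℳ (f m) (-f m)
    have h0 := rmul_add ℛ ℳ (0 : M) 0
    simp only [add_zero, left_eq_add] at h0
    rw [add_neg_cancel, h0] at h
    simp [hf m a, eq_neg_of_add_eq_zero_right h.symm]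

end Modules

/-! ### Additive endomorphisms of a graded group and the superbracket -/

/-- Additive maps `M → M` of degree `α`. -/
def endGr {M : Type*} [AddCommGroup M] (ℳ : ZMod 2 → AddSubgroup M) (α : ZMod 2) :
    AddSubgroup (M →+ M) where
  carrier := {f | ∀ β, ∀ m ∈ ℳ β, f m ∈ ℳ (α + β)}
  zero_mem' β _ _ := (ℳ (α + β)).zero_mem
  add_mem' hf hg β m hm := (ℳ (α + β)).add_mem (hf β m hm) (hg β m hm)
  neg_mem' hf β m hm := (ℳ (α + β)).neg_mem (hf β m hm)

section Bracket

variable {M : Type*} [AddCommGroup M] (ℳ : ZMod 2 → AddSubgroup M) [DirectSum.Decomposition ℳ]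

/-- The component of degree `α` of an additive endomorphism. -/
noncomputable def endProj (α : ZMod 2) : (M →+ M) →+ (M →+ M) :=
  AddMonoidHom.mk' (fun f => ∑ β, (proj ℳ (α + β)).comp (f.comp (proj ℳ β))) fun f g => by
    ext m
    simp [Finset.sum_add_distrib]

/-- The superbracket: `[f, g] = f g - (-1)^{|f||g|} g f` for homogeneous `f, g`, extended
biadditively. -/
noncomputable def sbr (f g : M →+ M) : M →+ M :=
  f.comp g - ∑ α, ∑ β, sgn α β • (endProj ℳ β g).comp (endProj ℳ α f)

theorem sbr_add_left (f f' g : M →+ M) : sbr ℳ (f + f') g = sbr ℳ f g + sbr ℳ f' g := by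
  ext m
  simp [sbr, Finset.sum_add_distrib, smul_add]
  abel

theorem sbr_zero_left (g : M →+ M) : sbr ℳ 0 g = 0 := by
  have h := sbr_add_left ℳ 0 0 g
  simpa using h

theorem sbr_neg_left (f g : M →+ M) : sbr ℳ (-f) g = -sbr ℳ f g := by
  have h := sbr_add_left ℳ f (-f) g
  rw [add_neg_cancel, sbr_zero_left] at h
  exact (neg_eq_of_add_eq_zero_right h.symm).symm

/-- `x(m)` with the sign `(-1)^{|x||m|}`, extended biadditively. -/
noncomputable def sapp (x : M →+ M) (m : M) : M :=
  ∑ α, ∑ β, sgn α β • endProj ℳ α x (proj ℳ β m)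

end Bracket

/-- `a · Id`, the left multiplication by `a`. -/
def lmul {A : Type*} [Ring A] (M : Type*) [AddCommGroup M] [Module A M] : A →+ (M →+ M) :=
  smulAddHom A M

/-- The endomorphisms of `M` that are (pointwise finite) sums of summable families in `X`. -/
def summableClosure {M : Type u} [AddCommGroup M] (X : AddSubgroup (M →+ M)) :
    AddSubgroup (M →+ M) where
  carrier := {f | ∃ (ι : Type u) (x : ι → M →+ M), (∀ i, x i ∈ X) ∧
    (∀ m, {i | x i m ≠ 0}.Finite) ∧ ∀ m, f m = ∑ᶠ i, x i m}
  zero_mem' := ⟨PEmpty, fun i => i.elim, fun i => i.elim, fun _ => Set.toFinite _,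
    fun _ => by rw [finsum_of_isEmpty]; rfl⟩
  add_mem' := by
    rintro f g ⟨ι, x, hx, hxf, hf⟩ ⟨κ, y, hy, hyf, hg⟩
    refine ⟨ι ⊕ κ, Sum.elim x y, ?_, fun m => ?_, fun m => ?_⟩
    · rintro (i | i)
      · exact hx i
      · exact hy i
    · refine (((hxf m).image Sum.inl).union ((hyf m).image Sum.inr)).subset ?_
      rintro (i | i) hi
      · exact Or.inl ⟨i, hi, rfl⟩
      · exact Or.inr ⟨i, hi, rfl⟩
    · rw [AddMonoidHom.add_apply, hf, hg,
        finsum_eq_sum_of_support_subset (s := (hxf m).toFinset) _ (by simp [Function.support]),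
        finsum_eq_sum_of_support_subset (s := (hyf m).toFinset) _ (by simp [Function.support]),
        finsum_eq_sum_of_support_subset
          (s := (hxf m).toFinset.disjSum (hyf m).toFinset), Finset.sum_disjSum]
      · simp
      · rintro (i | i) hi <;> simpa using hi
  neg_mem' := by
    rintro f ⟨ι, x, hx, hxf, hf⟩
    refine ⟨ι, fun i => -x i, fun i => X.neg_mem (hx i), fun m => ?_, fun m => ?_⟩
    · simpa using hxf m
    · simp [hf, finsum_neg_distrib]

/-! ### Quadratic forms, `osp`, `eosp` and its closure -/

section Forms

variable {A : Type v} [Ring A] (𝒜 : ZMod 2 → AddSubgroup A) [DirectSum.Decomposition 𝒜]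
  {M : Type u} [AddCommGroup M] [Module A M] (ℳ : ZMod 2 → AddSubgroup M)
  [DirectSum.Decomposition ℳ]

/-- An `A`-quadratic form: an `A`-bilinear supersymmetric map `M × M → A` of degree `0`. -/
structure IsQuadraticForm (q : M →+ M →+ A) : Prop where
  balanced : ∀ m n a, q (rmul 𝒜 ℳ m a) n = q m (a • n)
  right_linear : ∀ m n a, q m (rmul 𝒜 ℳ n a) = q m n * a
  degree : ∀ α β, ∀ m ∈ ℳ α, ∀ n ∈ ℳ β, q m n ∈ 𝒜 (α + β)
  supersymm : ∀ α β, ∀ m ∈ ℳ α, ∀ n ∈ ℳ β, q m n = sgn α β • q n m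

/-- `E_{m,n}(p) = m q(n,p) - (-1)^{|n||p|} q(m,p) n` for homogeneous `m, n, p`, extended
additively in each variable. -/
noncomputable def eMap (q : M →+ M →+ A) (m n : M) : M →+ M :=
  (rmul 𝒜 ℳ m).comp (q n) -
    ∑ β, ∑ γ, sgn β γ • ((smulAddHom A M).flip (proj ℳ β n)).comp ((q m).comp (proj ℳ γ))

/-- `eosp(q)`, the `ℤ`-span of all `E_{m,n}`. -/
noncomputable def eosp (q : M →+ M →+ A) : AddSubgroup (M →+ M) :=
  AddSubgroup.closure {f | ∃ m n, f = eMap 𝒜 ℳ q m n}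

/-- The set of all sums of summable families in `eosp(q)`. -/
noncomputable def eospBar (q : M →+ M →+ A) : AddSubgroup (M →+ M) :=
  summableClosure (eosp 𝒜 ℳ q)

/-- `osp(q)`. -/
noncomputable def osp (q : M →+ M →+ A) : AddSubgroup (M →+ M) where
  carrier := {x | x ∈ endLin 𝒜 ℳ ∧
    ∀ α β, ∀ m ∈ ℳ α, ∀ n ∈ ℳ β, q (x m) n + sgn α β • q (x n) m = 0}
  zero_mem' := ⟨(endLin 𝒜 ℳ).zero_mem, by simp⟩
  add_mem' {x y} hx hy := ⟨(endLin 𝒜 ℳ).add_mem hx.1 hy.1, fun α β m hm n hn => by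
    have h1 := hx.2 α β m hm n hn
    have h2 := hy.2 α β m hm n hn
    calc q ((x + y) m) n + sgn α β • q ((x + y) n) m
        = (q (x m) n + sgn α β • q (x n) m) + (q (y m) n + sgn α β • q (y n) m) := by
          simp only [AddMonoidHom.add_apply, map_add, smul_add]; abel
      _ = 0 := by rw [h1, h2, add_zero]⟩
  neg_mem' {x} hx := ⟨(endLin 𝒜 ℳ).neg_mem hx.1, fun α β m hm n hn => by
    have h1 := hx.2 α β m hm n hn
    simp only [AddMonoidHom.neg_apply, map_neg, smul_neg]
    rw [← neg_add, h1, neg_zero]⟩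

/-- `E` is one of `eosp(q)`, its closure, `osp(q)`. -/
def IsStandard (q : M →+ M →+ A) (E : AddSubgroup (M →+ M)) : Prop :=
  E = eosp 𝒜 ℳ q ∨ E = eospBar 𝒜 ℳ q ∨ E = osp 𝒜 ℳ q

/-- The annihilator of `M` in `A` is zero. -/
def IsFaithful (A : Type*) [Ring A] (M : Type*) [AddCommGroup M] [Module A M] : Prop :=
  ∀ a : A, (∀ m : M, a • m = 0) → a = 0

/-- `q` is almost diagonalizable with respect to the homogeneous basis `b`, where `bar i` is the
index paired with `i`. -/
structure IsAlmostDiagonal {I : Type*} (q : M →+ M →+ A) (b : Module.Basis I A M) (bar : I → I) :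
    Prop where
  homogeneous : ∀ i, ∃ α, b i ∈ ℳ α
  isUnit : ∀ i, IsUnit (q (b i) (b (bar i)))
  eq_zero : ∀ i j, j ≠ bar i → q (b i) (b j) = 0

/-- `q` has an orthogonal summand that is invertibly diagonalizable of rank two, spanned by
`h 0, h 1`, and whose orthogonal complement has zero annihilator. (Such `h 0, h 1` are
automatically independent, and `M` is the direct sum of their span and its complement.) -/
def HasRankTwoSummand (q : M →+ M →+ A) : Prop :=
  ∃ h : Fin 2 → M, (∀ i, ∃ α, h i ∈ ℳ α) ∧ (∀ i, IsUnit (q (h i) (h i))) ∧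
    (∀ i j, i ≠ j → q (h i) (h j) = 0) ∧
    ∀ a : A, (∀ m : M, (∀ i, q (h i) m = 0) → a • m = 0) → a = 0

/-- The extension `Δ_M` to `M` of an additive map `Δ : A → A`, with respect to an almost
diagonalizing basis `b`:
`∑ aᵢ bᵢ ↦ ∑ (½ Δ(q(bᵢ, b_{bar i})) q(bᵢ, b_{bar i})⁻¹ aᵢ + Δ(aᵢ)) bᵢ`. -/
noncomputable def derExt {I : Type*} (q : M →+ M →+ A) (b : Module.Basis I A M) (bar : I → I)
    (Δ : A →+ A) : M →+ M :=
  (Finsupp.liftAddHom fun i =>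
    ((smulAddHom A M).flip (b i)).comp
      (AddMonoidHom.mulLeft (Ring.inverse 2 * Δ (q (b i) (b (bar i))) *
        Ring.inverse (q (b i) (b (bar i)))) + Δ)).comp
    b.repr.toLinearMap.toAddMonoidHom

end Forms

/-- The orthogonal sum of two forms. -/
def orthSum {A N P : Type*} [Ring A] [AddCommGroup N] [AddCommGroup P]
    (qN : N →+ N →+ A) (qP : P →+ P →+ A) : N × P →+ N × P →+ A :=
  AddMonoidHom.mk'
    (fun x => (qN x.1).comp (AddMonoidHom.fst N P) + (qP x.2).comp (AddMonoidHom.snd N P))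
    fun x y => by
      apply AddMonoidHom.ext
      intro z
      simp only [AddMonoidHom.add_apply, AddMonoidHom.comp_apply, AddMonoidHom.coe_fst,
        AddMonoidHom.coe_snd, Prod.fst_add, Prod.snd_add, map_add]
      abel

/-- `eosp(q_N, q_P)`, the `A`-span of all `E_{n,p}` with `n ∈ N`, `p ∈ P`, inside
`End (N ⊕ P)`. -/
noncomputable def eospMixed {A N P : Type*} [Ring A] (𝒜 : ZMod 2 → AddSubgroup A)
    [DirectSum.Decomposition 𝒜] [AddCommGroup N] [AddCommGroup P] [Module A N] [Module A P]
    (𝒩 : ZMod 2 → AddSubgroup N) (𝓟 : ZMod 2 → AddSubgroup P)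
    [DirectSum.Decomposition 𝒩] [DirectSum.Decomposition 𝓟]
    (qN : N →+ N →+ A) (qP : P →+ P →+ A) : AddSubgroup (N × P →+ N × P) :=
  (Submodule.span A {f : N × P →+ N × P | ∃ (n : N) (p : P),
    f = eMap 𝒜 (prodGr 𝒩 𝓟) (orthSum qN qP) (n, 0) (0, p)}).toAddSubgroup

/-! ### The superalgebras `S^{(1)}`, `S^{(2)}`, `S^{(3)}` and `S_E` -/

section S

variable {K : Type w} [Ring K] (𝒦 : ZMod 2 → AddSubgroup K) [DirectSum.Decomposition 𝒦]
  {A : Type v} [Ring A]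
  {M : Type u} [AddCommGroup M] [Module K M] [Module A M] (ℳ : ZMod 2 → AddSubgroup M)
  [DirectSum.Decomposition ℳ]

variable (A) in
/-- `K`-endomorphisms of degree `α` with `[S, A·Id] ⊆ A·Id`. -/
noncomputable def s1Gr (α : ZMod 2) : AddSubgroup (M →+ M) where
  carrier := {S | (S ∈ endLin 𝒦 ℳ ∧ S ∈ endGr ℳ α) ∧
    ∀ a : A, ∃ b : A, sbr ℳ S (lmul M a) = lmul M b}
  zero_mem' := ⟨⟨zero_mem _, zero_mem _⟩, fun a => ⟨0, by simp [sbr_zero_left]⟩⟩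
  add_mem' {S T} hS hT := ⟨⟨add_mem hS.1.1 hT.1.1, add_mem hS.1.2 hT.1.2⟩, fun a => by
    obtain ⟨b, hb⟩ := hS.2 a
    obtain ⟨c, hc⟩ := hT.2 a
    exact ⟨b + c, by rw [sbr_add_left, hb, hc, map_add]⟩⟩
  neg_mem' {S} hS := ⟨⟨neg_mem hS.1.1, neg_mem hS.1.2⟩, fun a => by
    obtain ⟨b, hb⟩ := hS.2 a
    exact ⟨-b, by rw [sbr_neg_left, hb, map_neg]⟩⟩

/-- `K`-endomorphisms of degree `α` with
`[S, q(m,n)·Id] = (q(S(m),n) + (-1)^{|m||n|} q(S(n),m))·Id`. -/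
noncomputable def s2Gr (q : M →+ M →+ A) (α : ZMod 2) : AddSubgroup (M →+ M) where
  carrier := {S | (S ∈ endLin 𝒦 ℳ ∧ S ∈ endGr ℳ α) ∧
    ∀ β γ, ∀ m ∈ ℳ β, ∀ n ∈ ℳ γ,
      sbr ℳ S (lmul M (q m n)) = lmul M (q (S m) n + sgn β γ • q (S n) m)}
  zero_mem' := ⟨⟨zero_mem _, zero_mem _⟩, by simp [sbr_zero_left]⟩
  add_mem' {S T} hS hT := ⟨⟨add_mem hS.1.1 hT.1.1, add_mem hS.1.2 hT.1.2⟩,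
    fun β γ m hm n hn => by
      rw [sbr_add_left, hS.2 β γ m hm n hn, hT.2 β γ m hm n hn, ← map_add]
      congr 1
      simp only [AddMonoidHom.add_apply, map_add, smul_add]
      abel⟩
  neg_mem' {S} hS := ⟨⟨neg_mem hS.1.1, neg_mem hS.1.2⟩, fun β γ m hm n hn => by
    rw [sbr_neg_left, hS.2 β γ m hm n hn, ← map_neg]
    congr 1
    simp only [AddMonoidHom.neg_apply, map_neg, smul_neg]
    abel⟩

/-- `K`-endomorphisms of degree `α` with `[S, E] ⊆ E`. -/
noncomputable def s3Gr (E : AddSubgroup (M →+ M)) (α : ZMod 2) : AddSubgroup (M →+ M) where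
  carrier := {S | (S ∈ endLin 𝒦 ℳ ∧ S ∈ endGr ℳ α) ∧ ∀ x ∈ E, sbr ℳ S x ∈ E}
  zero_mem' := ⟨⟨zero_mem _, zero_mem _⟩, by simp [sbr_zero_left]⟩
  add_mem' {S T} hS hT := ⟨⟨add_mem hS.1.1 hT.1.1, add_mem hS.1.2 hT.1.2⟩, fun x hx => by
    rw [sbr_add_left]
    exact add_mem (hS.2 x hx) (hT.2 x hx)⟩
  neg_mem' {S} hS := ⟨⟨neg_mem hS.1.1, neg_mem hS.1.2⟩, fun x hx => by
    rw [sbr_neg_left]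
    exact neg_mem (hS.2 x hx)⟩

/-- `S^{(1)} ∩ S^{(2)}`, where `S^{(N)}` is the sum of its two homogeneous parts. -/
noncomputable def s12 (q : M →+ M →+ A) : AddSubgroup (M →+ M) :=
  (s1Gr 𝒦 A ℳ 0 ⊔ s1Gr 𝒦 A ℳ 1) ⊓ (s2Gr 𝒦 ℳ q 0 ⊔ s2Gr 𝒦 ℳ q 1)

/-- The part of degree `α` of `S_E`. -/
noncomputable def sEGr (q : M →+ M →+ A) (E : AddSubgroup (M →+ M)) (α : ZMod 2) :
    AddSubgroup (M →+ M) :=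
  s1Gr 𝒦 A ℳ α ⊓ s2Gr 𝒦 ℳ q α ⊓ s3Gr 𝒦 ℳ E α

/-- `S_E`. -/
noncomputable def sE (q : M →+ M →+ A) (E : AddSubgroup (M →+ M)) : AddSubgroup (M →+ M) :=
  sEGr 𝒦 ℳ q E 0 ⊔ sEGr 𝒦 ℳ q E 1

variable (A) in
open Classical in
/-- `ad_A S`: the map `Δ : A → A` with `[S, a·Id] = Δ(a)·Id` for all `a`. It exists and is unique
if `S ∈ S^{(1)}` and `M` has zero annihilator; the value is `0` if there is no such `Δ`. -/
noncomputable def adA (S : M →+ M) : A →+ A :=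
  if h : ∃ Δ : A →+ A, ∀ a, sbr ℳ S (lmul M a) = lmul M (Δ a) then h.choose else 0

end S

/-! ### Lie superalgebras over `K`, carried by subgroups of an ambient `K`-module -/

section Lie

variable {K : Type*} [Ring K] (𝒦 : ZMod 2 → AddSubgroup K)

/-- The subgroup `L` of `V`, graded by the subgroups `L ∩ gr α`, is a `K`-supermodule and the
bracket `br` makes it a Lie superalgebra over `K`. -/
structure IsLieSuperalgebra {V : Type*} [AddCommGroup V] [Module K V]
    (gr : ZMod 2 → AddSubgroup V) (L : AddSubgroup V) (br : V → V → V) : Prop where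
  smul_mem : ∀ k : K, ∀ x ∈ L, k • x ∈ L
  decompose : ∀ x ∈ L, ∃ y ∈ L, ∃ z ∈ L, y ∈ gr 0 ∧ z ∈ gr 1 ∧ x = y + z
  disjoint : ∀ x ∈ L, x ∈ gr 0 → x ∈ gr 1 → x = 0
  smul_degree : ∀ κ α, ∀ k ∈ 𝒦 κ, ∀ x ∈ L, x ∈ gr α → k • x ∈ gr (κ + α)
  br_mem : ∀ x ∈ L, ∀ y ∈ L, br x y ∈ L
  br_degree : ∀ α β, ∀ x ∈ L, ∀ y ∈ L, x ∈ gr α → y ∈ gr β → br x y ∈ gr (α + β)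
  add_br : ∀ x ∈ L, ∀ y ∈ L, ∀ z ∈ L, br (x + y) z = br x z + br y z
  br_add : ∀ x ∈ L, ∀ y ∈ L, ∀ z ∈ L, br x (y + z) = br x y + br x z
  smul_br : ∀ k : K, ∀ x ∈ L, ∀ y ∈ L, br (k • x) y = k • br x y
  br_smul : ∀ κ α, ∀ k ∈ 𝒦 κ, ∀ x ∈ L, x ∈ gr α → ∀ y ∈ L,
    br x (k • y) = sgn κ α • k • br x y
  skew : ∀ α β, ∀ x ∈ L, ∀ y ∈ L, x ∈ gr α → y ∈ gr β → br x y = -(sgn α β • br y x)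
  jacobi : ∀ α β γ, ∀ x ∈ L, ∀ y ∈ L, ∀ z ∈ L, x ∈ gr α → y ∈ gr β → z ∈ gr γ →
    sgn α γ • br (br x y) z + sgn β α • br (br y z) x + sgn γ β • br (br z x) y = 0

/-- `φ` restricts to an isomorphism of Lie superalgebras over `K` from `L` to `L'`. -/
structure IsLieSuperIso {V W : Type*} [AddCommGroup V] [Module K V] [AddCommGroup W] [Module K W]
    (grV : ZMod 2 → AddSubgroup V) (L : AddSubgroup V) (brV : V → V → V)
    (grW : ZMod 2 → AddSubgroup W) (L' : AddSubgroup W) (brW : W → W → W) (φ : V → W) :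
    Prop where
  source : IsLieSuperalgebra 𝒦 grV L brV
  target : IsLieSuperalgebra 𝒦 grW L' brW
  bijOn : Set.BijOn φ L L'
  map_add : ∀ x ∈ L, ∀ y ∈ L, φ (x + y) = φ x + φ y
  map_smul : ∀ k : K, ∀ x ∈ L, φ (k • x) = k • φ x
  map_degree : ∀ α, ∀ x ∈ L, x ∈ grV α → φ x ∈ grW α
  map_br : ∀ x ∈ L, ∀ y ∈ L, φ (brV x y) = brW (φ x) (φ y)

end Lie

/-! ### The direct sum attached to `M = N ⊕ P` -/

section Split

variable {A : Type*} [Ring A] (𝒜 : ZMod 2 → AddSubgroup A) [DirectSum.Decomposition 𝒜]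
  {N P : Type*} [AddCommGroup N] [AddCommGroup P] [Module A N] [Module A P]
  (𝒩 : ZMod 2 → AddSubgroup N) (𝓟 : ZMod 2 → AddSubgroup P)
  [DirectSum.Decomposition 𝒩] [DirectSum.Decomposition 𝓟]
  {I : Type*} (qN : N →+ N →+ A) (qP : P →+ P →+ A) (b : Module.Basis I A N) (bar : I → I)

/-- `(ad_A S)_N ⊕ S` on `N ⊕ P`, for an endomorphism `S` of `P`. -/
noncomputable def hat (S : P →+ P) : N × P →+ N × P :=
  (derExt qN b bar (adA A 𝓟 S)).prodMap S

/-- The map `x ⊕ S ↦ x ⊕ (ad_A S)_N ⊕ S`. A triple `(x, y, S)` stands for the element with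
components `x` in the closure of `eosp(q_N)`, `y` in the closure of `eosp(q_N, q_P)`, and
`S ∈ End P`; an endomorphism of `N` is extended by `0` on `P`. -/
noncomputable def splitMap (t : (N →+ N) × (N × P →+ N × P) × (P →+ P)) : N × P →+ N × P :=
  t.1.prodMap 0 + t.2.1 + hat 𝓟 qN b bar t.2.2

/-- The component `N → N` of an endomorphism of `N ⊕ P`. -/
def blockN (f : N × P →+ N × P) : N →+ N :=
  (AddMonoidHom.fst N P).comp (f.comp (AddMonoidHom.inl N P))

/-- The component `P → P` of an endomorphism of `N ⊕ P`. -/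
def blockP (f : N × P →+ N × P) : P →+ P :=
  (AddMonoidHom.snd N P).comp (f.comp (AddMonoidHom.inr N P))

/-- The bracket on the direct sum of the closure of `eosp(q_N)`, the closure of `eosp(q_N, q_P)`
and a superalgebra of endomorphisms `S` of `P`: the summands `eosp(q_N)` and `S` carry the
superbracket of endomorphisms, `S` acts on the others through `(ad_A S)_N ⊕ S`, and the bracket of
two elements of the closure of `eosp(q_N, q_P)` is distributed over the blocks `N → N` and
`P → P`. -/
noncomputable def splitBr (t t' : (N →+ N) × (N × P →+ N × P) × (P →+ P)) :
    (N →+ N) × (N × P →+ N × P) × (P →+ P) :=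
  (sbr 𝒩 t.1 t'.1 + blockN (sbr (prodGr 𝒩 𝓟) t.2.1 t'.2.1) +
      sbr 𝒩 (derExt qN b bar (adA A 𝓟 t.2.2)) t'.1 +
      sbr 𝒩 t.1 (derExt qN b bar (adA A 𝓟 t'.2.2)),
    sbr (prodGr 𝒩 𝓟) (t.1.prodMap 0) t'.2.1 + sbr (prodGr 𝒩 𝓟) t.2.1 (t'.1.prodMap 0) +
      sbr (prodGr 𝒩 𝓟) (hat 𝓟 qN b bar t.2.2) t'.2.1 +
      sbr (prodGr 𝒩 𝓟) t.2.1 (hat 𝓟 qN b bar t'.2.2),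
    sbr 𝓟 t.2.2 t'.2.2 + blockP (sbr (prodGr 𝒩 𝓟) t.2.1 t'.2.1))

/-- The grading of the direct sum. -/
def splitGr (α : ZMod 2) : AddSubgroup ((N →+ N) × (N × P →+ N × P) × (P →+ P)) :=
  (endGr 𝒩 α).prod ((endGr (prodGr 𝒩 𝓟) α).prod (endGr 𝓟 α))

/-- The direct sum of the closure of `eosp(q_N)`, the closure of `eosp(q_N, q_P)`, and `X`. -/
noncomputable def splitSum (X : AddSubgroup (P →+ P)) :
    AddSubgroup ((N →+ N) × (N × P →+ N × P) × (P →+ P)) :=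
  (eospBar 𝒜 𝒩 qN).prod ((summableClosure (eospMixed 𝒜 𝒩 𝓟 qN qP)).prod X)

end Split

/-! ### The Lie superalgebra `E_∞` and its derivations -/

section Infinity

variable {K : Type w} [Ring K] (𝒦 : ZMod 2 → AddSubgroup K)
  {A : Type v} [Ring A] (𝒜 : ZMod 2 → AddSubgroup A) [DirectSum.Decomposition 𝒜]
  {M : Type u} [AddCommGroup M] [Module A M] (ℳ : ZMod 2 → AddSubgroup M)
  [DirectSum.Decomposition ℳ]

/-- `E_∞ = {(a, m, n, x) | a ∈ A, m, n ∈ M, x ∈ E}`. -/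
def eInf (A : Type*) [Ring A] {M : Type*} [AddCommGroup M] (E : AddSubgroup (M →+ M)) :
    AddSubgroup (A × M × M × (M →+ M)) :=
  AddSubgroup.prod ⊤ (AddSubgroup.prod ⊤ (AddSubgroup.prod ⊤ E))

/-- The grading of `E_∞`. -/
def infGr {A : Type*} [Ring A] (𝒜 : ZMod 2 → AddSubgroup A) {M : Type*} [AddCommGroup M]
    (ℳ : ZMod 2 → AddSubgroup M) (α : ZMod 2) : AddSubgroup (A × M × M × (M →+ M)) :=
  (𝒜 α).prod ((ℳ α).prod ((ℳ α).prod (endGr ℳ α)))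

/-- The multiplication of `E_∞`. -/
noncomputable def infBr (q : M →+ M →+ A) (s t : A × M × M × (M →+ M)) :
    A × M × M × (M →+ M) :=
  let (a, m, n, x) := s
  let (a', m', n', x') := t
  (q m n' - q n m',
    a • m' + x m' - rmul 𝒜 ℳ m a' - sapp ℳ x' m,
    -(a • n') + x n' + rmul 𝒜 ℳ n a' - sapp ℳ x' n,
    eMap 𝒜 ℳ q m n' + eMap 𝒜 ℳ q n m' + sbr ℳ x x')

/-- `d` is homogeneous of degree `α` as a map of `E_∞`. -/
def HasDegree (E : AddSubgroup (M →+ M)) (α : ZMod 2) (d : eInf A E →+ eInf A E) : Prop :=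
  ∀ β, ∀ x : eInf A E, (x : A × M × M × (M →+ M)) ∈ infGr 𝒜 ℳ β →
    (d x : A × M × M × (M →+ M)) ∈ infGr 𝒜 ℳ (α + β)

/-- `d` is a `K`-derivation of `E_∞` of degree `α`; the condition `d(x k) = d(x) k` is written in
terms of the left action as `d(k x) = (-1)^{α|k|} k d(x)`. -/
structure IsHomDerivation [Module K A] [Module K M] (q : M →+ M →+ A) (E : AddSubgroup (M →+ M))
    (α : ZMod 2) (d : eInf A E →+ eInf A E) : Prop where
  degree : HasDegree 𝒜 ℳ E α d
  linear : ∀ κ, ∀ k ∈ 𝒦 κ, ∀ x y : eInf A E, (y : A × M × M × (M →+ M)) = k • x.1 →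
    (d y).1 = sgn α κ • k • (d x).1
  leibniz : ∀ β, ∀ x y z : eInf A E, x.1 ∈ infGr 𝒜 ℳ β → z.1 = infBr 𝒜 ℳ q x.1 y.1 →
    (d z).1 = infBr 𝒜 ℳ q (d x).1 y.1 + sgn α β • infBr 𝒜 ℳ q x.1 (d y).1

/-- `Der_K E_∞`. -/
def IsDerivation [Module K A] [Module K M] (q : M →+ M →+ A) (E : AddSubgroup (M →+ M))
    (d : eInf A E →+ eInf A E) : Prop :=
  ∃ d₀ d₁, IsHomDerivation 𝒦 𝒜 ℳ q E 0 d₀ ∧ IsHomDerivation 𝒦 𝒜 ℳ q E 1 d₁ ∧ d = d₀ + d₁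

/-- `ad E_∞`, the inner derivations. -/
def IsInner (q : M →+ M →+ A) (E : AddSubgroup (M →+ M)) (d : eInf A E →+ eInf A E) : Prop :=
  ∃ x : eInf A E, ∀ y : eInf A E, (d y).1 = infBr 𝒜 ℳ q x.1 y.1

/-- `ad_loc E_∞`, the locally inner derivations. -/
def IsLocallyInner [Module K A] [Module K M] (q : M →+ M →+ A) (E : AddSubgroup (M →+ M))
    (d : eInf A E →+ eInf A E) : Prop :=
  IsDerivation 𝒦 𝒜 ℳ q E d ∧
    ∀ F : Finset (eInf A E), ∃ x : eInf A E, ∀ y ∈ F, (d y).1 = infBr 𝒜 ℳ q x.1 y.1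

/-- `d = d_{S,0}`, that is, `d(a, m, n, x) = ([S, a·Id], S(m), S(n), [S, x])`, where `[S, a·Id]` is
identified with an element of `A`. -/
def IsDS (E : AddSubgroup (M →+ M)) (S : M →+ M) (d : eInf A E →+ eInf A E) : Prop :=
  ∀ v : eInf A E, (d v).1 = (adA A ℳ S v.1.1, S v.1.2.1, S v.1.2.2.1, sbr ℳ S v.1.2.2.2)

end Infinity

/-- `Der_K E_∞ ≅ J + X` for `M = N ⊕ P`: here `J` is a set of derivations of `E_∞` (inner or
locally inner ones) and `X` is a Lie superalgebra of endomorphisms `S` of `P`, embedded in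
`Der_K E_∞` by a monomorphism `ψ` of Lie superalgebras over `K`, namely
`S ↦ d_{S',0}` with `S' = (ad_A S)_N ⊕ S`. -/
def DerivationsEqSum {K : Type*} [Ring K] (𝒦 : ZMod 2 → AddSubgroup K)
    {A : Type*} [Ring A] (𝒜 : ZMod 2 → AddSubgroup A) [DirectSum.Decomposition 𝒜] [Module K A]
    {N P : Type*} [AddCommGroup N] [AddCommGroup P] [Module A N] [Module A P]
    [Module K N] [Module K P]
    (𝒩 : ZMod 2 → AddSubgroup N) (𝓟 : ZMod 2 → AddSubgroup P)
    [DirectSum.Decomposition 𝒩] [DirectSum.Decomposition 𝓟]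
    {I : Type*} (qN : N →+ N →+ A) (qP : P →+ P →+ A) (b : Module.Basis I A N) (bar : I → I)
    (E : AddSubgroup (N × P →+ N × P)) (J : (eInf A E →+ eInf A E) → Prop)
    (X : AddSubgroup (P →+ P)) : Prop :=
  IsLieSuperalgebra 𝒦 (infGr 𝒜 (prodGr 𝒩 𝓟)) (eInf A E)
      (infBr 𝒜 (prodGr 𝒩 𝓟) (orthSum qN qP)) ∧
    IsLieSuperalgebra 𝒦 (endGr 𝓟) X (sbr 𝓟) ∧
    ∃ ψ : X →+ (eInf A E →+ eInf A E),
      Function.Injective ψ ∧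
      (∀ S : X, IsDS (prodGr 𝒩 𝓟) E (hat 𝓟 qN b bar S.1) (ψ S)) ∧
      (∀ (k : K) (S S' : X), S'.1 = k • S.1 → ∀ v, (ψ S' v).1 = k • (ψ S v).1) ∧
      (∀ α, ∀ S : X, S.1 ∈ endGr 𝓟 α → HasDegree 𝒜 (prodGr 𝒩 𝓟) E α (ψ S)) ∧
      (∀ α β, ∀ S S' S'' : X, S.1 ∈ endGr 𝓟 α → S'.1 ∈ endGr 𝓟 β → S''.1 = sbr 𝓟 S.1 S'.1 →
        ψ S'' = (ψ S).comp (ψ S') - sgn α β • (ψ S').comp (ψ S)) ∧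
      ∀ d : eInf A E →+ eInf A E,
        IsDerivation 𝒦 𝒜 (prodGr 𝒩 𝓟) (orthSum qN qP) E d ↔
          ∃ e, J e ∧ ∃ S : X, d = e + ψ S

end OspDer

namespace OspDer

set_option linter.unusedSectionVars false
set_option linter.unnecessarySeqFocus false

/-! ### Signs and homogeneous elements -/

/-! The proof replaces the three conditions defining `s12` and `sE` by one notion. A homogeneous
endomorphism `S` of a faithful module satisfies the first two conditions exactly when some `Δ : A →+
A` makes `S` a `Δ`-derivation of the module structure and of the form (`IsSim`; `IsDer` for sums of
components). Faithfulness makes `Δ` unique, so that `Δ = adA S`, and makes it a derivation of `A`.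
The elements of `osp(q)` are exactly the derivations with `Δ = 0` (`mem_osp_iff`). Since `[S,
E_{m,n}] = E_{Sm,n} ± E_{m,Sn}` (`IsSim.sbr_eMap`), the third condition is automatic for the three
standard choices of `E` (`sE_eq_s12`), and the second isomorphism is the first one.

For the first isomorphism, let `T` be a derivation of `N ⊕ P` over `Δ`. Its `P → P` block `S` is a
derivation over the same `Δ`, and so is `hat S`, because `Δ_N` is a derivation of `(N, q_N)`
(`derExt_isSim`). Hence `T - hat S` is in `osp(q)` and has no `P → P` block. Its remaining pieces
are expanded with the basis `b` and its dual family `e`: for `x` in `osp(q)`, the sum over `i` of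
`E_{x(b_i), e_i}` is `xπ + πx`, with `π` the projection to `N` (`finsum_eMap`). This is `2x` for `x`
living on `N` and `x` itself for `x` exchanging `N` and `P`. So the two closures are all of
`osp(q_N)` and the whole off-diagonal part of `osp(q)`. The map respects brackets because `Δ ↦ Δ_N`
does (`derExt_sbr`): its coefficients are half logarithmic derivatives, which have no curvature.

For the derivations of `E_∞`, the element `(1, 0, 0, 0)` acts with eigenvalues `0, 1, -1`. After
subtraction of an inner derivation, a homogeneous derivation `d` preserves the eigenspaces and acts
on the two copies of `M` by maps `S` and `T`. The Leibniz rule shows that `S - T` supercommutes with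
every `E_{m,n}` up to scalars, and the rank-two summand forces such a map to be a scalar `a`
(`IsRankTwoPair.eq_lmul`). Subtracting the inner derivation of `(a/2, 0, 0, 0)` gives `S = T`, and
then `d = d_S` with `S` a derivation of `q`. Writing `S = R + hat S_P` with `R` in the closure of
`eosp(q)`, the derivation `d_R` is inner if `E` contains `R`; for `E = eosp(q)` finite partial sums
of `R` show that it is locally inner. -/

theorem zmod2_cases (α : ZMod 2) : α = 0 ∨ α = 1 := by
  revert α; decide

theorem one_add_one_zmod2 : (1 + 1 : ZMod 2) = 0 := by decide

@[simp] theorem sgn_zero_left (β : ZMod 2) : sgn 0 β = 1 := by simp [sgn]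

@[simp] theorem sgn_zero_right (α : ZMod 2) : sgn α 0 = 1 := by simp [sgn]

@[simp] theorem sgn_one_one : sgn 1 1 = -1 := by decide

theorem sgn_comm (α β : ZMod 2) : sgn α β = sgn β α := by simp [sgn, mul_comm]

theorem sgn_add_left (α β γ : ZMod 2) : sgn (α + β) γ = sgn α γ * sgn β γ := by
  rcases zmod2_cases α with rfl | rfl <;> rcases zmod2_cases β with rfl | rfl <;>
    rcases zmod2_cases γ with rfl | rfl <;> simp [one_add_one_zmod2]

theorem sgn_add_right (α β γ : ZMod 2) : sgn γ (α + β) = sgn γ α * sgn γ β := by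
  rw [sgn_comm, sgn_add_left, sgn_comm α, sgn_comm β]

@[simp] theorem sgn_mul_self (α β : ZMod 2) : sgn α β * sgn α β = 1 := by
  rcases zmod2_cases α with rfl | rfl <;> rcases zmod2_cases β with rfl | rfl <;> simp

@[simp] theorem sgn_smul_sgn_smul {M : Type*} [AddCommGroup M] (α β : ZMod 2) (m : M) :
    sgn α β • sgn α β • m = m := by
  rw [smul_smul, sgn_mul_self, one_smul]

theorem sum_zmod2 {M : Type*} [AddCommMonoid M] (f : ZMod 2 → M) : ∑ α, f α = f 0 + f 1 :=
  Fin.sum_univ_two f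

section Graded

variable {M : Type*} [AddCommGroup M] (ℳ : ZMod 2 → AddSubgroup M) [DirectSum.Decomposition ℳ]

theorem proj_zero_add_proj_one (m : M) : proj ℳ 0 m + proj ℳ 1 m = m := by
  rw [← sum_zmod2 fun α => proj ℳ α m, sum_proj]

theorem proj_of_mem {α β : ZMod 2} {m : M} (hm : m ∈ ℳ α) :
    proj ℳ β m = if α = β then m else 0 := by
  split_ifs with h
  · subst h; exact proj_same ℳ hm
  · exact proj_ne ℳ h hm

-- The reduction behind nearly all sign computations below: additive statements need only be checked
-- on homogeneous elements, and there the signs are settled by running through all degrees.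
include ℳ in
@[elab_as_elim]
theorem homog_induction {p : M → Prop} (m : M) (hadd : ∀ x y, p x → p y → p (x + y))
    (hom : ∀ α, ∀ x ∈ ℳ α, p x) : p m := by
  rw [← proj_zero_add_proj_one ℳ m]
  exact hadd _ _ (hom 0 _ (proj_mem ℳ 0 m)) (hom 1 _ (proj_mem ℳ 1 m))

theorem homog_ext {X : Type*} [AddCommGroup X] {f g : M →+ X}
    (h : ∀ α, ∀ m ∈ ℳ α, f m = g m) : f = g := by
  ext m
  refine homog_induction ℳ m (fun x y hx hy => ?_) h
  rw [map_add, map_add, hx, hy]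

theorem eq_zero_of_mem_mem {m : M} (h0 : m ∈ ℳ 0) (h1 : m ∈ ℳ 1) : m = 0 := by
  rw [← proj_same ℳ h0]
  exact proj_ne ℳ (by decide) h1

theorem endProj_apply (f : M →+ M) (α : ZMod 2) (m : M) :
    endProj ℳ α f m = proj ℳ α (f (proj ℳ 0 m)) + proj ℳ (α + 1) (f (proj ℳ 1 m)) := by
  simp [endProj, sum_zmod2]

theorem endProj_apply_of_mem (f : M →+ M) (α : ZMod 2) {β : ZMod 2} {m : M} (hm : m ∈ ℳ β) :
    endProj ℳ α f m = proj ℳ (α + β) (f m) := by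
  rcases zmod2_cases β with rfl | rfl <;> simp [endProj_apply, proj_of_mem ℳ hm]

theorem endProj_mem (f : M →+ M) (α : ZMod 2) : endProj ℳ α f ∈ endGr ℳ α := by
  intro β m hm
  rw [endProj_apply_of_mem ℳ f α hm]
  exact proj_mem ℳ _ _

theorem endProj_zero_add_endProj_one (f : M →+ M) : endProj ℳ 0 f + endProj ℳ 1 f = f := by
  refine homog_ext ℳ fun α m hm => ?_
  rw [AddMonoidHom.add_apply, endProj_apply_of_mem ℳ f _ hm, endProj_apply_of_mem ℳ f _ hm]
  rcases zmod2_cases α with rfl | rfl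
  · simpa using proj_zero_add_proj_one ℳ (f m)
  · rw [add_comm]; simpa [one_add_one_zmod2] using proj_zero_add_proj_one ℳ (f m)

theorem endProj_of_mem {f : M →+ M} {α β : ZMod 2} (hf : f ∈ endGr ℳ α) :
    endProj ℳ β f = if α = β then f else 0 := by
  refine homog_ext ℳ fun γ m hm => ?_
  rw [endProj_apply_of_mem ℳ f _ hm, proj_of_mem ℳ (hf γ m hm)]
  by_cases h : α = β <;> simp [h]

theorem endProj_same {f : M →+ M} {α : ZMod 2} (hf : f ∈ endGr ℳ α) : endProj ℳ α f = f := by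
  simp [endProj_of_mem ℳ hf]

include ℳ in
@[elab_as_elim]
theorem end_homog_induction {p : (M →+ M) → Prop} (f : M →+ M)
    (hadd : ∀ x y, p x → p y → p (x + y)) (hom : ∀ α, ∀ x ∈ endGr ℳ α, p x) : p f := by
  rw [← endProj_zero_add_endProj_one ℳ f]
  exact hadd _ _ (hom 0 _ (endProj_mem ℳ f 0)) (hom 1 _ (endProj_mem ℳ f 1))

/-! ### The superbracket -/

theorem sbr_apply (f g : M →+ M) (m : M) : sbr ℳ f g m =
    f (g m) - (endProj ℳ 0 g (endProj ℳ 0 f m) + endProj ℳ 1 g (endProj ℳ 0 f m) +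
      (endProj ℳ 0 g (endProj ℳ 1 f m) - endProj ℳ 1 g (endProj ℳ 1 f m))) := by
  simp [sbr, sum_zmod2, sub_eq_add_neg]

theorem sbr_of_mem {f g : M →+ M} {α β : ZMod 2} (hf : f ∈ endGr ℳ α) (hg : g ∈ endGr ℳ β) :
    sbr ℳ f g = f.comp g - sgn α β • g.comp f := by
  ext m
  rw [sbr_apply]
  rcases zmod2_cases α with rfl | rfl <;> rcases zmod2_cases β with rfl | rfl <;>
    simp [endProj_of_mem ℳ hf, endProj_of_mem ℳ hg]

theorem sbr_add_right (f g g' : M →+ M) : sbr ℳ f (g + g') = sbr ℳ f g + sbr ℳ f g' := by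
  ext m
  simp only [sbr_apply, AddMonoidHom.add_apply, map_add]
  abel

/-- The superbracket as a biadditive map. -/
noncomputable def sbrHom : (M →+ M) →+ (M →+ M) →+ (M →+ M) :=
  AddMonoidHom.mk' (fun f => AddMonoidHom.mk' (sbr ℳ f) (sbr_add_right ℳ f)) fun f g => by
    ext1 x
    exact sbr_add_left ℳ f g x

theorem sbrHom_apply (f g : M →+ M) : sbrHom ℳ f g = sbr ℳ f g := rfl

theorem sbr_zero_right (f : M →+ M) : sbr ℳ f 0 = 0 := map_zero (sbrHom ℳ f)

theorem sbr_neg_right (f g : M →+ M) : sbr ℳ f (-g) = -sbr ℳ f g := map_neg (sbrHom ℳ f) g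

theorem sbr_zsmul_right (f g : M →+ M) (k : ℤ) : sbr ℳ f (k • g) = k • sbr ℳ f g :=
  map_zsmul (sbrHom ℳ f) k g

theorem sbr_sub_left (f f' g : M →+ M) : sbr ℳ (f - f') g = sbr ℳ f g - sbr ℳ f' g := by
  simp_rw [← sbrHom_apply, map_sub]; rfl

omit [DirectSum.Decomposition ℳ] in
theorem comp_mem_endGr {f g : M →+ M} {α β : ZMod 2} (hf : f ∈ endGr ℳ α)
    (hg : g ∈ endGr ℳ β) : f.comp g ∈ endGr ℳ (α + β) := fun γ m hm => by
  rw [add_assoc]; exact hf _ _ (hg _ _ hm)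

theorem sbr_mem_endGr {f g : M →+ M} {α β : ZMod 2} (hf : f ∈ endGr ℳ α)
    (hg : g ∈ endGr ℳ β) : sbr ℳ f g ∈ endGr ℳ (α + β) := by
  rw [sbr_of_mem ℳ hf hg]
  refine sub_mem (comp_mem_endGr ℳ hf hg) (zsmul_mem ?_ _)
  rw [add_comm]; exact comp_mem_endGr ℳ hg hf

theorem sbr_skew {f g : M →+ M} {α β : ZMod 2} (hf : f ∈ endGr ℳ α) (hg : g ∈ endGr ℳ β) :
    sbr ℳ f g = -(sgn α β • sbr ℳ g f) := by
  rw [sbr_of_mem ℳ hf hg, sbr_of_mem ℳ hg hf, sgn_comm β α, smul_sub, sgn_smul_sgn_smul]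
  abel

/-- The Jacobi identity in Leibniz form; it is associativity of composition. The last argument need
not be homogeneous, since the signs involve only the degrees of `f` and `g`. -/
theorem sbr_leibniz {f g h : M →+ M} {α β : ZMod 2} (hf : f ∈ endGr ℳ α)
    (hg : g ∈ endGr ℳ β) :
    sbr ℳ f (sbr ℳ g h) = sbr ℳ (sbr ℳ f g) h + sgn α β • sbr ℳ g (sbr ℳ f h) := by
  refine end_homog_induction ℳ h (fun x y hx hy => ?_) fun γ h hh => ?_
  · simp only [sbr_add_right, hx, hy, smul_add]; abel
  · rw [sbr_of_mem ℳ hf (sbr_mem_endGr ℳ hg hh), sbr_of_mem ℳ (sbr_mem_endGr ℳ hf hg) hh,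
      sbr_of_mem ℳ hg (sbr_mem_endGr ℳ hf hh), sbr_of_mem ℳ hf hg, sbr_of_mem ℳ hg hh,
      sbr_of_mem ℳ hf hh]
    ext m
    rcases zmod2_cases α with rfl | rfl <;> rcases zmod2_cases β with rfl | rfl <;>
      rcases zmod2_cases γ with rfl | rfl <;> simp [one_add_one_zmod2] <;> abel

theorem sapp_of_mem {x : M →+ M} {m : M} {α β : ZMod 2} (hx : x ∈ endGr ℳ α) (hm : m ∈ ℳ β) :
    sapp ℳ x m = sgn α β • x m := by
  rcases zmod2_cases α with rfl | rfl <;> rcases zmod2_cases β with rfl | rfl <;>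
    simp [sapp, sum_zmod2, endProj_of_mem ℳ hx, proj_of_mem ℳ hm]

theorem sapp_add_right (x : M →+ M) (m n : M) : sapp ℳ x (m + n) = sapp ℳ x m + sapp ℳ x n := by
  simp [sapp, Finset.sum_add_distrib]

theorem sapp_add_left (x y : M →+ M) (m : M) : sapp ℳ (x + y) m = sapp ℳ x m + sapp ℳ y m := by
  simp [sapp, Finset.sum_add_distrib]

@[simp] theorem sapp_zero_right (x : M →+ M) : sapp ℳ x 0 = 0 := by simp [sapp]

@[simp] theorem sapp_zero_left (m : M) : sapp ℳ 0 m = 0 := by simp [sapp]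

end Graded

/-! ### Left and right actions, and linearity of homogeneous endomorphisms. -/

section Actions

variable {R : Type*} [Ring R] (ℛ : ZMod 2 → AddSubgroup R) [DirectSum.Decomposition ℛ]
  {M : Type*} [AddCommGroup M] [Module R M] (ℳ : ZMod 2 → AddSubgroup M)
  [DirectSum.Decomposition ℳ]

theorem rmul_of_mem {a : R} {m : M} {α β : ZMod 2} (ha : a ∈ ℛ α) (hm : m ∈ ℳ β) :
    rmul ℛ ℳ m a = sgn α β • a • m := by
  rcases zmod2_cases α with rfl | rfl <;> rcases zmod2_cases β with rfl | rfl <;>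
    simp [rmul, sum_zmod2, proj_of_mem ℛ ha, proj_of_mem ℳ hm]

theorem rmul_of_left_mem_zero {a : R} (m : M) (ha : a ∈ ℛ 0) : rmul ℛ ℳ m a = a • m := by
  refine homog_induction ℳ m (fun x y hx hy => ?_) fun β m hm => ?_
  · rw [rmul_add, AddMonoidHom.add_apply, hx, hy, smul_add]
  · rw [rmul_of_mem ℛ ℳ ha hm]; simp

theorem rmul_of_right_mem_zero (a : R) {m : M} (hm : m ∈ ℳ 0) : rmul ℛ ℳ m a = a • m := by
  refine homog_induction ℛ a (fun x y hx hy => ?_) fun β m ha => ?_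
  · rw [map_add, hx, hy, add_smul]
  · rw [rmul_of_mem ℛ ℳ ha hm]; simp

/-- The right action as a biadditive map. -/
noncomputable def rmulHom : M →+ R →+ M := AddMonoidHom.mk' (rmul ℛ ℳ) (rmul_add ℛ ℳ)

@[simp] theorem rmul_zero_left : rmul ℛ ℳ (0 : M) = 0 := map_zero (rmulHom ℛ ℳ)

/-- For a homogeneous endomorphism, `f (m a) = f(m) a` in terms of the left action. -/
theorem mem_endLin_iff_of_mem {f : M →+ M} {σ : ZMod 2} (hf : f ∈ endGr ℳ σ) :
    f ∈ endLin ℛ ℳ ↔ ∀ κ, ∀ a ∈ ℛ κ, ∀ m, f (a • m) = sgn σ κ • a • f m := by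
  constructor
  · intro h κ a ha m
    refine homog_induction ℳ m (fun x y hx hy => ?_) fun β m hm => ?_
    · simp only [smul_add, map_add, hx, hy]
    · have := h m a
      rw [rmul_of_mem ℛ ℳ ha hm, rmul_of_mem ℛ ℳ ha (hf β m hm), map_zsmul, sgn_add_right,
        mul_comm, mul_smul] at this
      have h2 := congrArg (fun z => sgn κ β • z) this
      simpa [sgn_comm] using h2
  · intro h m a
    refine homog_induction ℳ m (fun x y hx hy => ?_) fun β m hm => ?_
    · simp only [rmul_add, AddMonoidHom.add_apply, map_add, hx, hy]
    · refine homog_induction ℛ a (fun x y hx hy => ?_) fun κ a ha => ?_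
      · simp only [map_add, hx, hy]
      · rw [rmul_of_mem ℛ ℳ ha hm, rmul_of_mem ℛ ℳ ha (hf β m hm), map_zsmul, h κ a ha m,
          sgn_add_right, mul_comm, mul_smul, sgn_comm σ κ]

variable [SetLike.GradedSMul ℛ ℳ]

omit [DirectSum.Decomposition ℛ] [DirectSum.Decomposition ℳ] in
theorem smul_mem_gr {a : R} {m : M} {α β : ZMod 2} (ha : a ∈ ℛ α) (hm : m ∈ ℳ β) :
    a • m ∈ ℳ (α + β) :=
  SetLike.GradedSMul.smul_mem ha hm

omit [DirectSum.Decomposition ℛ] in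
theorem proj_smul_of_mem {a : R} {α : ZMod 2} (ha : a ∈ ℛ α) (m : M) (β : ZMod 2) :
    proj ℳ (α + β) (a • m) = a • proj ℳ β m := by
  refine homog_induction ℳ m (fun x y hx hy => ?_) fun γ m hm => ?_
  · simp only [smul_add, map_add, hx, hy]
  · rw [proj_of_mem ℳ hm, proj_of_mem ℳ (smul_mem_gr ℛ ℳ ha hm)]
    by_cases h : γ = β <;> simp [h]

/-- Right multiplication by a homogeneous scalar shifts all degrees by the same amount, so it
commutes with taking components. This is needed because `osp(q)` is defined without reference to
homogeneous maps. -/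
theorem endProj_mem_endLin {f : M →+ M} (hf : f ∈ endLin ℛ ℳ) (α : ZMod 2) :
    endProj ℳ α f ∈ endLin ℛ ℳ := by
  intro m a
  refine homog_induction ℳ m (fun x y hx hy => ?_) fun β m hm => ?_
  · simp only [rmul_add, AddMonoidHom.add_apply, map_add, hx, hy]
  · refine homog_induction ℛ a (fun x y hx hy => ?_) fun κ a ha => ?_
    · simp only [map_add, hx, hy]
    · have hm' : rmul ℛ ℳ m a ∈ ℳ (κ + β) := by
        rw [rmul_of_mem ℛ ℳ ha hm]
        exact zsmul_mem (smul_mem_gr ℛ ℳ ha hm) _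
      rw [endProj_apply_of_mem ℳ f α hm, endProj_apply_of_mem ℳ f α hm', hf m a]
      have key : ∀ (γ : ZMod 2) (x : M),
          proj ℳ (κ + γ) (rmul ℛ ℳ x a) = rmul ℛ ℳ (proj ℳ γ x) a := by
        intro γ x
        refine homog_induction ℳ x (fun x y hx hy => ?_) fun δ x hx => ?_
        · simp only [rmul_add, AddMonoidHom.add_apply, map_add, hx, hy]
        · rw [rmul_of_mem ℛ ℳ ha hx, map_zsmul, proj_smul_of_mem ℛ ℳ ha, proj_of_mem ℳ hx]
          split_ifs
          · rw [rmul_of_mem ℛ ℳ ha hx]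
          · simp
      rw [show α + (κ + β) = κ + (α + β) by abel, key]

end Actions

/-! ### Quadratic forms and the maps `E_{m,n}` -/

section Forms

variable {A : Type*} [Ring A] {𝒜 : ZMod 2 → AddSubgroup A} [GradedRing 𝒜]
  {M : Type*} [AddCommGroup M] [Module A M] {ℳ : ZMod 2 → AddSubgroup M}
  [DirectSum.Decomposition ℳ] {q : M →+ M →+ A}

omit [GradedRing 𝒜] in
theorem IsSupercommutative.comm (hA : IsSupercommutative 𝒜) {α β : ZMod 2} {a b : A}
    (ha : a ∈ 𝒜 α) (hb : b ∈ 𝒜 β) : a * b = sgn α β • (b * a) := hA α β a b ha hb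

theorem IsSupercommutative.comm_of_mem_zero (hA : IsSupercommutative 𝒜) {a : A} (ha : a ∈ 𝒜 0)
    (b : A) : a * b = b * a := by
  refine homog_induction 𝒜 b (fun x y hx hy => ?_) fun β b hb => ?_
  · rw [mul_add, add_mul, hx, hy]
  · simpa using hA.comm ha hb

variable [SetLike.GradedSMul 𝒜 ℳ]

/-- The axioms contain only right linearity and balancedness. Left linearity follows by exchanging
the two arguments with supersymmetry, pulling the scalar out on the right, and moving it back with
supercommutativity. -/
theorem IsQuadraticForm.smul_left (hA : IsSupercommutative 𝒜) (hq : IsQuadraticForm 𝒜 ℳ q)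
    (a : A) (m n : M) : q (a • m) n = a * q m n := by
  refine homog_induction 𝒜 a (fun x y hx hy => ?_) fun κ a ha => ?_
  · rw [add_smul, map_add, AddMonoidHom.add_apply, hx, hy, add_mul]
  refine homog_induction ℳ m (fun x y hx hy => ?_) fun β m hm => ?_
  · rw [smul_add, map_add, AddMonoidHom.add_apply, hx, hy, map_add, AddMonoidHom.add_apply,
      mul_add]
  refine homog_induction ℳ n (fun x y hx hy => ?_) fun γ n hn => ?_
  · rw [map_add, hx, hy, map_add, mul_add]
  have h1 := hq.right_linear n m a
  rw [rmul_of_mem 𝒜 ℳ ha hm, map_zsmul] at h1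
  have h2 : q n (a • m) = sgn κ β • (q n m * a) := by rw [← h1, sgn_smul_sgn_smul]
  rw [hq.supersymm _ _ _ (smul_mem_gr 𝒜 ℳ ha hm) _ hn, h2, hq.supersymm γ β n hn m hm,
    smul_mul_assoc, hA.comm (hq.degree _ _ _ hm _ hn) ha]
  rcases zmod2_cases κ with rfl | rfl <;> rcases zmod2_cases β with rfl | rfl <;>
      rcases zmod2_cases γ with rfl | rfl <;> simp [one_add_one_zmod2]

theorem IsQuadraticForm.smul_right (hA : IsSupercommutative 𝒜) (hq : IsQuadraticForm 𝒜 ℳ q)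
    {a : A} {m : M} {κ β : ZMod 2} (ha : a ∈ 𝒜 κ) (hm : m ∈ ℳ β) (n : M) :
    q m (a • n) = sgn κ β • (a * q m n) := by
  rw [← hq.balanced, rmul_of_mem 𝒜 ℳ ha hm, map_zsmul, AddMonoidHom.smul_apply,
    hq.smul_left hA]

theorem IsQuadraticForm.smul_right_of_mem_zero (hA : IsSupercommutative 𝒜)
    (hq : IsQuadraticForm 𝒜 ℳ q) (a : A) {m : M} (hm : m ∈ ℳ 0) (n : M) :
    q m (a • n) = a * q m n := by
  rw [← hq.balanced, rmul_of_right_mem_zero 𝒜 ℳ a hm, hq.smul_left hA]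

omit [SetLike.GradedSMul 𝒜 ℳ] in
theorem eMap_apply_of_mem (q : M →+ M →+ A) (m : M) {n p : M} {β γ : ZMod 2}
    (hn : n ∈ ℳ β) (hp : p ∈ ℳ γ) :
    eMap 𝒜 ℳ q m n p = rmul 𝒜 ℳ m (q n p) - sgn β γ • q m p • n := by
  rcases zmod2_cases β with rfl | rfl <;> rcases zmod2_cases γ with rfl | rfl <;>
    simp [eMap, sum_zmod2, proj_of_mem ℳ hn, proj_of_mem ℳ hp]

omit [SetLike.GradedSMul 𝒜 ℳ] in
theorem IsQuadraticForm.eMap_apply (hq : IsQuadraticForm 𝒜 ℳ q) {m n p : M} {α β γ : ZMod 2}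
    (hm : m ∈ ℳ α) (hn : n ∈ ℳ β) (hp : p ∈ ℳ γ) :
    eMap 𝒜 ℳ q m n p = sgn (β + γ) α • q n p • m - sgn β γ • q m p • n := by
  rw [eMap_apply_of_mem q m hn hp, rmul_of_mem 𝒜 ℳ (hq.degree _ _ _ hn _ hp) hm]

omit [SetLike.GradedSMul 𝒜 ℳ] in
theorem eMap_add_left (q : M →+ M →+ A) (m m' n : M) :
    eMap 𝒜 ℳ q (m + m') n = eMap 𝒜 ℳ q m n + eMap 𝒜 ℳ q m' n := by
  refine homog_ext ℳ fun γ p hp => ?_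
  refine homog_induction ℳ n (fun x y hx hy => ?_) fun β n hn => ?_
  · simp only [eMap, rmul_add, map_add, AddMonoidHom.add_apply, AddMonoidHom.sub_apply,
      AddMonoidHom.comp_apply, sum_zmod2, smul_add, AddMonoidHom.smul_apply,
      AddMonoidHom.flip_apply, smulAddHom_apply]
    abel
  · simp only [AddMonoidHom.add_apply, eMap_apply_of_mem q _ hn hp, rmul_add, map_add, add_smul,
      smul_add]
    abel

omit [SetLike.GradedSMul 𝒜 ℳ] in
theorem eMap_add_right (q : M →+ M →+ A) (m n n' : M) :
    eMap 𝒜 ℳ q m (n + n') = eMap 𝒜 ℳ q m n + eMap 𝒜 ℳ q m n' := by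
  ext p
  simp only [eMap, map_add, AddMonoidHom.add_apply, AddMonoidHom.sub_apply,
    AddMonoidHom.comp_apply, sum_zmod2, smul_add, AddMonoidHom.smul_apply,
    AddMonoidHom.flip_apply, smulAddHom_apply]
  abel

variable (𝒜 ℳ q) in
/-- `E_{m,n}` as a biadditive map. -/
noncomputable def eMapHom : M →+ M →+ (M →+ M) :=
  AddMonoidHom.mk' (fun m => AddMonoidHom.mk' (eMap 𝒜 ℳ q m) (eMap_add_right q m)) fun m n => by
    ext1 x
    exact eMap_add_left q m n x

omit [SetLike.GradedSMul 𝒜 ℳ] in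
theorem eMapHom_apply (m n : M) : eMapHom 𝒜 ℳ q m n = eMap 𝒜 ℳ q m n := rfl

omit [SetLike.GradedSMul 𝒜 ℳ] in
@[simp] theorem eMap_zero_left (n : M) : eMap 𝒜 ℳ q 0 n = 0 := by
  rw [← eMapHom_apply, map_zero]; rfl

omit [SetLike.GradedSMul 𝒜 ℳ] in
@[simp] theorem eMap_zero_right (m : M) : eMap 𝒜 ℳ q m 0 = 0 := by
  rw [← eMapHom_apply, map_zero]

omit [SetLike.GradedSMul 𝒜 ℳ] in
@[simp] theorem eMap_neg_left (m n : M) : eMap 𝒜 ℳ q (-m) n = -eMap 𝒜 ℳ q m n := by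
  simp_rw [← eMapHom_apply, map_neg]; rfl

omit [SetLike.GradedSMul 𝒜 ℳ] in
@[simp] theorem eMap_neg_right (m n : M) : eMap 𝒜 ℳ q m (-n) = -eMap 𝒜 ℳ q m n := by
  simp_rw [← eMapHom_apply, map_neg]

omit [SetLike.GradedSMul 𝒜 ℳ] in
theorem eMap_sub_left (m m' n : M) :
    eMap 𝒜 ℳ q (m - m') n = eMap 𝒜 ℳ q m n - eMap 𝒜 ℳ q m' n := by
  simp_rw [← eMapHom_apply, map_sub]; rfl

omit [SetLike.GradedSMul 𝒜 ℳ] in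
theorem eMap_sub_right (m n n' : M) :
    eMap 𝒜 ℳ q m (n - n') = eMap 𝒜 ℳ q m n - eMap 𝒜 ℳ q m n' := by
  simp_rw [← eMapHom_apply, map_sub]

omit [SetLike.GradedSMul 𝒜 ℳ] in
theorem eMap_zsmul_left (k : ℤ) (m n : M) :
    eMap 𝒜 ℳ q (k • m) n = k • eMap 𝒜 ℳ q m n := by
  simp_rw [← eMapHom_apply, map_zsmul]; rfl

omit [SetLike.GradedSMul 𝒜 ℳ] in
theorem eMap_zsmul_right (k : ℤ) (m n : M) :
    eMap 𝒜 ℳ q m (k • n) = k • eMap 𝒜 ℳ q m n := by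
  simp_rw [← eMapHom_apply, map_zsmul]

omit [SetLike.GradedSMul 𝒜 ℳ] in
theorem IsQuadraticForm.eMap_skew (hq : IsQuadraticForm 𝒜 ℳ q) {m n : M} {α β : ZMod 2}
    (hm : m ∈ ℳ α) (hn : n ∈ ℳ β) : eMap 𝒜 ℳ q m n = -(sgn α β • eMap 𝒜 ℳ q n m) := by
  refine homog_ext ℳ fun γ p hp => ?_
  simp only [AddMonoidHom.neg_apply, AddMonoidHom.smul_apply, hq.eMap_apply hm hn hp,
    hq.eMap_apply hn hm hp]
  rcases zmod2_cases α with rfl | rfl <;> rcases zmod2_cases β with rfl | rfl <;>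
      rcases zmod2_cases γ with rfl | rfl <;> simp [one_add_one_zmod2] <;> abel

theorem IsQuadraticForm.eMap_mem_endGr (hq : IsQuadraticForm 𝒜 ℳ q) {m n : M} {α β : ZMod 2}
    (hm : m ∈ ℳ α) (hn : n ∈ ℳ β) : eMap 𝒜 ℳ q m n ∈ endGr ℳ (α + β) := by
  intro γ p hp
  rw [hq.eMap_apply hm hn hp]
  refine sub_mem (zsmul_mem ?_ _) (zsmul_mem ?_ _)
  · rw [show α + β + γ = β + γ + α by abel]
    exact smul_mem_gr 𝒜 ℳ (hq.degree _ _ _ hn _ hp) hm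
  · rw [show α + β + γ = α + γ + β by abel]
    exact smul_mem_gr 𝒜 ℳ (hq.degree _ _ _ hm _ hp) hn

/-- Consequently the `ℤ`-span `eosp(q)` is already stable under `A`, which is what permits halving
and multiplication by elements of `K`. -/
theorem IsQuadraticForm.eMap_smul_left (hA : IsSupercommutative 𝒜) (hq : IsQuadraticForm 𝒜 ℳ q)
    (a : A) (m n : M) : eMap 𝒜 ℳ q (a • m) n = a • eMap 𝒜 ℳ q m n := by
  refine homog_ext ℳ fun γ p hp => ?_
  refine homog_induction 𝒜 a (fun x y hx hy => ?_) fun κ a ha => ?_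
  · simp only [AddMonoidHom.smul_apply, add_smul, eMap_add_left, AddMonoidHom.add_apply] at *
    rw [hx, hy]
  refine homog_induction ℳ m (fun x y hx hy => ?_) fun α m hm => ?_
  · simp only [AddMonoidHom.smul_apply, smul_add, eMap_add_left, AddMonoidHom.add_apply] at *
    rw [hx, hy]
  refine homog_induction ℳ n (fun x y hx hy => ?_) fun β n hn => ?_
  · simp only [AddMonoidHom.smul_apply, smul_add, eMap_add_right, AddMonoidHom.add_apply] at *
    rw [hx, hy]
  rw [AddMonoidHom.smul_apply, hq.eMap_apply hm hn hp,
    hq.eMap_apply (smul_mem_gr 𝒜 ℳ ha hm) hn hp, hq.smul_left hA, smul_smul,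
    hA.comm (hq.degree _ _ _ hn _ hp) ha, smul_sub, smul_comm a (sgn _ _ : ℤ),
    smul_comm a (sgn _ _ : ℤ), smul_smul a, smul_smul a]
  rcases zmod2_cases α with rfl | rfl <;> rcases zmod2_cases β with rfl | rfl <;>
      rcases zmod2_cases γ with rfl | rfl <;> rcases zmod2_cases κ with rfl | rfl <;>
      simp [one_add_one_zmod2]

theorem IsQuadraticForm.eMap_smul_right (hA : IsSupercommutative 𝒜)
    (hq : IsQuadraticForm 𝒜 ℳ q) {a : A} {m n : M} {κ α : ZMod 2} (ha : a ∈ 𝒜 κ)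
    (hm : m ∈ ℳ α) : eMap 𝒜 ℳ q m (a • n) = sgn κ α • a • eMap 𝒜 ℳ q m n := by
  refine homog_induction ℳ n (fun x y hx hy => ?_) fun β n hn => ?_
  · simp only [smul_add, eMap_add_right, hx, hy]
  rw [hq.eMap_skew hm (smul_mem_gr 𝒜 ℳ ha hn), hq.eMap_smul_left hA, hq.eMap_skew hm hn]
  rcases zmod2_cases α with rfl | rfl <;> rcases zmod2_cases β with rfl | rfl <;>
      rcases zmod2_cases κ with rfl | rfl <;> simp [one_add_one_zmod2]

end Forms

/-! ### Derivations of a quadratic form -/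

/-- `S` is a `K`-linear endomorphism of degree `σ` of `M` which, together with the endomorphism
`Δ` of `A`, acts by derivations on the module structure and on the quadratic form. -/
structure IsSim {K : Type*} [Ring K] (𝒦 : ZMod 2 → AddSubgroup K)
    {A : Type*} [Ring A] (𝒜 : ZMod 2 → AddSubgroup A)
    {M : Type*} [AddCommGroup M] [Module K M] [Module A M] (ℳ : ZMod 2 → AddSubgroup M)
    (q : M →+ M →+ A) (σ : ZMod 2) (S : M →+ M) (Δ : A →+ A) : Prop where
  degree : S ∈ endGr ℳ σ
  degA : Δ ∈ endGr 𝒜 σ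
  linear : ∀ κ, ∀ k ∈ 𝒦 κ, ∀ m, S (k • m) = sgn σ κ • k • S m
  smul : ∀ κ, ∀ a ∈ 𝒜 κ, ∀ m, S (a • m) = Δ a • m + sgn σ κ • a • S m
  form : ∀ β, ∀ m ∈ ℳ β, ∀ n, Δ (q m n) = q (S m) n + sgn σ β • q m (S n)

section Sim

variable {K : Type*} [Ring K] {𝒦 : ZMod 2 → AddSubgroup K} [GradedRing 𝒦]
  {A : Type*} [Ring A] {𝒜 : ZMod 2 → AddSubgroup A} [GradedRing 𝒜]
  [Module K A] [SetLike.GradedSMul 𝒦 𝒜]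
  {M : Type*} [AddCommGroup M] [Module A M] [Module K M] [IsScalarTower K A M]
  {ℳ : ZMod 2 → AddSubgroup M}
  [DirectSum.Decomposition ℳ] [SetLike.GradedSMul 𝒜 ℳ] {q : M →+ M →+ A}

omit [GradedRing 𝒦] in
theorem smul_one_mem {κ : ZMod 2} {k : K} (hk : k ∈ 𝒦 κ) : k • (1 : A) ∈ 𝒜 κ := by
  have h := smul_mem_gr 𝒦 𝒜 hk (SetLike.GradedOne.one_mem (A := 𝒜))
  rwa [add_zero] at h

omit [GradedRing 𝒦] [DirectSum.Decomposition ℳ] in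
include 𝒜 in
theorem ksmul_mem_gr {κ β : ZMod 2} {k : K} {m : M} (hk : k ∈ 𝒦 κ) (hm : m ∈ ℳ β) :
    k • m ∈ ℳ (κ + β) := by
  rw [← one_smul A m, ← smul_assoc]
  exact smul_mem_gr 𝒜 ℳ (smul_one_mem hk) hm

omit [GradedRing 𝒦] [DirectSum.Decomposition ℳ] [SetLike.GradedSMul 𝒜 ℳ] in
/-- An `A`-linear endomorphism of a quadratic form which is compatible with it is a derivation. -/
theorem IsSim.of_linear {σ : ZMod 2} {S : M →+ M} (hS : S ∈ endGr ℳ σ)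
    (hl : ∀ κ, ∀ a ∈ 𝒜 κ, ∀ m, S (a • m) = sgn σ κ • a • S m)
    (hf : ∀ β, ∀ m ∈ ℳ β, ∀ n, q (S m) n + sgn σ β • q m (S n) = 0) :
    IsSim 𝒦 𝒜 ℳ q σ S 0 where
  degree := hS
  degA := zero_mem _
  linear κ k hk m := by
    rw [← one_smul A m, ← smul_assoc, hl κ _ (smul_one_mem hk), one_smul, smul_assoc, one_smul]
  smul κ a ha m := by simp [hl κ a ha m]
  form β m hm n := by rw [hf β m hm n]; rfl

-- The four terms of `q(E p, r) ± q(p, E r)` cancel in pairs, by supersymmetry of `q` and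
-- supercommutativity of `A`.
omit [GradedRing 𝒦] in
theorem IsQuadraticForm.isSim_eMap (hA : IsSupercommutative 𝒜) (hq : IsQuadraticForm 𝒜 ℳ q)
    {m n : M} {α β : ZMod 2} (hm : m ∈ ℳ α) (hn : n ∈ ℳ β) :
    IsSim 𝒦 𝒜 ℳ q (α + β) (eMap 𝒜 ℳ q m n) 0 := by
  refine IsSim.of_linear (hq.eMap_mem_endGr hm hn) (fun κ a ha p => ?_) fun γ p hp r => ?_
  · refine homog_induction ℳ p (fun x y hx hy => ?_) fun γ p hp => ?_
    · simp only [smul_add, map_add, hx, hy]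
    · rw [hq.eMap_apply hm hn hp, hq.eMap_apply hm hn (smul_mem_gr 𝒜 ℳ ha hp),
        hq.smul_right hA ha hm, hq.smul_right hA ha hn]
      rcases zmod2_cases α with rfl | rfl <;> rcases zmod2_cases β with rfl | rfl <;>
        rcases zmod2_cases γ with rfl | rfl <;> rcases zmod2_cases κ with rfl | rfl <;>
        simp [one_add_one_zmod2, smul_smul, smul_sub] <;> abel
  · refine homog_induction ℳ r (fun x y hx hy => ?_) fun δ r hr => ?_
    · simp only [map_add, smul_add]
      rw [add_add_add_comm, hx, hy, add_zero]
    · rw [hq.eMap_apply hm hn hp, hq.eMap_apply hm hn hr]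
      simp only [map_sub, map_zsmul, AddMonoidHom.sub_apply, AddMonoidHom.smul_apply,
        hq.smul_left hA, hq.smul_right hA (hq.degree _ _ _ hm _ hr) hp,
        hq.smul_right hA (hq.degree _ _ _ hn _ hr) hp]
      rw [hA.comm (hq.degree _ _ _ hm _ hp) (hq.degree _ _ _ hn _ hr),
        hA.comm (hq.degree _ _ _ hn _ hp) (hq.degree _ _ _ hm _ hr),
        hq.supersymm _ _ _ hp _ hm, hq.supersymm _ _ _ hp _ hn]
      rcases zmod2_cases α with rfl | rfl <;> rcases zmod2_cases β with rfl | rfl <;>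
        rcases zmod2_cases γ with rfl | rfl <;> rcases zmod2_cases δ with rfl | rfl <;>
        simp [one_add_one_zmod2, smul_sub, smul_add] <;> abel

namespace IsSim

variable {σ τ : ZMod 2} {S T : M →+ M} {Δ Θ : A →+ A}

omit [GradedRing 𝒦] [GradedRing 𝒜] [Module K A] [SetLike.GradedSMul 𝒦 𝒜]
  [IsScalarTower K A M] [DirectSum.Decomposition ℳ] [SetLike.GradedSMul 𝒜 ℳ]

theorem zero : IsSim 𝒦 𝒜 ℳ q σ 0 0 :=
  ⟨zero_mem _, zero_mem _, by simp, by simp, by simp⟩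

theorem add (hS : IsSim 𝒦 𝒜 ℳ q σ S Δ) (hT : IsSim 𝒦 𝒜 ℳ q σ T Θ) :
    IsSim 𝒦 𝒜 ℳ q σ (S + T) (Δ + Θ) where
  degree := add_mem hS.degree hT.degree
  degA := add_mem hS.degA hT.degA
  linear κ k hk m := by simp [hS.linear κ k hk, hT.linear κ k hk, smul_add]
  smul κ a ha m := by
    simp only [AddMonoidHom.add_apply, hS.smul κ a ha, hT.smul κ a ha, smul_add, add_smul]
    abel
  form β m hm n := by
    simp only [AddMonoidHom.add_apply, hS.form β m hm, hT.form β m hm, smul_add, map_add]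
    abel

theorem neg (hS : IsSim 𝒦 𝒜 ℳ q σ S Δ) : IsSim 𝒦 𝒜 ℳ q σ (-S) (-Δ) where
  degree := neg_mem hS.degree
  degA := neg_mem hS.degA
  linear κ k hk m := by simp [hS.linear κ k hk]
  smul κ a ha m := by
    simp only [AddMonoidHom.neg_apply, hS.smul κ a ha, smul_neg, neg_smul]
    abel
  form β m hm n := by
    simp only [AddMonoidHom.neg_apply, hS.form β m hm, smul_neg, map_neg]
    abel

theorem sub (hS : IsSim 𝒦 𝒜 ℳ q σ S Δ) (hT : IsSim 𝒦 𝒜 ℳ q σ T Θ) :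
    IsSim 𝒦 𝒜 ℳ q σ (S - T) (Δ - Θ) := by
  rw [sub_eq_add_neg, sub_eq_add_neg]
  exact hS.add hT.neg

/-- In each Leibniz rule the mixed terms of the two compositions cancel in the supercommutator. -/
theorem sbr [DirectSum.Decomposition ℳ] (hS : IsSim 𝒦 𝒜 ℳ q σ S Δ)
    (hT : IsSim 𝒦 𝒜 ℳ q τ T Θ) :
    IsSim 𝒦 𝒜 ℳ q (σ + τ) (sbr ℳ S T) (Δ.comp Θ - sgn σ τ • Θ.comp Δ) where
  degree := sbr_mem_endGr ℳ hS.degree hT.degree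
  degA := by
    refine sub_mem (fun γ m hm => ?_) (zsmul_mem (fun γ m hm => ?_) _)
    · rw [add_assoc]; exact hS.degA _ _ (hT.degA _ _ hm)
    · rw [add_comm σ τ, add_assoc]; exact hT.degA _ _ (hS.degA _ _ hm)
  linear κ k hk m := by
    simp only [sbr_of_mem ℳ hS.degree hT.degree, AddMonoidHom.sub_apply, AddMonoidHom.comp_apply,
      AddMonoidHom.smul_apply, hT.linear κ k hk, hS.linear κ k hk, map_zsmul]
    rcases zmod2_cases σ with rfl | rfl <;> rcases zmod2_cases τ with rfl | rfl <;>
      rcases zmod2_cases κ with rfl | rfl <;> simp [one_add_one_zmod2, smul_sub]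
  smul κ a ha m := by
    simp only [sbr_of_mem ℳ hS.degree hT.degree, AddMonoidHom.sub_apply, AddMonoidHom.comp_apply,
      AddMonoidHom.smul_apply, hT.smul κ a ha, hS.smul κ a ha, map_zsmul, map_add,
      hT.smul _ _ (hS.degA κ a ha), hS.smul _ _ (hT.degA κ a ha)]
    rcases zmod2_cases σ with rfl | rfl <;> rcases zmod2_cases τ with rfl | rfl <;>
      rcases zmod2_cases κ with rfl | rfl <;>
      simp [one_add_one_zmod2, smul_sub, smul_add, sub_smul, add_smul] <;> abel
  form β m hm n := by
    simp only [sbr_of_mem ℳ hS.degree hT.degree, AddMonoidHom.sub_apply, AddMonoidHom.comp_apply,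
      AddMonoidHom.smul_apply, hT.form β m hm, hS.form β m hm, map_zsmul, map_add, map_sub,
      hT.form _ _ (hS.degree β m hm), hS.form _ _ (hT.degree β m hm)]
    rcases zmod2_cases σ with rfl | rfl <;> rcases zmod2_cases τ with rfl | rfl <;>
      rcases zmod2_cases β with rfl | rfl <;>
      simp [one_add_one_zmod2, smul_sub, smul_add] <;> abel

theorem sbr_lmul [GradedRing 𝒜] [DirectSum.Decomposition ℳ] [SetLike.GradedSMul 𝒜 ℳ]
    (hS : IsSim 𝒦 𝒜 ℳ q σ S Δ) (a : A) :
    OspDer.sbr ℳ S (lmul M a) = lmul M (Δ a) := by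
  refine homog_induction 𝒜 a (fun x y hx hy => ?_) fun κ a ha => ?_
  · rw [map_add, sbr_add_right, hx, hy, map_add, map_add]
  · have hl : lmul M a ∈ endGr ℳ κ := fun β m hm => smul_mem_gr 𝒜 ℳ ha hm
    rw [sbr_of_mem ℳ hS.degree hl]
    ext m
    simp [lmul, hS.smul κ a ha]

/-- `S` is a derivation of both ingredients of `E_{m,n}`, the form and the scalar action. Expanding
`Δ(q(n,p))` by the rule for the form, the terms containing `S p` are those which the bracket
subtracts, so no `Δ` survives. This identity makes `[S, E] ⊆ E` automatic. -/
theorem sbr_eMap [GradedRing 𝒜] [DirectSum.Decomposition ℳ] [SetLike.GradedSMul 𝒜 ℳ]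
    (hq : IsQuadraticForm 𝒜 ℳ q) (hS : IsSim 𝒦 𝒜 ℳ q σ S Δ) {m : M}
    {α : ZMod 2} (hm : m ∈ ℳ α) (n : M) :
    OspDer.sbr ℳ S (eMap 𝒜 ℳ q m n) =
      eMap 𝒜 ℳ q (S m) n + sgn σ α • eMap 𝒜 ℳ q m (S n) := by
  refine homog_induction ℳ n (fun x y hx hy => ?_) fun β n hn => ?_
  · simp only [map_add, eMap_add_right, sbr_add_right, hx, hy, smul_add]; abel
  rw [sbr_of_mem ℳ hS.degree (hq.eMap_mem_endGr hm hn)]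
  refine homog_ext ℳ fun γ p hp => ?_
  simp only [AddMonoidHom.sub_apply, AddMonoidHom.add_apply, AddMonoidHom.comp_apply,
    AddMonoidHom.smul_apply, hq.eMap_apply hm hn hp, hq.eMap_apply hm hn (hS.degree _ _ hp),
    hq.eMap_apply (hS.degree _ _ hm) hn hp, hq.eMap_apply hm (hS.degree _ _ hn) hp,
    map_sub, map_zsmul, hS.smul _ _ (hq.degree _ _ _ hn _ hp),
    hS.smul _ _ (hq.degree _ _ _ hm _ hp), hS.form _ _ hm, hS.form _ _ hn]
  rcases zmod2_cases σ with rfl | rfl <;> rcases zmod2_cases α with rfl | rfl <;>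
    rcases zmod2_cases β with rfl | rfl <;> rcases zmod2_cases γ with rfl | rfl <;>
    simp [one_add_one_zmod2, smul_sub, smul_add, add_smul] <;> abel

end IsSim

end Sim

/-! ### Sums of summable families -/

section Closure

variable {M : Type*} [AddCommGroup M]

/-- A sum of a summable family agrees on each finite set with a finite partial sum. -/
theorem summableClosure_approx {X : AddSubgroup (M →+ M)} {f : M →+ M}
    (hf : f ∈ summableClosure X) (F : Finset M) : ∃ x ∈ X, ∀ m ∈ F, f m = x m := by
  classical
  obtain ⟨ι, x, hx, hfin, hs⟩ := hf
  refine ⟨∑ i ∈ F.biUnion fun m => (hfin m).toFinset, x i, sum_mem fun i _ => hx i,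
    fun m hm => ?_⟩
  rw [hs, AddMonoidHom.finsetSum_apply]
  refine finsum_eq_sum_of_support_subset _ fun i hi => ?_
  simp only [Finset.coe_biUnion, Set.mem_iUnion, Set.Finite.coe_toFinset]
  exact ⟨m, hm, hi⟩

theorem le_summableClosure (X : AddSubgroup (M →+ M)) : X ≤ summableClosure X := fun x hx =>
  ⟨PUnit, fun _ => x, fun _ => hx, fun _ => Set.toFinite _, fun m => by
    rw [finsum_eq_sum_of_fintype]; simp⟩

/-- The definition of the closure asks for an index type in the universe of `M`. An injection into
`M` supplies one, namely its range, whatever the universe of `κ`. -/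
theorem mem_summableClosure_of_injective {X : AddSubgroup (M →+ M)} {κ : Type*} {g : κ → M}
    (hg : Function.Injective g) {x : κ → M →+ M} (hx : ∀ i, x i ∈ X)
    (hfin : ∀ m, {i | x i m ≠ 0}.Finite) {f : M →+ M} (hf : ∀ m, f m = ∑ᶠ i, x i m) :
    f ∈ summableClosure X := by
  let e := Equiv.ofInjective g hg
  refine ⟨Set.range g, fun i => x (e.symm i), fun i => hx _, fun m => ?_, fun m => ?_⟩
  · exact (hfin m).preimage e.symm.injective.injOn
  · rw [hf m]
    exact finsum_eq_of_bijective e e.bijective fun i => by simp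

/-- The hypothesis `hfin` is continuity for pointwise convergence with `M` discrete: each value of
`Φ x` depends on finitely many values of `x`. Such a map carries summable families to summable
families and commutes with their sums. -/
theorem map_mem_summableClosure {X Y : AddSubgroup (M →+ M)} (Φ : (M →+ M) →+ (M →+ M))
    (hX : ∀ x ∈ X, Φ x ∈ Y)
    (hfin : ∀ m, ∃ F : Finset M, ∀ x : M →+ M, (∀ p ∈ F, x p = 0) → Φ x m = 0)
    {f : M →+ M} (hf : f ∈ summableClosure X) : Φ f ∈ summableClosure Y := by
  classical
  obtain ⟨ι, x, hx, hxf, hs⟩ := hf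
  choose F hF using hfin
  have key : ∀ m, {i | Φ (x i) m ≠ 0} ⊆ ↑((F m).biUnion fun p => (hxf p).toFinset) := by
    intro m i hi
    by_contra h
    simp only [Finset.coe_biUnion, Set.mem_iUnion, Set.Finite.coe_toFinset, not_exists] at h
    exact hi (hF m _ fun p hp => by simpa using h p hp)
  refine ⟨ι, fun i => Φ (x i), fun i => hX _ (hx i), fun m => (Finset.finite_toSet _).subset (key m),
    fun m => ?_⟩
  rw [finsum_eq_sum_of_support_subset _ (key m), ← AddMonoidHom.finsetSum_apply, ← map_sum,
    -- The difference of `f` and the relevant finite partial sum vanishes on `F m`, so `Φ` of it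
    -- vanishes at `m`.
    ← sub_eq_zero, ← AddMonoidHom.sub_apply, ← map_sub]
  refine hF m _ fun p hp => ?_
  rw [AddMonoidHom.sub_apply, hs, AddMonoidHom.finsetSum_apply, sub_eq_zero]
  refine finsum_eq_sum_of_support_subset _ fun i hi => ?_
  simp only [Finset.coe_biUnion, Set.mem_iUnion, Set.Finite.coe_toFinset]
  exact ⟨p, hp, hi⟩

end Closure

/-! ### Derivations of a quadratic form and `osp` -/

section Der

variable {K : Type*} [Ring K] {𝒦 : ZMod 2 → AddSubgroup K} [GradedRing 𝒦]
  {A : Type*} [Ring A] {𝒜 : ZMod 2 → AddSubgroup A} [GradedRing 𝒜]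
  [Module K A] [SetLike.GradedSMul 𝒦 𝒜]
  {M : Type*} [AddCommGroup M] [Module A M] [Module K M] [IsScalarTower K A M]
  {ℳ : ZMod 2 → AddSubgroup M}
  [DirectSum.Decomposition ℳ] [SetLike.GradedSMul 𝒜 ℳ] {q : M →+ M →+ A}

variable (𝒦 𝒜 ℳ q) in
/-- The homogeneous components of `S` and `Δ` act by derivations on `M`, `A` and `q`. -/
def IsDer (S : M →+ M) (Δ : A →+ A) : Prop :=
  ∀ α, IsSim 𝒦 𝒜 ℳ q α (endProj ℳ α S) (endProj 𝒜 α Δ)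

section IsDer

variable {S T : M →+ M} {Δ Θ : A →+ A}

theorem IsDer.add (hS : IsDer 𝒦 𝒜 ℳ q S Δ) (hT : IsDer 𝒦 𝒜 ℳ q T Θ) :
    IsDer 𝒦 𝒜 ℳ q (S + T) (Δ + Θ) := fun α => by
  rw [map_add, map_add]; exact (hS α).add (hT α)

theorem IsDer.sub (hS : IsDer 𝒦 𝒜 ℳ q S Δ) (hT : IsDer 𝒦 𝒜 ℳ q T Θ) :
    IsDer 𝒦 𝒜 ℳ q (S - T) (Δ - Θ) := fun α => by
  rw [map_sub, map_sub]; exact (hS α).sub (hT α)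

theorem IsSim.isDer {σ : ZMod 2} (hS : IsSim 𝒦 𝒜 ℳ q σ S Δ) : IsDer 𝒦 𝒜 ℳ q S Δ := fun α => by
  rw [endProj_of_mem ℳ hS.degree, endProj_of_mem 𝒜 hS.degA]
  split_ifs with h
  · exact h ▸ hS
  · exact IsSim.zero

@[elab_as_elim]
theorem IsDer.induction {p : (M →+ M) → (A →+ A) → Prop} (hS : IsDer 𝒦 𝒜 ℳ q S Δ)
    (hadd : ∀ S Δ T Θ, p S Δ → p T Θ → p (S + T) (Δ + Θ))
    (hom : ∀ σ S Δ, IsSim 𝒦 𝒜 ℳ q σ S Δ → p S Δ) : p S Δ := by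
  rw [← endProj_zero_add_endProj_one ℳ S, ← endProj_zero_add_endProj_one 𝒜 Δ]
  exact hadd _ _ _ _ (hom 0 _ _ (hS 0)) (hom 1 _ _ (hS 1))

theorem IsDer.isSim {σ : ZMod 2} (hS : IsDer 𝒦 𝒜 ℳ q S Δ) (h : S ∈ endGr ℳ σ)
    (h' : Δ ∈ endGr 𝒜 σ) : IsSim 𝒦 𝒜 ℳ q σ S Δ := by
  have := hS σ
  rwa [endProj_same ℳ h, endProj_same 𝒜 h'] at this

theorem IsDer.sbr (hS : IsDer 𝒦 𝒜 ℳ q S Δ) (hT : IsDer 𝒦 𝒜 ℳ q T Θ) :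
    IsDer 𝒦 𝒜 ℳ q (sbr ℳ S T) (sbr 𝒜 Δ Θ) := by
  refine hS.induction (fun S Δ S' Δ' h h' => ?_) fun σ S Δ hS => ?_
  · rw [sbr_add_left, sbr_add_left]; exact h.add h'
  refine hT.induction (fun T Θ T' Θ' h h' => ?_) fun τ T Θ hT => ?_
  · rw [sbr_add_right, sbr_add_right]; exact h.add h'
  rw [sbr_of_mem 𝒜 hS.degA hT.degA]
  exact (hS.sbr hT).isDer

theorem IsDer.sbr_lmul (hS : IsDer 𝒦 𝒜 ℳ q S Δ) (a : A) :
    OspDer.sbr ℳ S (lmul M a) = lmul M (Δ a) := by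
  refine hS.induction (fun S Δ S' Δ' h h' => ?_) fun σ S Δ hS => hS.sbr_lmul a
  rw [sbr_add_left, h, h', ← map_add]; rfl

end IsDer

theorem proj_form (hq : IsQuadraticForm 𝒜 ℳ q) (m : M) {n : M} {γ : ZMod 2} (hn : n ∈ ℳ γ)
    (β : ZMod 2) : proj 𝒜 (β + γ) (q m n) = q (proj ℳ β m) n := by
  refine homog_induction ℳ m (fun x y hx hy => ?_) fun δ m hm => ?_
  · simp only [map_add, AddMonoidHom.add_apply, hx, hy]
  · rw [proj_of_mem ℳ hm, proj_of_mem 𝒜 (hq.degree _ _ _ hm _ hn)]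
    by_cases h : δ = β <;> simp [h]

/-- Only the passage to components needs care: the defining identity for `x` is stated for the whole
map, and its part of degree `α + β + γ` is the identity for the component of degree `α`. -/
theorem mem_osp_iff (hq : IsQuadraticForm 𝒜 ℳ q) {x : M →+ M} :
    x ∈ osp 𝒜 ℳ q ↔ IsDer 𝒦 𝒜 ℳ q x 0 := by
  constructor
  · rintro ⟨hl, hf⟩ α
    rw [map_zero]
    refine IsSim.of_linear (endProj_mem ℳ x α)
      ((mem_endLin_iff_of_mem 𝒜 ℳ (endProj_mem ℳ x α)).1 (endProj_mem_endLin 𝒜 ℳ hl α))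
      fun β m hm n => ?_
    refine homog_induction ℳ n (fun x y hx hy => ?_) fun γ n hn => ?_
    · simp only [map_add, smul_add]
      rw [add_add_add_comm, hx, hy, add_zero]
    have h := congrArg (proj 𝒜 (α + β + γ)) (hf β γ m hm n hn)
    rw [map_add, map_zsmul, map_zero, proj_form hq _ hn, show α + β + γ = α + γ + β by abel,
      proj_form hq _ hm, ← endProj_apply_of_mem ℳ x α hm, ← endProj_apply_of_mem ℳ x α hn,
      hq.supersymm _ _ _ (endProj_mem ℳ x α γ n hn) _ hm, sgn_add_left, sgn_comm γ β, mul_smul,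
      smul_comm (sgn β γ), sgn_smul_sgn_smul] at h
    exact h
  · intro h
    have key : ∀ α y, IsSim 𝒦 𝒜 ℳ q α y 0 → y ∈ osp 𝒜 ℳ q := by
      intro α y hy
      refine ⟨(mem_endLin_iff_of_mem 𝒜 ℳ hy.degree).2 fun κ a ha m => ?_, fun β γ m hm n hn => ?_⟩
      · simpa using hy.smul κ a ha m
      · have h := hy.form β m hm n
        rw [hq.supersymm _ _ _ hm _ (hy.degree γ n hn), sgn_add_right, mul_smul, sgn_comm β α,
          sgn_smul_sgn_smul] at h
        exact h.symm
    rw [← endProj_zero_add_endProj_one ℳ x]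
    have h0 := h 0
    have h1 := h 1
    rw [map_zero] at h0 h1
    exact add_mem (key _ _ h0) (key _ _ h1)

/-- Each condition defining `osp(q)` involves two values of the map only, so it can be tested on a
finite partial sum. -/
theorem summableClosure_osp_le : summableClosure (osp 𝒜 ℳ q) ≤ osp 𝒜 ℳ q := by
  classical
  intro f hf
  refine ⟨fun m a => ?_, fun α β m hm n hn => ?_⟩
  · obtain ⟨x, hx, h⟩ := summableClosure_approx hf {m, rmul 𝒜 ℳ m a}
    rw [h _ (by simp), h _ (by simp)]
    exact hx.1 m a
  · obtain ⟨x, hx, h⟩ := summableClosure_approx hf {m, n}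
    rw [h _ (by simp), h _ (by simp)]
    exact hx.2 α β m hm n hn

theorem eMap_mem_eosp (m n : M) : eMap 𝒜 ℳ q m n ∈ eosp 𝒜 ℳ q :=
  AddSubgroup.subset_closure ⟨m, n, rfl⟩

theorem eosp_le {X : AddSubgroup (M →+ M)}
    (h : ∀ α β, ∀ m ∈ ℳ α, ∀ n ∈ ℳ β, eMap 𝒜 ℳ q m n ∈ X) : eosp 𝒜 ℳ q ≤ X := by
  rw [eosp, AddSubgroup.closure_le]
  rintro _ ⟨m, n, rfl⟩
  refine homog_induction ℳ m (fun x y hx hy => ?_) fun α m hm => ?_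
  · rw [eMap_add_left]; exact add_mem hx hy
  refine homog_induction ℳ n (fun x y hx hy => ?_) fun β n hn => ?_
  · rw [eMap_add_right]; exact add_mem hx hy
  exact h α β m hm n hn

theorem eosp_le_osp (hA : IsSupercommutative 𝒜) (hq : IsQuadraticForm 𝒜 ℳ q) :
    eosp 𝒜 ℳ q ≤ osp 𝒜 ℳ q :=
  eosp_le fun _ _ _ hm _ hn => (mem_osp_iff (𝒦 := 𝒜) hq).2 (hq.isSim_eMap hA hm hn).isDer

theorem eosp_le_eospBar : eosp 𝒜 ℳ q ≤ eospBar 𝒜 ℳ q := le_summableClosure _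

theorem eospBar_le_osp (hA : IsSupercommutative 𝒜) (hq : IsQuadraticForm 𝒜 ℳ q) :
    eospBar 𝒜 ℳ q ≤ osp 𝒜 ℳ q := by
  intro f hf
  refine summableClosure_osp_le ?_
  obtain ⟨ι, x, hx, h⟩ := hf
  exact ⟨ι, x, fun i => eosp_le_osp hA hq (hx i), h⟩

theorem IsStandard.eosp_le {E : AddSubgroup (M →+ M)} (hA : IsSupercommutative 𝒜)
    (hq : IsQuadraticForm 𝒜 ℳ q) (hE : IsStandard 𝒜 ℳ q E) : eosp 𝒜 ℳ q ≤ E := by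
  rcases hE with rfl | rfl | rfl
  exacts [le_rfl, eosp_le_eospBar, eosp_le_osp hA hq]

theorem IsStandard.le_osp {E : AddSubgroup (M →+ M)} (hA : IsSupercommutative 𝒜)
    (hq : IsQuadraticForm 𝒜 ℳ q) (hE : IsStandard 𝒜 ℳ q E) : E ≤ osp 𝒜 ℳ q := by
  rcases hE with rfl | rfl | rfl
  exacts [eosp_le_osp hA hq, eospBar_le_osp hA hq, le_rfl]

theorem IsStandard.isDer {E : AddSubgroup (M →+ M)} (hA : IsSupercommutative 𝒜)
    (hq : IsQuadraticForm 𝒜 ℳ q) (hE : IsStandard 𝒜 ℳ q E) {x : M →+ M} (hx : x ∈ E) :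
    IsDer 𝒦 𝒜 ℳ q x 0 :=
  (mem_osp_iff hq).1 (hE.le_osp hA hq hx)

/-- `E` is stable under a map on endomorphisms which preserves `eosp(q)` and `osp(q)` and is
pointwise determined by finitely many values. -/
theorem IsStandard.map_mem {E : AddSubgroup (M →+ M)} (hE : IsStandard 𝒜 ℳ q E)
    (Φ : (M →+ M) →+ (M →+ M)) (h1 : ∀ α β, ∀ m ∈ ℳ α, ∀ n ∈ ℳ β, Φ (eMap 𝒜 ℳ q m n) ∈ eosp 𝒜 ℳ q)
    (h2 : ∀ x ∈ osp 𝒜 ℳ q, Φ x ∈ osp 𝒜 ℳ q)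
    (hfin : ∀ m, ∃ F : Finset M, ∀ x : M →+ M, (∀ p ∈ F, x p = 0) → Φ x m = 0)
    {x : M →+ M} (hx : x ∈ E) : Φ x ∈ E := by
  have h1' : ∀ x ∈ eosp 𝒜 ℳ q, Φ x ∈ eosp 𝒜 ℳ q := fun x hx =>
    (OspDer.eosp_le h1 : eosp 𝒜 ℳ q ≤ (eosp 𝒜 ℳ q).comap Φ) hx
  rcases hE with rfl | rfl | rfl
  exacts [h1' x hx, map_mem_summableClosure Φ h1' hfin hx, h2 x hx]

theorem IsStandard.endProj_mem {E : AddSubgroup (M →+ M)}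
    (hq : IsQuadraticForm 𝒜 ℳ q) (hE : IsStandard 𝒜 ℳ q E) {x : M →+ M} (hx : x ∈ E)
    (α : ZMod 2) : endProj ℳ α x ∈ E := by
  classical
  refine hE.map_mem (endProj ℳ α) (fun β γ m hm n hn => ?_) (fun x hx => ?_) (fun m => ?_) hx
  · rw [endProj_of_mem ℳ (hq.eMap_mem_endGr hm hn)]
    split_ifs
    exacts [eMap_mem_eosp m n, zero_mem _]
  · have h := (mem_osp_iff (𝒦 := 𝒜) hq).1 hx α
    rw [map_zero] at h
    exact (mem_osp_iff (𝒦 := 𝒜) hq).2 h.isDer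
  · refine ⟨{proj ℳ 0 m, proj ℳ 1 m}, fun x hx => ?_⟩
    rw [endProj_apply, hx _ (by simp), hx _ (by simp), map_zero, map_zero, add_zero]

/-- The reason the third condition in the definition of `S_E` is redundant. On `eosp(q)` it is the
formula for `[S, E_{m,n}]`; on `osp(q)` the bracket again has `Δ = 0`; on the closure one passes to
summable families. -/
theorem IsStandard.sbr_mem {E : AddSubgroup (M →+ M)}
    (hq : IsQuadraticForm 𝒜 ℳ q) (hE : IsStandard 𝒜 ℳ q E) {S : M →+ M} {Δ : A →+ A}
    (hS : IsDer 𝒦 𝒜 ℳ q S Δ) {x : M →+ M} (hx : x ∈ E) : sbr ℳ S x ∈ E := by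
  classical
  refine hS.induction (fun S _ T _ h h' => ?_) fun σ S Δ hS => ?_
  · rw [sbr_add_left]; exact add_mem h h'
  refine hE.map_mem (sbrHom ℳ S) (fun β γ m hm n hn => ?_) (fun x hx => ?_) (fun m => ?_) hx
  · rw [sbrHom_apply, hS.sbr_eMap hq hm]
    exact add_mem (eMap_mem_eosp _ _) (zsmul_mem (eMap_mem_eosp _ _) _)
  · have h := hS.isDer.sbr ((mem_osp_iff (𝒦 := 𝒦) hq).1 hx)
    rw [sbr_zero_right] at h
    exact (mem_osp_iff hq).2 h
  -- The value `[S, x](m)` involves `x` only at `m` and at the homogeneous parts of the values at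
  -- `m` of the components of `S`.
  · refine ⟨{m, proj ℳ 0 (endProj ℳ 0 S m), proj ℳ 1 (endProj ℳ 0 S m),
      proj ℳ 0 (endProj ℳ 1 S m), proj ℳ 1 (endProj ℳ 1 S m)}, fun x hx => ?_⟩
    have h : ∀ α β, endProj ℳ α x (endProj ℳ β S m) = 0 := by
      intro α β
      rw [endProj_apply]
      rcases zmod2_cases β with rfl | rfl <;>
        rw [hx _ (by simp), hx _ (by simp), map_zero, map_zero, add_zero]
    rw [sbrHom_apply, sbr_apply, hx m (by simp), map_zero, h, h, h, h]
    simp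

/-! ### Scalar multiples -/

section KSmul

variable (hK : IsSupercommutative 𝒦) (hA : IsSupercommutative 𝒜)

-- The element `k` acts as `k • 1 ∈ A`, so supercommutativity of `A` moves it past scalars and past
-- the form, and that of `K` gives `K`-linearity.
include hK hA in
theorem IsSim.ksmul [IsScalarTower K A A] (hq : IsQuadraticForm 𝒜 ℳ q) {κ σ : ZMod 2} {k : K}
    (hk : k ∈ 𝒦 κ) {S : M →+ M} {Δ : A →+ A} (hS : IsSim 𝒦 𝒜 ℳ q σ S Δ) :
    IsSim 𝒦 𝒜 ℳ q (κ + σ) (k • S) (k • Δ) := by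
  have e : ∀ m : M, k • m = (k • (1 : A)) • m := fun m => by rw [smul_assoc, one_smul]
  have e' : ∀ a : A, k • a = (k • (1 : A)) * a := fun m => by rw [smul_mul_assoc, one_mul]
  have hk1 : k • (1 : A) ∈ 𝒜 κ := smul_one_mem hk
  refine ⟨fun β m hm => ?_, fun β a ha => ?_, fun κ' k' hk' m => ?_, fun κ' a ha m => ?_,
    fun β m hm n => ?_⟩
  · rw [add_assoc]
    exact ksmul_mem_gr (𝒜 := 𝒜) hk (hS.degree β m hm)
  · rw [add_assoc]
    exact smul_mem_gr 𝒦 𝒜 hk (hS.degA β a ha)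
  · rw [AddMonoidHom.smul_apply, hS.linear κ' k' hk', AddMonoidHom.smul_apply,
      smul_comm k (sgn σ κ'), smul_smul, hK.comm hk hk', smul_assoc, mul_smul, sgn_add_left,
      mul_comm, mul_smul]
  · rw [AddMonoidHom.smul_apply, hS.smul κ' a ha, AddMonoidHom.smul_apply, smul_add,
      AddMonoidHom.smul_apply, smul_assoc, smul_comm k (sgn σ κ'), e (a • _), smul_smul,
      hA.comm hk1 ha, smul_assoc, mul_smul, ← e, sgn_add_left, mul_comm, mul_smul]
  · rw [AddMonoidHom.smul_apply, hS.form β m hm, AddMonoidHom.smul_apply, AddMonoidHom.smul_apply,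
      e (S m), e (S n), hq.smul_left hA, hq.smul_right hA hk1 hm, smul_add, ← e',
      smul_comm k (sgn σ β), ← e', sgn_add_left, mul_comm, mul_smul, sgn_smul_sgn_smul]

include hK hA in
theorem IsDer.ksmul [IsScalarTower K A A] (hq : IsQuadraticForm 𝒜 ℳ q) (k : K) {S : M →+ M}
    {Δ : A →+ A} (hS : IsDer 𝒦 𝒜 ℳ q S Δ) : IsDer 𝒦 𝒜 ℳ q (k • S) (k • Δ) := by
  refine homog_induction 𝒦 k (fun x y hx hy => ?_) fun κ k hk => ?_
  · rw [add_smul, add_smul]; exact hx.add hy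
  refine hS.induction (fun S Δ T Θ h h' => ?_) fun σ S Δ hS => ?_
  · rw [smul_add, smul_add]; exact h.add h'
  exact (hS.ksmul hK hA hq hk).isDer

include hK hA in
theorem IsStandard.ksmul_mem [IsScalarTower K A A] (hq : IsQuadraticForm 𝒜 ℳ q)
    {E : AddSubgroup (M →+ M)} (hE : IsStandard 𝒜 ℳ q E) (k : K) {x : M →+ M} (hx : x ∈ E) :
    k • x ∈ E := by
  refine hE.map_mem (DistribSMul.toAddMonoidHom (M →+ M) k) (fun β γ m hm n hn => ?_)
    (fun x hx => ?_) (fun m => ⟨{m}, fun x hx => ?_⟩) hx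
  -- The multiple of a generator by `k` is again a generator: the scalar is absorbed into `m`.
  · have h : DistribSMul.toAddMonoidHom (M →+ M) k (eMap 𝒜 ℳ q m n) =
        eMap 𝒜 ℳ q ((k • (1 : A)) • m) n := by
      rw [hq.eMap_smul_left hA]
      ext p
      change k • eMap 𝒜 ℳ q m n p = (k • (1 : A)) • eMap 𝒜 ℳ q m n p
      rw [smul_assoc, one_smul]
    rw [h]
    exact eMap_mem_eosp _ _
  · have h := ((mem_osp_iff (𝒦 := 𝒦) hq).1 hx).ksmul hK hA hq k
    rw [smul_zero] at h
    exact (mem_osp_iff hq).2 h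
  · change k • x m = 0
    rw [hx m (by simp), smul_zero]

/-- The superbracket is `K`-bilinear on `K`-linear endomorphisms. -/
theorem IsSim.sbr_ksmul_left {σ : ZMod 2} (k : K) (S : M →+ M) {T : M →+ M} {Δ : A →+ A}
    (hT : IsSim 𝒦 𝒜 ℳ q σ T Δ) : OspDer.sbr ℳ (k • S) T = k • OspDer.sbr ℳ S T := by
  refine homog_induction 𝒦 k (fun x y hx hy => ?_) fun κ k hk => ?_
  · simp only [add_smul, sbr_add_left, hx, hy]
  refine end_homog_induction ℳ S (fun x y hx hy => ?_) fun τ S hS => ?_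
  · simp only [smul_add, sbr_add_left, hx, hy]
  have hkS : k • S ∈ endGr ℳ (κ + τ) := fun β m hm => by
    rw [add_assoc]; exact ksmul_mem_gr (𝒜 := 𝒜) hk (hS β m hm)
  rw [sbr_of_mem ℳ hkS hT.degree, sbr_of_mem ℳ hS hT.degree]
  ext m
  simp only [AddMonoidHom.sub_apply, AddMonoidHom.smul_apply, AddMonoidHom.comp_apply,
    hT.linear κ k hk, smul_sub, sgn_add_left, mul_smul, smul_comm k (sgn _ _ : ℤ)]
  rw [sgn_comm σ κ, smul_comm (sgn κ σ), sgn_smul_sgn_smul]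

theorem IsDer.sbr_ksmul_left (k : K) (S : M →+ M) {T : M →+ M} {Δ : A →+ A}
    (hT : IsDer 𝒦 𝒜 ℳ q T Δ) : OspDer.sbr ℳ (k • S) T = k • OspDer.sbr ℳ S T := by
  refine hT.induction (fun T _ T' _ h h' => ?_) fun σ T _ hT => hT.sbr_ksmul_left k S
  simp only [sbr_add_right, h, h', smul_add]

theorem IsSim.sbr_ksmul_right {σ κ : ZMod 2} {k : K} (hk : k ∈ 𝒦 κ) {S : M →+ M} {Δ : A →+ A}
    (hS : IsSim 𝒦 𝒜 ℳ q σ S Δ) (T : M →+ M) :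
    OspDer.sbr ℳ S (k • T) = sgn κ σ • k • OspDer.sbr ℳ S T := by
  refine end_homog_induction ℳ T (fun x y hx hy => ?_) fun τ T hT => ?_
  · simp only [smul_add, sbr_add_right, hx, hy]
  have hkT : k • T ∈ endGr ℳ (κ + τ) := fun β m hm => by
    rw [add_assoc]; exact ksmul_mem_gr (𝒜 := 𝒜) hk (hT β m hm)
  rw [sbr_of_mem ℳ hS.degree hkT, sbr_of_mem ℳ hS.degree hT]
  ext m
  simp only [AddMonoidHom.sub_apply, AddMonoidHom.smul_apply, AddMonoidHom.comp_apply,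
    hS.linear κ k hk, smul_sub, sgn_add_right, mul_smul, smul_comm k (sgn _ _ : ℤ)]
  rw [sgn_comm σ κ]

end KSmul

end Der

/-! ### `S^{(1)} ∩ S^{(2)}` for a faithful module -/

section S12

variable {K : Type*} [Ring K] {𝒦 : ZMod 2 → AddSubgroup K} [GradedRing 𝒦]
  {A : Type*} [Ring A] {𝒜 : ZMod 2 → AddSubgroup A} [GradedRing 𝒜]
  [Module K A] [SetLike.GradedSMul 𝒦 𝒜]
  {M : Type*} [AddCommGroup M] [Module A M] [Module K M] [IsScalarTower K A M]
  {ℳ : ZMod 2 → AddSubgroup M}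
  [DirectSum.Decomposition ℳ] [SetLike.GradedSMul 𝒜 ℳ] {q : M →+ M →+ A}

theorem IsFaithful.lmul_injective (hM : IsFaithful A M) {a b : A} (h : lmul M a = lmul M b) :
    a = b := by
  rw [← sub_eq_zero]
  refine hM _ fun m => ?_
  rw [sub_smul, sub_eq_zero]
  exact DFunLike.congr_fun h m

theorem proj_smul_of_right_mem (a : A) {m : M} {β : ZMod 2} (hm : m ∈ ℳ β) (γ : ZMod 2) :
    proj ℳ (γ + β) (a • m) = proj 𝒜 γ a • m := by
  refine homog_induction 𝒜 a (fun x y hx hy => ?_) fun κ a ha => ?_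
  · simp only [add_smul, map_add, hx, hy]
  · rw [proj_of_mem 𝒜 ha, proj_of_mem ℳ (smul_mem_gr 𝒜 ℳ ha hm)]
    by_cases h : κ = γ <;> simp [h]

/-- The component of `a` in the other degree sends each homogeneous vector to the part of `a • m` in
the wrong degree, which is zero; faithfulness then kills it. -/
theorem IsFaithful.mem_of_smul_mem (hM : IsFaithful A M) {a : A} {α : ZMod 2}
    (h : ∀ β, ∀ m ∈ ℳ β, a • m ∈ ℳ (α + β)) : a ∈ 𝒜 α := by
  have h1 : proj 𝒜 (α + 1) a = 0 := by
    refine hM _ fun m => ?_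
    refine homog_induction ℳ m (fun x y hx hy => ?_) fun β m hm => ?_
    · rw [smul_add, hx, hy, add_zero]
    · rw [← proj_smul_of_right_mem (ℳ := ℳ) a hm]
      exact proj_ne ℳ (by simp) (h β m hm)
  have h2 : a = proj 𝒜 α a := by
    conv_lhs => rw [← proj_zero_add_proj_one 𝒜 a]
    rcases zmod2_cases α with rfl | rfl
    · rw [zero_add] at h1; rw [h1, add_zero]
    · rw [one_add_one_zmod2] at h1; rw [h1, zero_add]
  rw [h2]
  exact proj_mem 𝒜 α a

/-- Faithfulness identifies `A` with `A·Id`. It makes the choice of `Δ(a)` additive and of the right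
degree, and turns the second condition, an equality of operators, into one in `A`. -/
theorem IsFaithful.exists_isSim (hM : IsFaithful A M) (hq : IsQuadraticForm 𝒜 ℳ q) {σ : ZMod 2}
    {S : M →+ M} (h1 : S ∈ s1Gr 𝒦 A ℳ σ) (h2 : S ∈ s2Gr 𝒦 ℳ q σ) :
    ∃ Δ, IsSim 𝒦 𝒜 ℳ q σ S Δ := by
  obtain ⟨⟨hl, hd⟩, h1⟩ := h1
  choose Δ hΔ using h1
  let D : A →+ A := AddMonoidHom.mk' Δ fun a b => hM.lmul_injective (M := M) <| by
    rw [map_add, ← hΔ, ← hΔ, ← hΔ, map_add, sbr_add_right]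
  have hs : ∀ κ, ∀ a ∈ 𝒜 κ, ∀ m, S (a • m) = Δ a • m + sgn σ κ • a • S m := by
    intro κ a ha m
    have hla : lmul M a ∈ endGr ℳ κ := fun β m hm => smul_mem_gr 𝒜 ℳ ha hm
    have h := hΔ a
    rw [sbr_of_mem ℳ hd hla, sub_eq_iff_eq_add] at h
    exact DFunLike.congr_fun h m
  refine ⟨D, hd, fun κ a ha => ?_, (mem_endLin_iff_of_mem 𝒦 ℳ hd).1 hl, hs, fun β m hm n => ?_⟩
  · refine hM.mem_of_smul_mem (ℳ := ℳ) fun β m hm => ?_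
    have h : Δ a • m = S (a • m) - sgn σ κ • a • S m := by rw [hs κ a ha, add_sub_cancel_right]
    change Δ a • m ∈ _
    rw [h]
    refine sub_mem ?_ (zsmul_mem ?_ _)
    · rw [add_assoc]; exact hd _ _ (smul_mem_gr 𝒜 ℳ ha hm)
    · rw [add_comm σ κ, add_assoc]; exact smul_mem_gr 𝒜 ℳ ha (hd _ _ hm)
  · refine homog_induction ℳ n (fun x y hx hy => ?_) fun γ n hn => ?_
    · simp only [map_add, hx, hy, smul_add]; abel
    · have h := hM.lmul_injective ((hΔ _).symm.trans (h2.2 β γ m hm n hn))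
      change Δ _ = _
      rw [h, hq.supersymm _ _ _ (hd γ n hn) _ hm, sgn_add_left, sgn_comm γ β, mul_comm, mul_smul,
        sgn_smul_sgn_smul]

theorem IsSim.mem_s1Gr {σ : ZMod 2} {S : M →+ M} {Δ : A →+ A} (hS : IsSim 𝒦 𝒜 ℳ q σ S Δ) :
    S ∈ s1Gr 𝒦 A ℳ σ :=
  ⟨⟨(mem_endLin_iff_of_mem 𝒦 ℳ hS.degree).2 hS.linear, hS.degree⟩, fun a => ⟨Δ a, hS.sbr_lmul a⟩⟩

theorem IsSim.mem_s2Gr (hq : IsQuadraticForm 𝒜 ℳ q) {σ : ZMod 2} {S : M →+ M} {Δ : A →+ A}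
    (hS : IsSim 𝒦 𝒜 ℳ q σ S Δ) : S ∈ s2Gr 𝒦 ℳ q σ :=
  ⟨⟨(mem_endLin_iff_of_mem 𝒦 ℳ hS.degree).2 hS.linear, hS.degree⟩, fun β γ m hm n hn => by
    rw [hS.sbr_lmul, hS.form β m hm, hq.supersymm _ _ _ hm _ (hS.degree γ n hn), sgn_add_right,
      mul_smul, sgn_comm β σ, sgn_smul_sgn_smul]⟩

theorem IsDer.mem_s12 (hq : IsQuadraticForm 𝒜 ℳ q) {S : M →+ M} {Δ : A →+ A}
    (hS : IsDer 𝒦 𝒜 ℳ q S Δ) : S ∈ s12 (A := A) 𝒦 ℳ q := by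
  rw [← endProj_zero_add_endProj_one ℳ S]
  exact ⟨add_mem (AddSubgroup.mem_sup_left (hS 0).mem_s1Gr)
    (AddSubgroup.mem_sup_right (hS 1).mem_s1Gr),
    add_mem (AddSubgroup.mem_sup_left ((hS 0).mem_s2Gr hq))
    (AddSubgroup.mem_sup_right ((hS 1).mem_s2Gr hq))⟩

theorem endProj_mem_of_mem_sup {X : ZMod 2 → AddSubgroup (M →+ M)} (hX : ∀ α, X α ≤ endGr ℳ α)
    {f : M →+ M} (hf : f ∈ X 0 ⊔ X 1) (α : ZMod 2) : endProj ℳ α f ∈ X α := by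
  obtain ⟨f₀, h0, f₁, h1, rfl⟩ := AddSubgroup.mem_sup.1 hf
  rw [map_add, endProj_of_mem ℳ (hX 0 h0), endProj_of_mem ℳ (hX 1 h1)]
  rcases zmod2_cases α with rfl | rfl <;> simpa

theorem mem_s12_iff (hM : IsFaithful A M) (hq : IsQuadraticForm 𝒜 ℳ q) {S : M →+ M} :
    S ∈ s12 (A := A) 𝒦 ℳ q ↔ ∃ Δ, IsDer 𝒦 𝒜 ℳ q S Δ := by
  refine ⟨fun ⟨h1, h2⟩ => ?_, fun ⟨Δ, h⟩ => h.mem_s12 hq⟩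
  have key : ∀ α, ∃ Δ, IsSim 𝒦 𝒜 ℳ q α (endProj ℳ α S) Δ := fun α =>
    hM.exists_isSim hq (endProj_mem_of_mem_sup (X := s1Gr 𝒦 A ℳ) (fun α _ h => h.1.2) h1 α)
      (endProj_mem_of_mem_sup (X := s2Gr 𝒦 ℳ q) (fun α _ h => h.1.2) h2 α)
  obtain ⟨Δ₀, h0⟩ := key 0
  obtain ⟨Δ₁, h1⟩ := key 1
  refine ⟨Δ₀ + Δ₁, ?_⟩
  rw [← endProj_zero_add_endProj_one ℳ S]
  exact h0.isDer.add h1.isDer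

theorem IsDer.adA_eq (hM : IsFaithful A M) {S : M →+ M} {Δ : A →+ A}
    (hS : IsDer 𝒦 𝒜 ℳ q S Δ) : adA A ℳ S = Δ := by
  have h : ∃ Δ : A →+ A, ∀ a, OspDer.sbr ℳ S (lmul M a) = lmul M (Δ a) := ⟨Δ, hS.sbr_lmul⟩
  rw [adA, dif_pos h]
  ext a
  exact hM.lmul_injective ((h.choose_spec a).symm.trans (hS.sbr_lmul a))

theorem isDer_adA (hM : IsFaithful A M) (hq : IsQuadraticForm 𝒜 ℳ q) {S : M →+ M}
    (hS : S ∈ s12 (A := A) 𝒦 ℳ q) : IsDer 𝒦 𝒜 ℳ q S (adA A ℳ S) := by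
  obtain ⟨Δ, h⟩ := (mem_s12_iff hM hq).1 hS
  rwa [h.adA_eq hM]

/-- The condition `[S, E] ⊆ E` follows from the other two. -/
theorem sE_eq_s12 (hM : IsFaithful A M) (hq : IsQuadraticForm 𝒜 ℳ q)
    {E : AddSubgroup (M →+ M)} (hE : IsStandard 𝒜 ℳ q E) :
    sE 𝒦 ℳ q E = s12 (A := A) 𝒦 ℳ q := by
  refine le_antisymm ?_ fun S hS => ?_
  · have h : ∀ α, sEGr 𝒦 ℳ q E α ≤ s12 (A := A) 𝒦 ℳ q := by
      intro α S hS
      obtain ⟨Δ, h⟩ := hM.exists_isSim hq hS.1.1 hS.1.2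
      exact h.isDer.mem_s12 hq
    exact sup_le (h 0) (h 1)
  · obtain ⟨Δ, h⟩ := (mem_s12_iff hM hq).1 hS
    have key : ∀ α, endProj ℳ α S ∈ sEGr 𝒦 ℳ q E α := fun α =>
      ⟨⟨(h α).mem_s1Gr, (h α).mem_s2Gr hq⟩, (h α).mem_s1Gr.1,
        fun x hx => hE.sbr_mem hq (h α).isDer hx⟩
    rw [← endProj_zero_add_endProj_one ℳ S]
    exact add_mem (AddSubgroup.mem_sup_left (key 0)) (AddSubgroup.mem_sup_right (key 1))

/-- The component of `Δ` of degree `σ` serves for `S` just as well as `Δ`, and the map attached to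
`S` is unique. -/
theorem IsDer.degA (hM : IsFaithful A M) {S : M →+ M} {Δ : A →+ A} {σ : ZMod 2}
    (hS : IsDer 𝒦 𝒜 ℳ q S Δ) (h : S ∈ endGr ℳ σ) : Δ ∈ endGr 𝒜 σ := by
  have h1 : IsDer 𝒦 𝒜 ℳ q S (endProj 𝒜 σ Δ) := by
    have := (hS σ).isDer
    rwa [endProj_same ℳ h] at this
  rw [← hS.adA_eq hM, h1.adA_eq hM]
  exact endProj_mem 𝒜 Δ σ

/-- The cyclic Jacobi identity in terms of skewness and the Leibniz rule. -/
theorem jacobi_of_leibniz {V : Type*} [AddCommGroup V] {α β γ : ZMod 2}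
    {xyz yzx zxy u v : V} (h1 : xyz = u - sgn α β • v) (h2 : yzx = -(sgn (β + γ) α • u))
    (h3 : zxy = sgn (γ + α) β • sgn γ α • v) :
    sgn α γ • xyz + sgn β α • yzx + sgn γ β • zxy = 0 := by
  subst h1 h2 h3
  rcases zmod2_cases α with rfl | rfl <;> rcases zmod2_cases β with rfl | rfl <;>
    rcases zmod2_cases γ with rfl | rfl <;> simp [one_add_one_zmod2] <;> abel

theorem isLieSuperalgebra_s12 [IsScalarTower K A A] (hK : IsSupercommutative 𝒦)
    (hA : IsSupercommutative 𝒜) (hM : IsFaithful A M) (hq : IsQuadraticForm 𝒜 ℳ q) :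
    IsLieSuperalgebra 𝒦 (endGr ℳ) (s12 (A := A) 𝒦 ℳ q) (sbr ℳ) where
  smul_mem k x hx := by
    obtain ⟨Δ, h⟩ := (mem_s12_iff hM hq).1 hx
    exact (h.ksmul hK hA hq k).mem_s12 hq
  decompose x hx := by
    obtain ⟨Δ, h⟩ := (mem_s12_iff hM hq).1 hx
    exact ⟨_, (h 0).isDer.mem_s12 hq, _, (h 1).isDer.mem_s12 hq, endProj_mem ℳ x 0,
      endProj_mem ℳ x 1, (endProj_zero_add_endProj_one ℳ x).symm⟩
  disjoint x _ h0 h1 := by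
    rw [← endProj_same ℳ h0, endProj_of_mem ℳ h1, if_neg (by decide)]
  smul_degree κ α k hk x _ hx := fun β m hm => by
    rw [add_assoc]; exact ksmul_mem_gr (𝒜 := 𝒜) hk (hx β m hm)
  br_mem x hx y hy := by
    obtain ⟨Δ, h⟩ := (mem_s12_iff hM hq).1 hx
    obtain ⟨Θ, h'⟩ := (mem_s12_iff hM hq).1 hy
    exact (h.sbr h').mem_s12 hq
  br_degree α β x _ y _ h h' := sbr_mem_endGr ℳ h h'
  add_br x _ y _ z _ := sbr_add_left ℳ x y z
  br_add x _ y _ z _ := sbr_add_right ℳ x y z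
  smul_br k x _ y hy := by
    obtain ⟨Θ, h⟩ := (mem_s12_iff hM hq).1 hy
    exact h.sbr_ksmul_left k x
  br_smul κ α k hk x hx hd y _ := by
    obtain ⟨Δ, h⟩ := (mem_s12_iff hM hq).1 hx
    exact (h.isSim hd (h.degA hM hd)).sbr_ksmul_right hk y
  skew α β x _ y _ hx hy := sbr_skew ℳ hx hy
  jacobi α β γ x _ y _ z _ hx hy hz := by
    refine jacobi_of_leibniz (u := sbr ℳ x (sbr ℳ y z)) (v := sbr ℳ y (sbr ℳ x z)) ?_ ?_ ?_
    · rw [sbr_leibniz ℳ hx hy, add_sub_cancel_right]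
    · exact sbr_skew ℳ (sbr_mem_endGr ℳ hy hz) hx
    · rw [sbr_skew ℳ (sbr_mem_endGr ℳ hz hx) hy, sbr_skew ℳ hz hx, sbr_neg_right,
        sbr_zsmul_right, smul_neg, neg_neg]

end S12

/-! ### Units of degree zero -/

section Units

variable {A : Type*} [Ring A] {𝒜 : ZMod 2 → AddSubgroup A} [GradedRing 𝒜]

/-- Multiplication by an even element preserves degrees, so the even part of the equation `a a⁻¹ =
1` shows that the even part of `a⁻¹` is already an inverse. -/
theorem inverse_mem_zero {a : A} (ha : a ∈ 𝒜 0) (hu : IsUnit a) : Ring.inverse a ∈ 𝒜 0 := by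
  have h : a * proj 𝒜 0 (Ring.inverse a) = 1 := by
    have h1 := proj_smul_of_mem 𝒜 𝒜 ha (Ring.inverse a) 0
    rw [smul_eq_mul, smul_eq_mul, Ring.mul_inverse_cancel a hu, zero_add,
      proj_same 𝒜 (SetLike.GradedOne.one_mem (A := 𝒜))] at h1
    exact h1.symm
  have h2 : Ring.inverse a = proj 𝒜 0 (Ring.inverse a) := by
    rw [← hu.mul_right_inj, h, Ring.mul_inverse_cancel a hu]
  rw [h2]
  exact proj_mem 𝒜 0 _

theorem one_mem_zero : (1 : A) ∈ 𝒜 0 := SetLike.GradedOne.one_mem (A := 𝒜)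

theorem two_mem_zero : (2 : A) ∈ 𝒜 0 := by
  have h : (2 : A) = 1 + 1 := one_add_one_eq_two.symm
  rw [h]; exact add_mem one_mem_zero one_mem_zero

theorem mul_mem_gr {a c : A} {α β : ZMod 2} (ha : a ∈ 𝒜 α) (hc : c ∈ 𝒜 β) : a * c ∈ 𝒜 (α + β) :=
  SetLike.GradedMul.mul_mem ha hc

theorem eq_zero_of_add_self {M : Type*} [AddCommGroup M] [Module A M] (h2 : IsUnit (2 : A)) {m : M}
    (h : m + m = 0) : m = 0 := by
  rwa [← two_smul A m, h2.smul_eq_zero] at h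

theorem inverse_two_smul_add_self {M : Type*} [AddCommGroup M] [Module A M] (h2 : IsUnit (2 : A))
    (m : M) : Ring.inverse (2 : A) • (m + m) = m := by
  rw [← two_smul A m, smul_smul, Ring.inverse_mul_cancel _ h2, one_smul]

/-- A unit is not odd. -/
theorem IsSupercommutative.not_isUnit_odd [Nontrivial A] (hA : IsSupercommutative 𝒜)
    (h2 : IsUnit (2 : A)) {a : A} (ha : a ∈ 𝒜 1) : ¬ IsUnit a := by
  intro hu
  have h : a * a + a * a = 0 := by
    conv_lhs => lhs; rw [hA.comm ha ha]
    simp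
  have h' := eq_zero_of_add_self h2 h
  rw [hu.mul_right_eq_zero] at h'
  exact hu.ne_zero h'

end Units

/-! ### Derivations of `A` -/

/-- `Δ` is a homogeneous `K`-derivation of `A` of degree `σ`. -/
structure IsADer {K : Type*} [Ring K] (𝒦 : ZMod 2 → AddSubgroup K) {A : Type*} [Ring A]
    (𝒜 : ZMod 2 → AddSubgroup A) [Module K A] (σ : ZMod 2) (Δ : A →+ A) : Prop where
  degree : Δ ∈ endGr 𝒜 σ
  linear : ∀ κ, ∀ k ∈ 𝒦 κ, ∀ a, Δ (k • a) = sgn σ κ • k • Δ a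
  mul : ∀ κ, ∀ a ∈ 𝒜 κ, ∀ c, Δ (a * c) = Δ a * c + sgn σ κ • (a * Δ c)

section ADer

variable {K : Type*} [Ring K] {𝒦 : ZMod 2 → AddSubgroup K} [GradedRing 𝒦]
  {A : Type*} [Ring A] {𝒜 : ZMod 2 → AddSubgroup A} [GradedRing 𝒜]
  [Module K A] [SetLike.GradedSMul 𝒦 𝒜]
  {M : Type*} [AddCommGroup M] [Module A M] [Module K M] [IsScalarTower K A M]
  {ℳ : ZMod 2 → AddSubgroup M}
  [DirectSum.Decomposition ℳ] [SetLike.GradedSMul 𝒜 ℳ] {q : M →+ M →+ A}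
  {σ : ZMod 2} {Δ : A →+ A}

theorem IsADer.map_one (h : IsADer 𝒦 𝒜 σ Δ) : Δ 1 = 0 := by
  have h1 := h.mul 0 1 one_mem_zero 1
  simpa using h1

/-- Computing `S((ac)m)` as `S(a(cm))` gives the product rule on `M`; faithfulness carries it to
`A`. Linearity over `K` is obtained from `S((ka)m)` in the same way. -/
theorem IsSim.isADer (hM : IsFaithful A M) {S : M →+ M} (hS : IsSim 𝒦 𝒜 ℳ q σ S Δ) :
    IsADer 𝒦 𝒜 σ Δ := by
  refine ⟨hS.degA, fun κ k hk a => ?_, fun κ a ha c => ?_⟩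
  · refine homog_induction 𝒜 a (fun x y hx hy => ?_) fun α a ha => ?_
    · simp only [smul_add, map_add, hx, hy]
    · refine hM.lmul_injective (M := M) (AddMonoidHom.ext fun m => ?_)
      have h1 := hS.smul _ _ (smul_mem_gr 𝒦 𝒜 hk ha) m
      rw [smul_assoc, hS.linear κ k hk, hS.smul _ a ha, sgn_add_right, mul_smul,
        smul_assoc k a, smul_add, smul_add, smul_comm k (sgn σ α : ℤ), add_left_inj] at h1
      change Δ (k • a) • m = (sgn σ κ • k • Δ a) • m
      rw [← h1, smul_assoc, smul_assoc]
  · refine homog_induction 𝒜 c (fun x y hx hy => ?_) fun γ c hc => ?_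
    · simp only [mul_add, map_add, hx, hy, smul_add]; abel
    · refine hM.lmul_injective (M := M) (AddMonoidHom.ext fun m => ?_)
      have h1 := hS.smul _ _ (mul_mem_gr ha hc) m
      rw [mul_smul, hS.smul κ a ha, hS.smul γ c hc, ← sub_eq_iff_eq_add] at h1
      change Δ (a * c) • m = (Δ a * c + sgn σ κ • (a * Δ c)) • m
      rw [← h1, sgn_add_right, add_smul, mul_smul, smul_assoc, mul_smul, mul_smul, mul_smul,
        smul_add, smul_add, smul_comm a (sgn σ γ : ℤ)]
      abel

end ADer

/-! ### Almost diagonalizable forms -/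

@[elab_as_elim]
theorem basis_induction {A : Type*} [Ring A] {𝒜 : ZMod 2 → AddSubgroup A} [GradedRing 𝒜]
    {N : Type*} [AddCommGroup N] [Module A N] {I : Type*} (b : Module.Basis I A N) {p : N → Prop}
    (h0 : p 0) (hadd : ∀ x y, p x → p y → p (x + y))
    (hom : ∀ i α, ∀ a ∈ 𝒜 α, p (a • b i)) (n : N) : p n := by
  rw [← b.repr.symm_apply_apply n]
  induction b.repr n using Finsupp.induction_linear with
  | zero => rwa [map_zero]
  | add f g hf hg => rw [map_add]; exact hadd _ _ hf hg
  | single i a =>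
    rw [b.repr_symm_single]
    refine homog_induction 𝒜 a (fun x y hx hy => ?_) fun α a ha => hom i α a ha
    rw [add_smul]; exact hadd _ _ hx hy

theorem basis_ext {A : Type*} [Ring A] {N : Type*} [AddCommGroup N] [Module A N] {I : Type*}
    (b : Module.Basis I A N) {X : Type*} [AddCommGroup X] {f g : N →+ X}
    (h : ∀ i (a : A), f (a • b i) = g (a • b i)) : f = g := by
  ext n
  rw [← b.repr.symm_apply_apply n]
  induction b.repr n using Finsupp.induction_linear with
  | zero => simp
  | add f g hf hg => rw [map_add, map_add, map_add, hf, hg]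
  | single i a => rw [b.repr_symm_single, h]

section Diagonal

variable {K : Type*} [Ring K] {𝒦 : ZMod 2 → AddSubgroup K} [GradedRing 𝒦]
  {A : Type*} [Ring A] {𝒜 : ZMod 2 → AddSubgroup A} [GradedRing 𝒜]
  [Module K A] [SetLike.GradedSMul 𝒦 𝒜]
  {N : Type*} [AddCommGroup N] [Module A N] [Module K N] [IsScalarTower K A N]
  {𝒩 : ZMod 2 → AddSubgroup N}
  [DirectSum.Decomposition 𝒩] [SetLike.GradedSMul 𝒜 𝒩] {q : N →+ N →+ A}
  {I : Type*} {b : Module.Basis I A N} {bar : I → I} {σ : ZMod 2} {Δ : A →+ A}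

/-- The degree of a basis vector. -/
noncomputable def IsAlmostDiagonal.deg (hb : IsAlmostDiagonal 𝒩 q b bar) (i : I) : ZMod 2 :=
  (hb.homogeneous i).choose

namespace IsAlmostDiagonal

variable (hb : IsAlmostDiagonal 𝒩 q b bar)

include hb

theorem mem_deg (i : I) : b i ∈ 𝒩 (hb.deg i) := (hb.homogeneous i).choose_spec

/-- Otherwise `q(b_{bar i}, b_i)` vanishes, and by supersymmetry so does the unit `q(b_i, b_{bar
i})`. Over the zero ring `bar` may be arbitrary; hence the nontriviality assumption here and the
separate treatment of that case later. -/
theorem bar_bar [Nontrivial A] (hq : IsQuadraticForm 𝒜 𝒩 q) (i : I) : bar (bar i) = i := by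
  by_contra h
  have h1 := hb.eq_zero (bar i) i fun h' => h h'.symm
  have h2 := hq.supersymm _ _ _ (hb.mem_deg i) _ (hb.mem_deg (bar i))
  rw [h1, smul_zero] at h2
  exact (hb.isUnit i).ne_zero h2

/-- If the degrees differed, `q(b_i, b_{bar i})` would be an odd unit, which is impossible when `2`
is invertible. -/
theorem deg_bar [Nontrivial A] (hA : IsSupercommutative 𝒜) (h2 : IsUnit (2 : A))
    (hq : IsQuadraticForm 𝒜 𝒩 q) (i : I) : hb.deg (bar i) = hb.deg i := by
  by_contra h
  have h1 := hq.degree _ _ _ (hb.mem_deg i) _ (hb.mem_deg (bar i))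
  have h3 : hb.deg i + hb.deg (bar i) = 1 := by
    rcases zmod2_cases (hb.deg i) with h4 | h4 <;>
      rcases zmod2_cases (hb.deg (bar i)) with h5 | h5 <;> simp_all
  rw [h3] at h1
  exact hA.not_isUnit_odd h2 h1 (hb.isUnit i)

theorem form_mem_zero [Nontrivial A] (hA : IsSupercommutative 𝒜) (h2 : IsUnit (2 : A))
    (hq : IsQuadraticForm 𝒜 𝒩 q) (i : I) : q (b i) (b (bar i)) ∈ 𝒜 0 := by
  have h1 := hq.degree _ _ _ (hb.mem_deg i) _ (hb.mem_deg (bar i))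
  rw [hb.deg_bar hA h2 hq] at h1
  rcases zmod2_cases (hb.deg i) with h4 | h4 <;> rwa [h4] at h1

theorem form_bar [Nontrivial A] (hA : IsSupercommutative 𝒜) (h2 : IsUnit (2 : A))
    (hq : IsQuadraticForm 𝒜 𝒩 q) (i : I) :
    q (b (bar i)) (b i) = sgn (hb.deg i) (hb.deg i) • q (b i) (b (bar i)) := by
  rw [hq.supersymm _ _ _ (hb.mem_deg (bar i)) _ (hb.mem_deg i), hb.deg_bar hA h2 hq]

omit hb in
theorem derExt_smul_basis (a : A) (i : I) : derExt q b bar Δ (a • b i) =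
    (Ring.inverse 2 * Δ (q (b i) (b (bar i))) * Ring.inverse (q (b i) (b (bar i))) * a + Δ a) •
      b i := by
  simp [derExt, add_smul]

theorem coeff_mem [Nontrivial A] (hA : IsSupercommutative 𝒜) (h2 : IsUnit (2 : A))
    (hq : IsQuadraticForm 𝒜 𝒩 q) (hΔ : Δ ∈ endGr 𝒜 σ) (i : I) :
    Ring.inverse 2 * Δ (q (b i) (b (bar i))) * Ring.inverse (q (b i) (b (bar i))) ∈ 𝒜 σ := by
  have h1 := hb.form_mem_zero hA h2 hq i
  have h3 := mul_mem_gr (mul_mem_gr (inverse_mem_zero two_mem_zero h2) (hΔ 0 _ h1))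
    (inverse_mem_zero h1 (hb.isUnit i))
  simpa using h3

/-- The coefficient is half the logarithmic derivative of `q(b_i, b_{bar i})`. Exchanging `i` and
`bar i` changes that unit at most by a sign, which a logarithmic derivative does not see. -/
theorem coeff_bar [Nontrivial A] (hA : IsSupercommutative 𝒜) (h2 : IsUnit (2 : A))
    (hq : IsQuadraticForm 𝒜 𝒩 q) (i : I) :
    Ring.inverse 2 * Δ (q (b (bar i)) (b i)) * Ring.inverse (q (b (bar i)) (b i)) =
    Ring.inverse 2 * Δ (q (b i) (b (bar i))) * Ring.inverse (q (b i) (b (bar i))) := by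
  rw [hb.form_bar hA h2 hq]
  rcases zmod2_cases (hb.deg i) with h | h
  · simp [h]
  · have e : Ring.inverse (-q (b i) (b (bar i))) = -Ring.inverse (q (b i) (b (bar i))) := by
      have hu := hb.isUnit i
      rw [← hu.neg.mul_right_inj, Ring.mul_inverse_cancel _ hu.neg, neg_mul_neg,
        Ring.mul_inverse_cancel _ hu]
    simp [h, e]

theorem coeff_mul [Nontrivial A] (h2 : IsUnit (2 : A)) (i : I) :
    Ring.inverse 2 * Δ (q (b i) (b (bar i))) * Ring.inverse (q (b i) (b (bar i))) *
      q (b i) (b (bar i)) + Ring.inverse 2 * Δ (q (b i) (b (bar i))) *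
      Ring.inverse (q (b i) (b (bar i))) * q (b i) (b (bar i)) = Δ (q (b i) (b (bar i))) := by
  rw [mul_assoc _ (Ring.inverse (q (b i) (b (bar i)))), Ring.inverse_mul_cancel _ (hb.isUnit i),
    mul_one, ← mul_add]
  exact inverse_two_smul_add_self h2 _

/-- On coefficients `Δ_N` acts by `Δ`, so it is a derivation of the module. For the form only the
pairs `(b_i, b_{bar i})` matter; there each of the two vectors contributes half of `Δ(q(b_i, b_{bar
i}))`, by `coeff_bar` and `coeff_mul`. -/
theorem derExt_isSim (hA : IsSupercommutative 𝒜) (h2 : IsUnit (2 : A))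
    (hq : IsQuadraticForm 𝒜 𝒩 q) (hΔ : IsADer 𝒦 𝒜 σ Δ) :
    IsSim 𝒦 𝒜 𝒩 q σ (derExt q b bar Δ) Δ := by
  rcases subsingleton_or_nontrivial A with hs | hs
  · have hN : Subsingleton N := Module.subsingleton A N
    exact ⟨fun β m _ => by rw [Subsingleton.elim (derExt q b bar Δ m) 0]; exact zero_mem _,
      hΔ.degree, fun _ _ _ _ => Subsingleton.elim _ _, fun _ _ _ _ => Subsingleton.elim _ _,
      fun _ _ _ _ => Subsingleton.elim _ _⟩
  obtain ⟨C, hC⟩ : ∃ C : I → A, ∀ i, C i = Ring.inverse 2 * Δ (q (b i) (b (bar i))) *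
    Ring.inverse (q (b i) (b (bar i))) := ⟨_, fun i => rfl⟩
  have hD : ∀ a i, derExt q b bar Δ (a • b i) = (C i * a + Δ a) • b i := fun a i => by
    rw [hC, derExt_smul_basis]
  have hCm : ∀ i, C i ∈ 𝒜 σ := fun i => by rw [hC]; exact hb.coeff_mem hA h2 hq hΔ.degree i
  have hCb : ∀ i, C (bar i) = C i := fun i => by
    rw [hC, hC, hb.bar_bar hq, hb.coeff_bar hA h2 hq]
  have hCq : ∀ i, C i * q (b i) (b (bar i)) + C i * q (b i) (b (bar i)) =
      Δ (q (b i) (b (bar i))) := fun i => by rw [hC, hb.coeff_mul h2]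
  set D := derExt q b bar Δ
  have hsm : ∀ κ, ∀ a ∈ 𝒜 κ, ∀ m, D (a • m) = Δ a • m + sgn σ κ • a • D m := by
    intro κ a ha m
    refine basis_induction (𝒜 := 𝒜) b ?_ (fun x y hx hy => ?_) (fun i α c hc => ?_) m
    · simp
    · simp only [smul_add, map_add, hx, hy]; abel
    · rw [smul_smul, hD, hD, hΔ.mul κ a ha, smul_smul, smul_smul, ← smul_assoc, ← add_smul]
      congr 1
      rw [mul_add, smul_add, ← mul_assoc, ← mul_assoc, hA.comm (hCm i) ha, smul_mul_assoc]
      abel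
  have hproj : ∀ i α, ∀ a ∈ 𝒜 α, a • b i ∈ 𝒩 (α + hb.deg i) := fun i α a ha =>
    smul_mem_gr 𝒜 𝒩 ha (hb.mem_deg i)
  refine ⟨fun β m hm => ?_, hΔ.degree, fun κ k hk m => ?_, hsm, fun β m hm n => ?_⟩
  -- Induction over the basis destroys homogeneity, so the claim is proved for the component `proj 𝒩
  -- β m` of an arbitrary `m`.
  · rw [← proj_same 𝒩 hm]
    refine basis_induction (𝒜 := 𝒜) b ?_ (fun x y hx hy => ?_) (fun i α c hc => ?_) m
    · rw [map_zero, map_zero]; exact zero_mem _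
    · rw [map_add, map_add]; exact add_mem hx hy
    · rw [proj_of_mem 𝒩 (hproj i α c hc)]
      split_ifs with h
      · subst h
        rw [hD, ← add_assoc]
        exact smul_mem_gr 𝒜 𝒩 (add_mem (mul_mem_gr (hCm i) hc) (hΔ.degree _ _ hc)) (hb.mem_deg i)
      · rw [map_zero]; exact zero_mem _
  · have e : ∀ n : N, k • n = (k • (1 : A)) • n := fun n => by rw [smul_assoc, one_smul]
    rw [e m, hsm κ _ (smul_one_mem hk), hΔ.linear κ k hk, hΔ.map_one, smul_zero, smul_zero,
      zero_smul, zero_add, ← e]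
  · rw [← proj_same 𝒩 hm]
    refine basis_induction (𝒜 := 𝒜) b ?_ (fun x y hx hy => ?_) (fun i α a ha => ?_) m
    · simp
    · simp only [map_add, AddMonoidHom.add_apply, hx, hy, smul_add]; abel
    rw [proj_of_mem 𝒩 (hproj i α a ha)]
    split_ifs with h
    swap
    · simp
    subst h
    refine basis_induction (𝒜 := 𝒜) b ?_ (fun x y hx hy => ?_) (fun j γ c hc => ?_) n
    · simp
    · simp only [map_add, hx, hy, smul_add]; abel
    rw [hD, hD, hq.smul_left hA, hq.smul_left hA, hq.smul_left hA,
      hq.smul_right hA hc (hb.mem_deg i),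
      hq.smul_right hA (add_mem (mul_mem_gr (hCm j) hc) (hΔ.degree _ _ hc)) (hb.mem_deg i)]
    -- All other pairs of basis vectors are orthogonal, and both sides vanish.
    by_cases h : j = bar i
    swap
    · simp [hb.eq_zero i j h]
    subst h
    rw [mul_smul_comm, map_zsmul, hΔ.mul _ a ha, hΔ.mul _ c hc, hCb, ← hCq]
    have h1 : a * (C i * (c * q (b i) (b (bar i)))) =
        sgn α σ • (C i * (a * (c * q (b i) (b (bar i))))) := by
      rw [← mul_assoc, hA.comm ha (hCm i), smul_mul_assoc, mul_assoc]
    have h3 : a * (c * (C i * q (b i) (b (bar i)))) =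
        sgn (α + γ) σ • (C i * (a * (c * q (b i) (b (bar i))))) := by
      rw [← mul_assoc, ← mul_assoc, hA.comm (mul_mem_gr ha hc) (hCm i), smul_mul_assoc, mul_assoc,
        mul_assoc]
    simp only [mul_add, add_mul, mul_smul_comm, smul_add, mul_assoc, h1, h3]
    generalize hb.deg i = δ
    rcases zmod2_cases α with rfl | rfl <;> rcases zmod2_cases γ with rfl | rfl <;>
      rcases zmod2_cases δ with rfl | rfl <;> rcases zmod2_cases σ with rfl | rfl <;>
      simp [one_add_one_zmod2] <;> abel

omit hb in
theorem derExt_add (Δ Δ' : A →+ A) :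
    derExt q b bar (Δ + Δ') = derExt q b bar Δ + derExt q b bar Δ' := by
  refine basis_ext b fun i a => ?_
  simp only [AddMonoidHom.add_apply, derExt_smul_basis, mul_add, add_mul, ← add_smul]
  congr 1; abel

omit hb in
theorem derExt_smul [IsScalarTower K A A] (hA : IsSupercommutative 𝒜) (h2 : IsUnit (2 : A))
    (k : K) (Δ : A →+ A) : derExt q b bar (k • Δ) = k • derExt q b bar Δ := by
  refine basis_ext b fun i a => ?_
  have e : ∀ a : A, k • a = (k • (1 : A)) * a := fun m => by rw [smul_mul_assoc, one_mul]
  simp only [AddMonoidHom.smul_apply, derExt_smul_basis]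
  rw [← smul_assoc, smul_add, e (Δ (q _ _)), ← mul_assoc,
    hA.comm_of_mem_zero (inverse_mem_zero two_mem_zero h2), mul_assoc _ (Ring.inverse 2),
    ← e, smul_mul_assoc, smul_mul_assoc]

omit hb in
@[simp] theorem derExt_zero : derExt q b bar (0 : A →+ A) = 0 := by
  have h := derExt_add (q := q) (b := b) (bar := bar) 0 0
  simpa using h

/-- The extension to `N` is compatible with superbrackets. -/
theorem derExt_sbr (hA : IsSupercommutative 𝒜) (h2 : IsUnit (2 : A))
    (hq : IsQuadraticForm 𝒜 𝒩 q) {τ : ZMod 2} {Θ : A →+ A} (hΔ : IsADer 𝒦 𝒜 σ Δ)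
    (hΘ : IsADer 𝒦 𝒜 τ Θ) : derExt q b bar (sbr 𝒜 Δ Θ) =
      sbr 𝒩 (derExt q b bar Δ) (derExt q b bar Θ) := by
  rcases subsingleton_or_nontrivial A with hs | hs
  · have hN : Subsingleton N := Module.subsingleton A N
    ext; exact Subsingleton.elim _ _
  have hD := hb.derExt_isSim hA h2 hq hΔ
  have hT := hb.derExt_isSim hA h2 hq hΘ
  rw [sbr_of_mem 𝒜 hΔ.degree hΘ.degree, sbr_of_mem 𝒩 hD.degree hT.degree]
  refine basis_ext b fun i a => ?_
  simp only [AddMonoidHom.sub_apply, AddMonoidHom.comp_apply, AddMonoidHom.smul_apply,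
    derExt_smul_basis]
  rw [← smul_assoc, ← sub_smul]
  congr 1
  have hu := hb.isUnit i
  have hu0 := hb.form_mem_zero hA h2 hq i
  set u := q (b i) (b (bar i))
  have hi2 : (Ring.inverse 2 : A) ∈ 𝒜 0 := inverse_mem_zero two_mem_zero h2
  have hr0 := inverse_mem_zero hu0 hu
  set h : A := Ring.inverse 2
  set r := Ring.inverse u
  -- The quotient rule, obtained by differentiating `r u = 1`.
  have hrinv : ∀ {ρ : ZMod 2} {Φ : A →+ A}, IsADer 𝒦 𝒜 ρ Φ → Φ r = -(r * Φ u * r) := by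
    intro ρ Φ hΦ
    have h1 := hΦ.mul 0 r hr0 u
    rw [Ring.inverse_mul_cancel u hu, hΦ.map_one, sgn_zero_right, one_smul] at h1
    have h3 := congrArg (· * r) h1
    simp only [zero_mul, add_mul, mul_assoc] at h3
    rw [Ring.mul_inverse_cancel u hu, mul_one] at h3
    rw [mul_assoc]
    exact eq_neg_of_add_eq_zero_left h3.symm
  -- A derivation kills `1`, hence `2`, hence the inverse of `2`.
  have hhalf : ∀ {ρ : ZMod 2} {Φ : A →+ A}, IsADer 𝒦 𝒜 ρ Φ → Φ h = 0 := by
    intro ρ Φ hΦ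
    have h1 := hΦ.mul 0 2 two_mem_zero h
    rw [Ring.mul_inverse_cancel 2 h2, ← one_add_one_eq_two, map_add, hΦ.map_one] at h1
    simp only [add_zero, zero_mul, sgn_zero_right, one_smul, zero_add, add_mul, one_mul] at h1
    exact eq_zero_of_add_self h2 h1.symm
  have hx := hΔ.degree 0 u hu0
  have hy := hΘ.degree 0 u hu0
  have hxy := hΔ.degree _ _ hy
  have hyx := hΘ.degree _ _ hx
  simp only [add_zero] at hx hy hxy hyx
  have hc0 : ∀ {ρ : ZMod 2} {z : A}, z ∈ 𝒜 ρ → z * r ∈ 𝒜 ρ := fun hz => by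
    have := mul_mem_gr hz hr0; rwa [add_zero] at this
  have key : ∀ {ρ : ZMod 2} {Φ : A →+ A} {π : ZMod 2} {z : A}, IsADer 𝒦 𝒜 ρ Φ → z ∈ 𝒜 π →
      Φ (h * z * r * a) = h * Φ z * r * a - sgn ρ π • (h * z * r * Φ u * r * a) +
        sgn ρ π • (h * z * r * Φ a) := by
    intro ρ Φ π z hΦ hz
    rw [show h * z * r * a = h * (z * (r * a)) by simp only [mul_assoc], hΦ.mul 0 h hi2, hhalf hΦ,
      hΦ.mul π z hz, hΦ.mul 0 r hr0, hrinv hΦ]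
    simp only [zero_mul, zero_add, sgn_zero_right, one_smul, mul_add, mul_smul_comm, neg_mul,
      mul_neg, smul_add, smul_neg, mul_assoc]
    abel
  have hcomm : ∀ {ρ π : ZMod 2} {z w : A}, z ∈ 𝒜 ρ → w ∈ 𝒜 π → ∀ s : A,
      z * r * w * s = sgn ρ π • (w * r * z * s) := by
    intro ρ π z w hz hw s
    have h1 := hA.comm (hc0 hz) hw
    rw [h1, smul_mul_assoc, ← hA.comm_of_mem_zero hr0 z, mul_assoc w r z]
  simp only [map_add, key hΔ hy, key hΘ hx, mul_add, mul_sub, sub_mul, smul_add, mul_smul_comm,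
    smul_mul_assoc, smul_sub]
  have hh : ∀ z w : A, h * z * r * (h * w * r * a) = h * (h * (z * r * w * (r * a))) := by
    intro z w
    rw [show h * z * r * (h * w * r * a) = h * (z * r * h) * (w * (r * a)) by
      simp only [mul_assoc], ← hA.comm_of_mem_zero hi2 (z * r)]
    simp only [mul_assoc]
  have e1 : h * Θ u * r * Δ u * r * a = h * (Θ u * r * Δ u * (r * a)) := by simp only [mul_assoc]
  have e2 : h * Δ u * r * Θ u * r * a = h * (Δ u * r * Θ u * (r * a)) := by simp only [mul_assoc]
  -- Supercommutativity brings every product of first derivatives of `u` to the single shape `X`.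
  -- The contributions of the quotient rule to the two orders of composition cancel, as do the
  -- products of two coefficients, and only `½ [Δ, Θ](u) u⁻¹` survives as coefficient.
  rw [hh, hh, e1, e2, hcomm hy hx]
  simp only [mul_smul_comm]
  generalize Δ u * r * Θ u * (r * a) = X
  rcases zmod2_cases σ with rfl | rfl <;> rcases zmod2_cases τ with rfl | rfl <;>
    simp <;> abel

end IsAlmostDiagonal

end Diagonal

/-! ### Dual families and expansions in the maps `E_{m,n}` -/

section DualFamily

variable {A : Type*} [Ring A] {𝒜 : ZMod 2 → AddSubgroup A} [GradedRing 𝒜]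
  {M : Type*} [AddCommGroup M] [Module A M] {ℳ : ZMod 2 → AddSubgroup M}
  [DirectSum.Decomposition ℳ] [SetLike.GradedSMul 𝒜 ℳ] {q : M →+ M →+ A} {I : Type*}

variable (𝒜 ℳ q) in
/-- The families `b` and `e` are dual to each other and give an expansion of the projection `π`. -/
structure IsDualFamily (b e : I → M) (π : M →+ M) : Prop where
  homogeneous : ∀ i, ∃ δ, b i ∈ ℳ δ ∧ e i ∈ ℳ δ
  fin_left : ∀ p, {i | q (e i) p ≠ 0}.Finite
  fin_right : ∀ p, {i | q p (b i) ≠ 0}.Finite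
  sum_left : ∀ p, ∑ᶠ i, rmul 𝒜 ℳ (b i) (q (e i) p) = π p
  sum_right : ∀ p, ∑ᶠ i, q p (b i) • e i = π p

namespace IsDualFamily

variable {b e : I → M} {π : M →+ M} (h : IsDualFamily 𝒜 ℳ q b e π)

include h

/-- Membership in `osp(q)` moves `x` from `b_i` to `p` in the second half of `E_{x(b_i), e_i}(p)`,
and linearity pulls it out of the first half. -/
theorem eMap_apply {x : M →+ M} (hx : x ∈ osp 𝒜 ℳ q) (i : I)
    (p : M) :
    eMap 𝒜 ℳ q (x (b i)) (e i) p = x (rmul 𝒜 ℳ (b i) (q (e i) p)) + q (x p) (b i) • e i := by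
  obtain ⟨δ, hbi, hei⟩ := h.homogeneous i
  refine homog_induction ℳ p (fun u v hu hv => ?_) fun γ p hp => ?_
  · simp only [map_add, AddMonoidHom.add_apply, add_smul, hu, hv]; abel
  rw [eMap_apply_of_mem q _ hei hp, hx.1, sub_eq_add_neg, add_right_inj]
  have h1 := hx.2 δ γ (b i) hbi p hp
  rw [eq_neg_of_add_eq_zero_left h1, neg_smul, smul_neg, neg_neg, smul_assoc, sgn_smul_sgn_smul]

theorem finite_eMap {x : M →+ M} (hx : x ∈ osp 𝒜 ℳ q) (p : M) :
    {i | eMap 𝒜 ℳ q (x (b i)) (e i) p ≠ 0}.Finite := by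
  refine ((h.fin_left p).union (h.fin_right (x p))).subset fun i hi => ?_
  by_contra hc
  simp only [Set.mem_union, Set.mem_ofPred_eq, not_or, not_not] at hc
  exact hi (by rw [h.eMap_apply hx, hc.1, hc.2]; simp)

/-- The expansion on which both closures rest. The first halves sum to `π p` inside `x`, the second
ones to `π` of `x p`. If `π` acts as the identity on both sides of `x` the result is `2x`, which
explains a factor `½`; if `x` exchanges the image and the kernel of a projection `π` the result is
`x`. -/
theorem finsum_eMap {x : M →+ M} (hx : x ∈ osp 𝒜 ℳ q) (p : M) :
    ∑ᶠ i, eMap 𝒜 ℳ q (x (b i)) (e i) p = x (π p) + π (x p) := by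
  have h1 : {i | rmul 𝒜 ℳ (b i) (q (e i) p) ≠ 0}.Finite :=
    (h.fin_left p).subset fun i hi hc => hi (by simp [hc])
  simp_rw [h.eMap_apply hx]
  rw [finsum_add_distrib, ← h.sum_left, ← h.sum_right, x.map_finsum h1]
  · exact h1.subset fun i hi hc => hi (by simp [hc])
  · exact (h.fin_right (x p)).subset fun i hi hc => hi (by simp [hc])

end IsDualFamily

end DualFamily

/-! ### The dual basis of an almost diagonalizing basis. -/

namespace IsAlmostDiagonal

variable {A : Type*} [Ring A] {𝒜 : ZMod 2 → AddSubgroup A} [GradedRing 𝒜]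
  {N : Type*} [AddCommGroup N] [Module A N] {𝒩 : ZMod 2 → AddSubgroup N}
  [DirectSum.Decomposition 𝒩] [SetLike.GradedSMul 𝒜 𝒩] {q : N →+ N →+ A}
  {I : Type*} {b : Module.Basis I A N} {bar : I → I}

variable (q b bar) in
/-- The basis dual to an almost diagonalizing basis. -/
noncomputable def dual (i : I) : N := Ring.inverse (q (b (bar i)) (b i)) • b (bar i)

variable [Nontrivial A] (hb : IsAlmostDiagonal 𝒩 q b bar) (hA : IsSupercommutative 𝒜)
  (h2 : IsUnit (2 : A)) (hq : IsQuadraticForm 𝒜 𝒩 q)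

include hb hA hq

theorem form_dual_self (i : I) : q (dual q b bar i) (b i) = 1 := by
  have h := hb.isUnit (bar i)
  rw [hb.bar_bar hq] at h
  rw [dual, hq.smul_left hA, Ring.inverse_mul_cancel _ h]

theorem form_dual_ne {i j : I} (h : j ≠ i) : q (dual q b bar i) (b j) = 0 := by
  rw [dual, hq.smul_left hA, hb.eq_zero (bar i) j (by rwa [hb.bar_bar hq]), mul_zero]

include h2

theorem dual_mem (i : I) : dual q b bar i ∈ 𝒩 (hb.deg i) := by
  have h := hb.isUnit (bar i)
  have h0 := hb.form_mem_zero hA h2 hq (bar i)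
  rw [hb.bar_bar hq] at h h0
  have h3 := smul_mem_gr 𝒜 𝒩 (inverse_mem_zero h0 h) (hb.mem_deg (bar i))
  rwa [zero_add, hb.deg_bar hA h2 hq] at h3

theorem isDualFamily : IsDualFamily 𝒜 𝒩 q b (dual q b bar) (AddMonoidHom.id N) := by
  have hd : ∀ i j, j ≠ i → ∀ α, ∀ a ∈ 𝒜 α, q (dual q b bar i) (a • b j) = 0 := by
    intro i j hij α a ha
    rw [hq.smul_right hA ha (hb.dual_mem hA h2 hq i), hb.form_dual_ne hA hq hij, mul_zero,
      smul_zero]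
  have hr : ∀ i j, i ≠ bar j → ∀ a : A, q (a • b j) (b i) = 0 := by
    intro i j hij a
    rw [hq.smul_left hA, hb.eq_zero j i hij, mul_zero]
  have fl : ∀ p, {i | q (dual q b bar i) p ≠ 0}.Finite := by
    intro p
    refine basis_induction (𝒜 := 𝒜) b (by simp) (fun x y hx hy => ?_) (fun j α a ha => ?_) p
    · refine (hx.union hy).subset fun i hi => ?_
      by_contra hc
      simp only [Set.mem_union, Set.mem_ofPred_eq, not_or, not_not] at hc
      exact hi (by rw [map_add, hc.1, hc.2, add_zero])
    · exact (Set.finite_singleton j).subset fun i hi => by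
        by_contra hc; exact hi (hd i j (fun h => hc h.symm) α a ha)
  have fr : ∀ p, {i | q p (b i) ≠ 0}.Finite := by
    intro p
    refine basis_induction (𝒜 := 𝒜) b (by simp) (fun x y hx hy => ?_) (fun j α a ha => ?_) p
    · refine (hx.union hy).subset fun i hi => ?_
      by_contra hc
      simp only [Set.mem_union, Set.mem_ofPred_eq, not_or, not_not] at hc
      exact hi (by rw [map_add, AddMonoidHom.add_apply, hc.1, hc.2, add_zero])
    · exact (Set.finite_singleton (bar j)).subset fun i hi => by
        by_contra hc; exact hi (hr i j hc a)
  refine ⟨fun i => ⟨_, hb.mem_deg i, hb.dual_mem hA h2 hq i⟩, fl, fr, fun p => ?_, fun p => ?_⟩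
  · refine basis_induction (𝒜 := 𝒜) b (by simp) (fun x y hx hy => ?_) (fun j α a ha => ?_) p
    · simp only [map_add]
      rw [finsum_add_distrib, hx, hy]
      · exact (fl x).subset fun i hi hc => hi (by simp [hc])
      · exact (fl y).subset fun i hi hc => hi (by simp [hc])
    · rw [finsum_eq_single _ j fun i hi => by rw [hd i j hi.symm α a ha, map_zero],
        hq.smul_right hA ha (hb.dual_mem hA h2 hq j), hb.form_dual_self hA hq, mul_one, map_zsmul,
        rmul_of_mem 𝒜 𝒩 ha (hb.mem_deg j), sgn_smul_sgn_smul]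
      rfl
  · refine basis_induction (𝒜 := 𝒜) b (by simp) (fun x y hx hy => ?_) (fun j α a ha => ?_) p
    · simp only [map_add, AddMonoidHom.add_apply, add_smul]
      rw [finsum_add_distrib, hx, hy]
      · exact (fr x).subset fun i hi hc => hi (by simp [hc])
      · exact (fr y).subset fun i hi hc => hi (by simp [hc])
    -- Here the surviving index is `bar j`, not `j`: the vector `a b_j` pairs only with `b_{bar j}`,
    -- whose dual vector is a multiple of `b_j`.
    · rw [finsum_eq_single _ (bar j) fun i hi => by rw [hr i j hi, zero_smul],
        hq.smul_left hA, dual, hb.bar_bar hq, smul_smul, mul_assoc,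
        Ring.mul_inverse_cancel _ (hb.isUnit j), mul_one]
      rfl

end IsAlmostDiagonal

/-! ### Elements of `osp(q)` as sums of summable families of maps `E_{m,n}`. -/

section Expansion

variable {A : Type*} [Ring A] {𝒜 : ZMod 2 → AddSubgroup A} [GradedRing 𝒜]
  {M : Type*} [AddCommGroup M] [Module A M] {ℳ : ZMod 2 → AddSubgroup M}
  [DirectSum.Decomposition ℳ] [SetLike.GradedSMul 𝒜 ℳ] {q : M →+ M →+ A} {I : Type*}
  {b e : I → M} {π : M →+ M}

/-- Elements of `osp(q)` which take a dual family to an "off-diagonal" one are sums of summable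
families of maps `E_{m,n}`. -/
theorem IsDualFamily.mem_summableClosure (h : IsDualFamily 𝒜 ℳ q b e π)
    (hinj : Function.Injective b) {x : M →+ M}
    (hx : x ∈ osp 𝒜 ℳ q) (hs : ∀ p, x (π p) + π (x p) = x p) {X : AddSubgroup (M →+ M)}
    (hX : ∀ i, eMap 𝒜 ℳ q (x (b i)) (e i) ∈ X) : x ∈ summableClosure X :=
  mem_summableClosure_of_injective hinj hX (h.finite_eMap hx) fun p => by
    rw [h.finsum_eMap hx, hs]

/-- Elements of `osp(q)` supported on the span of a dual family are sums of summable families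
of maps `E_{m,n}`. -/
theorem IsDualFamily.mem_eospBar_of_block (h : IsDualFamily 𝒜 ℳ q b e π)
    (hinj : Function.Injective b) (hA : IsSupercommutative 𝒜) (h2 : IsUnit (2 : A))
    (hq : IsQuadraticForm 𝒜 ℳ q) {x : M →+ M}
    (hx : x ∈ osp 𝒜 ℳ q) (hs : ∀ p, x (π p) = x p) (hs' : ∀ p, π (x p) = x p) :
    x ∈ eospBar 𝒜 ℳ q := by
  -- The factor `½` is absorbed into the first index, so the terms of the family remain generators
  -- of `eosp(q)`.
  have e1 : ∀ m n, eMap 𝒜 ℳ q (Ring.inverse (2 : A) • m) n = Ring.inverse (2 : A) • eMap 𝒜 ℳ q m n :=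
    fun m n => hq.eMap_smul_left hA _ m n
  have hz : ∀ i p, eMap 𝒜 ℳ q (x (b i)) (e i) p = 0 →
      eMap 𝒜 ℳ q (Ring.inverse (2 : A) • x (b i)) (e i) p = 0 := fun i p hc => by
    rw [e1, AddMonoidHom.smul_apply, hc, smul_zero]
  refine mem_summableClosure_of_injective (x := fun i =>
      eMap 𝒜 ℳ q (Ring.inverse (2 : A) • x (b i)) (e i)) hinj (fun i => eMap_mem_eosp _ _)
    (fun p => (h.finite_eMap hx p).subset fun i hi hc => hi (hz i p hc)) fun p => ?_
  simp_rw [e1, AddMonoidHom.smul_apply]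
  have h3 := (DistribSMul.toAddMonoidHom M (Ring.inverse (2 : A))).map_finsum
    (h.finite_eMap hx p)
  rw [h.finsum_eMap hx, hs, hs'] at h3
  exact (inverse_two_smul_add_self h2 _).symm.trans h3

end Expansion

/-! ### Endomorphisms of a direct sum -/

section Prod

variable {N P : Type*} [AddCommGroup N] [AddCommGroup P]
  {𝒩 : ZMod 2 → AddSubgroup N} {𝓟 : ZMod 2 → AddSubgroup P}

theorem mem_prodGr {α : ZMod 2} {x : N × P} : x ∈ prodGr 𝒩 𝓟 α ↔ x.1 ∈ 𝒩 α ∧ x.2 ∈ 𝓟 α :=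
  AddSubgroup.mem_prod

theorem inl_mem_prodGr {α : ZMod 2} {n : N} (hn : n ∈ 𝒩 α) : ((n, 0) : N × P) ∈ prodGr 𝒩 𝓟 α :=
  mem_prodGr.2 ⟨hn, zero_mem _⟩

theorem inr_mem_prodGr {α : ZMod 2} {p : P} (hp : p ∈ 𝓟 α) : ((0, p) : N × P) ∈ prodGr 𝒩 𝓟 α :=
  mem_prodGr.2 ⟨zero_mem _, hp⟩

theorem blockN_apply (f : N × P →+ N × P) (n : N) : blockN f n = (f (n, 0)).1 := rfl

theorem blockP_apply (f : N × P →+ N × P) (p : P) : blockP f p = (f (0, p)).2 := rfl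

theorem blockN_add (f g : N × P →+ N × P) : blockN (f + g) = blockN f + blockN g := rfl

theorem blockP_add (f g : N × P →+ N × P) : blockP (f + g) = blockP f + blockP g := rfl

theorem blockN_sub (f g : N × P →+ N × P) : blockN (f - g) = blockN f - blockN g := rfl

theorem blockP_sub (f g : N × P →+ N × P) : blockP (f - g) = blockP f - blockP g := rfl

theorem prodMap_eval (f : N →+ N) (g : P →+ P) (x : N × P) :
    f.prodMap g x = (f x.1, g x.2) := rfl

@[simp] theorem blockN_prodMap (f : N →+ N) (g : P →+ P) : blockN (f.prodMap g) = f := rfl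

@[simp] theorem blockP_prodMap (f : N →+ N) (g : P →+ P) : blockP (f.prodMap g) = g := rfl

theorem prodMap_add (f f' : N →+ N) (g g' : P →+ P) :
    (f + f').prodMap (g + g') = f.prodMap g + f'.prodMap g' := rfl

theorem prodMap_mem_endGr {α : ZMod 2} {f : N →+ N} {g : P →+ P} (hf : f ∈ endGr 𝒩 α)
    (hg : g ∈ endGr 𝓟 α) : f.prodMap g ∈ endGr (prodGr 𝒩 𝓟) α := fun β _ hm =>
  mem_prodGr.2 ⟨hf β _ (mem_prodGr.1 hm).1, hg β _ (mem_prodGr.1 hm).2⟩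

theorem blockN_mem_endGr {α : ZMod 2} {f : N × P →+ N × P} (hf : f ∈ endGr (prodGr 𝒩 𝓟) α) :
    blockN f ∈ endGr 𝒩 α := fun β _ hm => (mem_prodGr.1 (hf β _ (inl_mem_prodGr hm))).1

theorem blockP_mem_endGr {α : ZMod 2} {f : N × P →+ N × P} (hf : f ∈ endGr (prodGr 𝒩 𝓟) α) :
    blockP f ∈ endGr 𝓟 α := fun β _ hm => (mem_prodGr.1 (hf β _ (inr_mem_prodGr hm))).2

variable (N P) in
/-- The endomorphisms preserving both summands. -/
def diagEnd : AddSubgroup (N × P →+ N × P) where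
  carrier := {f | (∀ n, (f (n, 0)).2 = 0) ∧ ∀ p, (f (0, p)).1 = 0}
  zero_mem' := ⟨fun _ => rfl, fun _ => rfl⟩
  add_mem' hf hg := ⟨fun n => by simp [hf.1 n, hg.1 n], fun p => by simp [hf.2 p, hg.2 p]⟩
  neg_mem' hf := ⟨fun n => by simp [hf.1 n], fun p => by simp [hf.2 p]⟩

variable (N P) in
/-- The endomorphisms exchanging the two summands. -/
def offEnd : AddSubgroup (N × P →+ N × P) where
  carrier := {f | (∀ n, (f (n, 0)).1 = 0) ∧ ∀ p, (f (0, p)).2 = 0}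
  zero_mem' := ⟨fun _ => rfl, fun _ => rfl⟩
  add_mem' hf hg := ⟨fun n => by simp [hf.1 n, hg.1 n], fun p => by simp [hf.2 p, hg.2 p]⟩
  neg_mem' hf := ⟨fun n => by simp [hf.1 n], fun p => by simp [hf.2 p]⟩

theorem prodMap_mem_diagEnd (f : N →+ N) (g : P →+ P) : f.prodMap g ∈ diagEnd N P :=
  ⟨fun _ => map_zero g, fun _ => map_zero f⟩

theorem eq_prodMap_of_mem_diagEnd {f : N × P →+ N × P} (hf : f ∈ diagEnd N P) :
    f = (blockN f).prodMap (blockP f) := by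
  refine AddMonoidHom.ext fun x => ?_
  have e : f x = f (x.1, 0) + f (0, x.2) := by rw [← map_add]; simp
  rw [e, Prod.ext_iff]
  simp [hf.1 x.1, hf.2 x.2, blockN_apply, blockP_apply]

theorem blockN_of_mem_offEnd {f : N × P →+ N × P} (hf : f ∈ offEnd N P) : blockN f = 0 :=
  AddMonoidHom.ext hf.1

theorem blockP_of_mem_offEnd {f : N × P →+ N × P} (hf : f ∈ offEnd N P) : blockP f = 0 :=
  AddMonoidHom.ext hf.2

theorem mem_offEnd_of_block {f : N × P →+ N × P} (h1 : blockN f = 0) (h2 : blockP f = 0) :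
    f ∈ offEnd N P :=
  ⟨fun n => DFunLike.congr_fun h1 n, fun p => DFunLike.congr_fun h2 p⟩

theorem diag_inl {f : N × P →+ N × P} (hf : f ∈ diagEnd N P) (n : N) :
    f (n, 0) = ((f (n, 0)).1, 0) := Prod.ext rfl (hf.1 n)

theorem diag_inr {f : N × P →+ N × P} (hf : f ∈ diagEnd N P) (p : P) :
    f (0, p) = (0, (f (0, p)).2) := Prod.ext (hf.2 p) rfl

theorem off_inl {f : N × P →+ N × P} (hf : f ∈ offEnd N P) (n : N) :
    f (n, 0) = (0, (f (n, 0)).2) := Prod.ext (hf.1 n) rfl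

theorem off_inr {f : N × P →+ N × P} (hf : f ∈ offEnd N P) (p : P) :
    f (0, p) = ((f (0, p)).1, 0) := Prod.ext rfl (hf.2 p)

theorem off_comp_off {f g : N × P →+ N × P} (hf : f ∈ offEnd N P) (hg : g ∈ offEnd N P) :
    f.comp g ∈ diagEnd N P := by
  refine ⟨fun n => ?_, fun p => ?_⟩
  · rw [AddMonoidHom.comp_apply, off_inl hg, off_inr hf]
  · rw [AddMonoidHom.comp_apply, off_inr hg, off_inl hf]

theorem diag_comp_off {f g : N × P →+ N × P} (hf : f ∈ diagEnd N P) (hg : g ∈ offEnd N P) :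
    f.comp g ∈ offEnd N P := by
  refine ⟨fun n => ?_, fun p => ?_⟩
  · rw [AddMonoidHom.comp_apply, off_inl hg, diag_inr hf]
  · rw [AddMonoidHom.comp_apply, off_inr hg, diag_inl hf]

theorem off_comp_diag {f g : N × P →+ N × P} (hf : f ∈ offEnd N P) (hg : g ∈ diagEnd N P) :
    f.comp g ∈ offEnd N P := by
  refine ⟨fun n => ?_, fun p => ?_⟩
  · rw [AddMonoidHom.comp_apply, diag_inl hg, off_inl hf]
  · rw [AddMonoidHom.comp_apply, diag_inr hg, off_inr hf]

/-- With `π` the projection to `N`, this is `xπ + πx = x`, the condition under which the expansion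
along `N` reproduces `x` without a factor `½`. -/
theorem off_expand {f : N × P →+ N × P} (hf : f ∈ offEnd N P) (x : N × P) :
    f ((AddMonoidHom.inl N P).comp (AddMonoidHom.fst N P) x) +
      (AddMonoidHom.inl N P).comp (AddMonoidHom.fst N P) (f x) = f x := by
  have e : f x = f (x.1, 0) + f (0, x.2) := by rw [← map_add]; simp
  rw [e, Prod.ext_iff]
  simp [hf.1 x.1, hf.2 x.2]

variable [DirectSum.Decomposition 𝒩] [DirectSum.Decomposition 𝓟]

theorem proj_prodGr (α : ZMod 2) (x : N × P) :
    proj (prodGr 𝒩 𝓟) α x = (proj 𝒩 α x.1, proj 𝓟 α x.2) := by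
  refine homog_induction (prodGr 𝒩 𝓟) x (fun x y hx hy => ?_) fun β x hx => ?_
  · rw [map_add, hx, hy, Prod.fst_add, Prod.snd_add, map_add, map_add]; rfl
  · rw [proj_of_mem _ hx, proj_of_mem _ (mem_prodGr.1 hx).1, proj_of_mem _ (mem_prodGr.1 hx).2]
    split_ifs <;> rfl

theorem endProj_prodMap (α : ZMod 2) (f : N →+ N) (g : P →+ P) :
    endProj (prodGr 𝒩 𝓟) α (f.prodMap g) = (endProj 𝒩 α f).prodMap (endProj 𝓟 α g) := by
  refine AddMonoidHom.ext fun x => ?_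
  simp only [endProj_apply, proj_prodGr, prodMap_eval, Prod.mk_add_mk]

theorem endProj_blockN (α : ZMod 2) (f : N × P →+ N × P) :
    endProj 𝒩 α (blockN f) = blockN (endProj (prodGr 𝒩 𝓟) α f) := by
  ext n
  simp [blockN_apply, endProj_apply, proj_prodGr]

theorem endProj_blockP (α : ZMod 2) (f : N × P →+ N × P) :
    endProj 𝓟 α (blockP f) = blockP (endProj (prodGr 𝒩 𝓟) α f) := by
  ext n
  simp [blockP_apply, endProj_apply, proj_prodGr]

theorem endProj_mem_offEnd {f : N × P →+ N × P} (hf : f ∈ offEnd N P) (α : ZMod 2) :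
    endProj (prodGr 𝒩 𝓟) α f ∈ offEnd N P := by
  refine mem_offEnd_of_block ?_ ?_
  · rw [← endProj_blockN, blockN_of_mem_offEnd hf, map_zero]
  · rw [← endProj_blockP, blockP_of_mem_offEnd hf, map_zero]

theorem endProj_mem_diagEnd {f : N × P →+ N × P} (hf : f ∈ diagEnd N P) (α : ZMod 2) :
    endProj (prodGr 𝒩 𝓟) α f ∈ diagEnd N P := by
  rw [eq_prodMap_of_mem_diagEnd hf, endProj_prodMap]
  exact prodMap_mem_diagEnd _ _

theorem sbr_prodMap (f f' : N →+ N) (g g' : P →+ P) :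
    sbr (prodGr 𝒩 𝓟) (f.prodMap g) (f'.prodMap g') = (sbr 𝒩 f f').prodMap (sbr 𝓟 g g') := by
  refine AddMonoidHom.ext fun x => ?_
  simp only [sbr_apply, endProj_prodMap, prodMap_eval, Prod.mk_add_mk, Prod.mk_sub_mk]

theorem sbr_diag_off {f g : N × P →+ N × P} (hf : f ∈ diagEnd N P) (hg : g ∈ offEnd N P) :
    sbr (prodGr 𝒩 𝓟) f g ∈ offEnd N P :=
  sub_mem (diag_comp_off hf hg) (sum_mem fun _ _ => sum_mem fun _ _ => zsmul_mem
    (off_comp_diag (endProj_mem_offEnd hg _) (endProj_mem_diagEnd hf _)) _)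

theorem sbr_off_diag {f g : N × P →+ N × P} (hf : f ∈ offEnd N P) (hg : g ∈ diagEnd N P) :
    sbr (prodGr 𝒩 𝓟) f g ∈ offEnd N P :=
  sub_mem (off_comp_diag hf hg) (sum_mem fun _ _ => sum_mem fun _ _ => zsmul_mem
    (diag_comp_off (endProj_mem_diagEnd hg _) (endProj_mem_offEnd hf _)) _)

theorem sbr_off_off {f g : N × P →+ N × P} (hf : f ∈ offEnd N P) (hg : g ∈ offEnd N P) :
    sbr (prodGr 𝒩 𝓟) f g ∈ diagEnd N P :=
  sub_mem (off_comp_off hf hg) (sum_mem fun _ _ => sum_mem fun _ _ => zsmul_mem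
    (off_comp_off (endProj_mem_offEnd hg _) (endProj_mem_offEnd hf _)) _)

end Prod

/-! ### Derivations and forms on an orthogonal direct sum. -/

section ProdForm

variable {K : Type*} [Ring K] {𝒦 : ZMod 2 → AddSubgroup K} [GradedRing 𝒦]
  {A : Type*} [Ring A] {𝒜 : ZMod 2 → AddSubgroup A} [GradedRing 𝒜]
  [Module K A] [SetLike.GradedSMul 𝒦 𝒜]
  {N P : Type*} [AddCommGroup N] [Module A N] [AddCommGroup P] [Module A P]
  [Module K N] [IsScalarTower K A N] [Module K P] [IsScalarTower K A P]
  {𝒩 : ZMod 2 → AddSubgroup N} [DirectSum.Decomposition 𝒩] [SetLike.GradedSMul 𝒜 𝒩]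
  {𝓟 : ZMod 2 → AddSubgroup P} [DirectSum.Decomposition 𝓟] [SetLike.GradedSMul 𝒜 𝓟]
  {qN : N →+ N →+ A} {qP : P →+ P →+ A}

theorem orthSum_apply (x y : N × P) : orthSum qN qP x y = qN x.1 y.1 + qP x.2 y.2 := rfl

theorem rmul_prodGr (x : N × P) (a : A) :
    rmul 𝒜 (prodGr 𝒩 𝓟) x a = (rmul 𝒜 𝒩 x.1 a, rmul 𝒜 𝓟 x.2 a) := by
  refine homog_induction (prodGr 𝒩 𝓟) x (fun x y hx hy => ?_) fun β x hx => ?_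
  · simp only [rmul_add, AddMonoidHom.add_apply, hx, hy, Prod.fst_add, Prod.snd_add]; rfl
  refine homog_induction 𝒜 a (fun x y hx hy => ?_) fun α a ha => ?_
  · simp only [map_add, hx, hy]; rfl
  rw [rmul_of_mem _ _ ha hx, rmul_of_mem _ _ ha (mem_prodGr.1 hx).1,
    rmul_of_mem _ _ ha (mem_prodGr.1 hx).2]
  rfl

theorem IsQuadraticForm.orthSum (hqN : IsQuadraticForm 𝒜 𝒩 qN) (hqP : IsQuadraticForm 𝒜 𝓟 qP) :
    IsQuadraticForm 𝒜 (prodGr 𝒩 𝓟) (orthSum qN qP) where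
  balanced m n a := by
    simp only [orthSum_apply, rmul_prodGr, hqN.balanced, hqP.balanced]; rfl
  right_linear m n a := by
    simp only [orthSum_apply, rmul_prodGr, hqN.right_linear, hqP.right_linear, add_mul]
  degree α β m hm n hn :=
    add_mem (hqN.degree α β _ (mem_prodGr.1 hm).1 _ (mem_prodGr.1 hn).1)
      (hqP.degree α β _ (mem_prodGr.1 hm).2 _ (mem_prodGr.1 hn).2)
  supersymm α β m hm n hn := by
    rw [orthSum_apply, orthSum_apply,
      hqN.supersymm α β _ (mem_prodGr.1 hm).1 _ (mem_prodGr.1 hn).1,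
      hqP.supersymm α β _ (mem_prodGr.1 hm).2 _ (mem_prodGr.1 hn).2, smul_add]

theorem IsFaithful.prod (hP : IsFaithful A P) : IsFaithful A (N × P) := fun a h =>
  hP a fun p => congrArg Prod.snd (h (0, p))

variable {σ : ZMod 2} {Δ : A →+ A}

theorem IsSim.prodMap {f : N →+ N} {g : P →+ P} (hf : IsSim 𝒦 𝒜 𝒩 qN σ f Δ)
    (hg : IsSim 𝒦 𝒜 𝓟 qP σ g Δ) :
    IsSim 𝒦 𝒜 (prodGr 𝒩 𝓟) (orthSum qN qP) σ (f.prodMap g) Δ where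
  degree := prodMap_mem_endGr hf.degree hg.degree
  degA := hf.degA
  linear κ k hk m := Prod.ext (hf.linear κ k hk m.1) (hg.linear κ k hk m.2)
  smul κ a ha m := Prod.ext (hf.smul κ a ha m.1) (hg.smul κ a ha m.2)
  form β m hm n := by
    simp only [orthSum_apply, map_add, hf.form β _ (mem_prodGr.1 hm).1,
      hg.form β _ (mem_prodGr.1 hm).2, smul_add, AddMonoidHom.coe_prodMap, Prod.map]
    abel

/-- Since `N` and `P` are orthogonal, a vector of `N` pairs only with the `N`-component of a value
of `f`. Thus compressing to a block keeps every rule, with the same `Δ`. -/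
theorem IsSim.blockN {f : N × P →+ N × P}
    (hf : IsSim 𝒦 𝒜 (prodGr 𝒩 𝓟) (orthSum qN qP) σ f Δ) : IsSim 𝒦 𝒜 𝒩 qN σ (blockN f) Δ where
  degree := blockN_mem_endGr hf.degree
  degA := hf.degA
  linear κ k hk m := by
    have h := congrArg Prod.fst (hf.linear κ k hk (m, 0))
    simpa [blockN_apply] using h
  smul κ a ha m := by
    have h := congrArg Prod.fst (hf.smul κ a ha (m, 0))
    simpa [blockN_apply] using h
  form β m hm n := by
    have h := hf.form β (m, 0) (inl_mem_prodGr hm) (n, 0)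
    simpa [orthSum_apply, blockN_apply] using h

theorem IsSim.blockP {f : N × P →+ N × P}
    (hf : IsSim 𝒦 𝒜 (prodGr 𝒩 𝓟) (orthSum qN qP) σ f Δ) : IsSim 𝒦 𝒜 𝓟 qP σ (blockP f) Δ where
  degree := blockP_mem_endGr hf.degree
  degA := hf.degA
  linear κ k hk m := by
    have h := congrArg Prod.snd (hf.linear κ k hk (0, m))
    simpa [blockP_apply] using h
  smul κ a ha m := by
    have h := congrArg Prod.snd (hf.smul κ a ha (0, m))
    simpa [blockP_apply] using h
  form β m hm n := by
    have h := hf.form β (0, m) (inr_mem_prodGr hm) (0, n)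
    simpa [orthSum_apply, blockP_apply] using h

theorem IsDer.prodMap {f : N →+ N} {g : P →+ P} (hf : IsDer 𝒦 𝒜 𝒩 qN f Δ)
    (hg : IsDer 𝒦 𝒜 𝓟 qP g Δ) :
    IsDer 𝒦 𝒜 (prodGr 𝒩 𝓟) (orthSum qN qP) (f.prodMap g) Δ := fun α => by
  rw [endProj_prodMap]; exact (hf α).prodMap (hg α)

theorem IsDer.blockN {f : N × P →+ N × P}
    (hf : IsDer 𝒦 𝒜 (prodGr 𝒩 𝓟) (OspDer.orthSum qN qP) f Δ) :
    IsDer 𝒦 𝒜 𝒩 qN (OspDer.blockN f) Δ := fun α => by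
  rw [endProj_blockN (𝓟 := 𝓟)]; exact (hf α).blockN

theorem IsDer.blockP {f : N × P →+ N × P}
    (hf : IsDer 𝒦 𝒜 (prodGr 𝒩 𝓟) (OspDer.orthSum qN qP) f Δ) :
    IsDer 𝒦 𝒜 𝓟 qP (OspDer.blockP f) Δ := fun α => by
  rw [endProj_blockP (𝒩 := 𝒩)]; exact (hf α).blockP

theorem IsDer.zero {M : Type*} [AddCommGroup M] [Module A M] [Module K M]
    {ℳ : ZMod 2 → AddSubgroup M} [DirectSum.Decomposition ℳ] {q : M →+ M →+ A} :
    IsDer 𝒦 𝒜 ℳ q 0 0 := fun α => by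
  rw [map_zero, map_zero]; exact IsSim.zero

variable {I : Type*} {b : Module.Basis I A N} {bar : I → I}

theorem IsDer.derExt (hA : IsSupercommutative 𝒜) (h2 : IsUnit (2 : A)) (hP : IsFaithful A P)
    (hqN : IsQuadraticForm 𝒜 𝒩 qN) (hb : IsAlmostDiagonal 𝒩 qN b bar) {S : P →+ P}
    (hS : IsDer 𝒦 𝒜 𝓟 qP S Δ) : IsDer 𝒦 𝒜 𝒩 qN (derExt qN b bar Δ) Δ := by
  refine hS.induction (fun S Δ T Θ h h' => ?_) fun σ S Δ hS => ?_
  · rw [IsAlmostDiagonal.derExt_add]; exact h.add h'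
  · exact (hb.derExt_isSim hA h2 hqN (hS.isADer hP)).isDer

theorem IsDer.derExt_sbr (hA : IsSupercommutative 𝒜) (h2 : IsUnit (2 : A)) (hP : IsFaithful A P)
    (hqN : IsQuadraticForm 𝒜 𝒩 qN) (hb : IsAlmostDiagonal 𝒩 qN b bar) {S T : P →+ P}
    {Θ : A →+ A} (hS : IsDer 𝒦 𝒜 𝓟 qP S Δ) (hT : IsDer 𝒦 𝒜 𝓟 qP T Θ) :
    OspDer.derExt qN b bar (OspDer.sbr 𝒜 Δ Θ) =
      OspDer.sbr 𝒩 (OspDer.derExt qN b bar Δ) (OspDer.derExt qN b bar Θ) := by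
  refine hS.induction (fun S Δ S' Δ' h h' => ?_) fun σ S Δ hS => ?_
  · simp only [sbr_add_left, IsAlmostDiagonal.derExt_add, h, h']
  refine hT.induction (fun T Θ T' Θ' h h' => ?_) fun τ T Θ hT => ?_
  · simp only [sbr_add_right, IsAlmostDiagonal.derExt_add, h, h']
  exact hb.derExt_sbr hA h2 hqN (hS.isADer hP) (hT.isADer hP)

/-- Both blocks are derivations over the same `Δ`, as they must be to combine into a derivation of
the orthogonal sum. -/
theorem IsDer.hat (hA : IsSupercommutative 𝒜) (h2 : IsUnit (2 : A)) (hP : IsFaithful A P)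
    (hqN : IsQuadraticForm 𝒜 𝒩 qN) (hb : IsAlmostDiagonal 𝒩 qN b bar) {S : P →+ P}
    (hS : IsDer 𝒦 𝒜 𝓟 qP S Δ) :
    IsDer 𝒦 𝒜 (prodGr 𝒩 𝓟) (OspDer.orthSum qN qP) (hat 𝓟 qN b bar S) Δ := by
  rw [OspDer.hat, hS.adA_eq hP]
  exact (hS.derExt hA h2 hP hqN hb).prodMap hS

/-! ### The closures of `eosp(q_N)` and `eosp(q_N, q_P)` -/

/-- On `N` the projection `π` is the identity, so every element of `osp(q_N)` is half the sum of the
`E_{x(b_i), e_i}`. -/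
theorem eospBar_eq_osp (hA : IsSupercommutative 𝒜) (h2 : IsUnit (2 : A))
    (hqN : IsQuadraticForm 𝒜 𝒩 qN) (hb : IsAlmostDiagonal 𝒩 qN b bar) :
    eospBar 𝒜 𝒩 qN = osp 𝒜 𝒩 qN := by
  refine le_antisymm (eospBar_le_osp hA hqN) fun x hx => ?_
  rcases subsingleton_or_nontrivial A with hs | hs
  · have hN : Subsingleton N := Module.subsingleton A N
    rw [show x = 0 by ext; exact Subsingleton.elim _ _]
    exact zero_mem _
  · exact (hb.isDualFamily hA h2 hqN).mem_eospBar_of_block b.injective hA h2 hqN hx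
      (fun _ => rfl) fun _ => rfl

/-- Inside `N ⊕ P`, the dual basis of `N` expands the projection to `N`. No basis or nondegeneracy
of `P` is involved. -/
theorem isDualFamily_inl [Nontrivial A] (hA : IsSupercommutative 𝒜) (h2 : IsUnit (2 : A))
    (hqN : IsQuadraticForm 𝒜 𝒩 qN) (hb : IsAlmostDiagonal 𝒩 qN b bar) :
    IsDualFamily 𝒜 (prodGr 𝒩 𝓟) (orthSum qN qP) (fun i => (b i, 0))
      (fun i => (IsAlmostDiagonal.dual qN b bar i, 0))
      ((AddMonoidHom.inl N P).comp (AddMonoidHom.fst N P)) := by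
  have h := hb.isDualFamily hA h2 hqN
  refine ⟨fun i => ?_, fun p => ?_, fun p => ?_, fun p => ?_, fun p => ?_⟩
  · obtain ⟨δ, h1, h2⟩ := h.homogeneous i
    exact ⟨δ, inl_mem_prodGr h1, inl_mem_prodGr h2⟩
  · simpa [orthSum_apply] using h.fin_left p.1
  · simpa [orthSum_apply] using h.fin_right p.1
  · have h1 : {i | rmul 𝒜 𝒩 (b i) (qN (IsAlmostDiagonal.dual qN b bar i) p.1) ≠ 0}.Finite :=
      (h.fin_left p.1).subset fun i hi hc => hi (by simp [hc])
    have h2 := (AddMonoidHom.inl N P).map_finsum h1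
    rw [h.sum_left] at h2
    rw [AddMonoidHom.comp_apply, AddMonoidHom.coe_fst]
    refine Eq.trans (finsum_congr fun i => ?_) h2.symm
    simp [rmul_prodGr, orthSum_apply]
  · have h1 : {i | qN p.1 (b i) • IsAlmostDiagonal.dual qN b bar i ≠ 0}.Finite :=
      (h.fin_right p.1).subset fun i hi hc => hi (by simp [hc])
    have h2 := (AddMonoidHom.inl N P).map_finsum h1
    rw [h.sum_right] at h2
    rw [AddMonoidHom.comp_apply, AddMonoidHom.coe_fst]
    refine Eq.trans (finsum_congr fun i => ?_) h2.symm
    simp [orthSum_apply]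

theorem inl_basis_injective [Nontrivial A] : Function.Injective fun i => ((b i, 0) : N × P) :=
  fun _ _ h => b.injective (congrArg Prod.fst h)

theorem eMap_inr_inl_mem_eospMixed (hqN : IsQuadraticForm 𝒜 𝒩 qN)
    (hqP : IsQuadraticForm 𝒜 𝓟 qP) (n : N) (p : P) :
    eMap 𝒜 (prodGr 𝒩 𝓟) (orthSum qN qP) (0, p) (n, 0) ∈ eospMixed 𝒜 𝒩 𝓟 qN qP := by
  refine homog_induction 𝒩 n (fun x y hx hy => ?_) fun α n hn => ?_
  · rw [show ((x + y, 0) : N × P) = (x, 0) + (y, 0) by simp, eMap_add_right]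
    exact add_mem hx hy
  refine homog_induction 𝓟 p (fun x y hx hy => ?_) fun β p hp => ?_
  · rw [show ((0, x + y) : N × P) = (0, x) + (0, y) by simp, eMap_add_left]
    exact add_mem hx hy
  rw [(hqN.orthSum hqP).eMap_skew (inr_mem_prodGr hp) (inl_mem_prodGr hn)]
  have h : eMap 𝒜 (prodGr 𝒩 𝓟) (orthSum qN qP) (n, 0) (0, p) ∈ eospMixed 𝒜 𝒩 𝓟 qN qP :=
    Submodule.subset_span ⟨n, p, rfl⟩
  exact neg_mem (zsmul_mem h _)

/-- By orthogonality a generator `E_{n,p}` sends `N` into multiples of `p` and `P` into multiples of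
`n`; both conditions are stable under `A`. -/
theorem eospMixed_le (hA : IsSupercommutative 𝒜) (hqN : IsQuadraticForm 𝒜 𝒩 qN)
    (hqP : IsQuadraticForm 𝒜 𝓟 qP) :
    eospMixed 𝒜 𝒩 𝓟 qN qP ≤ osp 𝒜 (prodGr 𝒩 𝓟) (orthSum qN qP) ⊓ offEnd N P := by
  have hq := hqN.orthSum hqP
  intro f hf
  refine Submodule.span_induction (p := fun f _ => f ∈ osp 𝒜 (prodGr 𝒩 𝓟) (orthSum qN qP) ⊓
    offEnd N P) ?_ (zero_mem _) (fun x y _ _ hx hy => add_mem hx hy) ?_ hf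
  · rintro _ ⟨n, p, rfl⟩
    refine ⟨eosp_le_osp hA hq (eMap_mem_eosp _ _), ?_⟩
    refine homog_induction 𝓟 p (fun x y hx hy => ?_) fun β p hp => ?_
    · rw [show ((0, x + y) : N × P) = (0, x) + (0, y) by simp, eMap_add_right]
      exact add_mem hx hy
    refine ⟨fun n' => ?_, fun p' => ?_⟩
    · refine homog_induction 𝒩 n' (fun x y hx hy => ?_) fun γ n' hn' => ?_
      · rw [show ((x + y, 0) : N × P) = (x, 0) + (y, 0) by simp, map_add, Prod.fst_add, hx, hy,
          add_zero]
      rw [eMap_apply_of_mem _ _ (inr_mem_prodGr hp) (inl_mem_prodGr hn')]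
      simp [orthSum_apply]
    · refine homog_induction 𝓟 p' (fun x y hx hy => ?_) fun γ p' hp' => ?_
      · rw [show ((0, x + y) : N × P) = (0, x) + (0, y) by simp, map_add, Prod.snd_add, hx, hy,
          add_zero]
      rw [eMap_apply_of_mem _ _ (inr_mem_prodGr hp) (inr_mem_prodGr hp')]
      simp [orthSum_apply, rmul_prodGr]
  · intro a x _ hx
    refine ⟨?_, fun n => ?_, fun p => ?_⟩
    · have h := ((mem_osp_iff (𝒦 := 𝒜) hq).1 hx.1).ksmul hA hA hq a
      rw [smul_zero] at h
      exact (mem_osp_iff hq).2 h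
    · simp [hx.2.1 n]
    · simp [hx.2.2 p]

theorem summableClosure_offEnd_le {X : AddSubgroup (N × P →+ N × P)} (hX : X ≤ offEnd N P) :
    summableClosure X ≤ offEnd N P := by
  intro f hf
  refine ⟨fun n => ?_, fun p => ?_⟩
  · obtain ⟨x, hx, h⟩ := summableClosure_approx hf {(n, 0)}
    rw [h _ (by simp), (hX hx).1]
  · obtain ⟨x, hx, h⟩ := summableClosure_approx hf {(0, p)}
    rw [h _ (by simp), (hX hx).2]

/-- For the hard inclusion, an off-diagonal `x` is the sum of the `E_{x(b_i), e_i}`, and these are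
mixed generators because `x(b_i)` lies in `P` and `e_i` in `N`. -/
theorem summableClosure_eospMixed_eq (hA : IsSupercommutative 𝒜) (h2 : IsUnit (2 : A))
    (hqN : IsQuadraticForm 𝒜 𝒩 qN) (hqP : IsQuadraticForm 𝒜 𝓟 qP)
    (hb : IsAlmostDiagonal 𝒩 qN b bar) :
    summableClosure (eospMixed 𝒜 𝒩 𝓟 qN qP) =
      osp 𝒜 (prodGr 𝒩 𝓟) (orthSum qN qP) ⊓ offEnd N P := by
  have hq := hqN.orthSum hqP
  refine le_antisymm (le_inf ?_ ?_) fun x hx => ?_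
  · intro f hf
    refine summableClosure_osp_le ?_
    obtain ⟨ι, x, hx, h⟩ := hf
    exact ⟨ι, x, fun i => (eospMixed_le hA hqN hqP (hx i)).1, h⟩
  · exact summableClosure_offEnd_le fun x hx => (eospMixed_le hA hqN hqP hx).2
  rcases subsingleton_or_nontrivial A with hs | hs
  · have hN : Subsingleton (N × P) := Module.subsingleton A (N × P)
    rw [show x = 0 from AddMonoidHom.ext fun _ => Subsingleton.elim _ _]
    exact zero_mem _
  · refine (isDualFamily_inl hA h2 hqN hb).mem_summableClosure inl_basis_injective hx.1
      (off_expand hx.2) fun i => ?_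
    · rw [off_inl hx.2]
      exact eMap_inr_inl_mem_eospMixed hqN hqP _ _

/-- Elements of `osp(q)` with trivial `P → P` block are in the closure of `eosp(q)`. -/
theorem mem_eospBar_of_blockP_eq_zero (hA : IsSupercommutative 𝒜) (h2 : IsUnit (2 : A))
    (hqN : IsQuadraticForm 𝒜 𝒩 qN) (hqP : IsQuadraticForm 𝒜 𝓟 qP)
    (hb : IsAlmostDiagonal 𝒩 qN b bar) {x : N × P →+ N × P}
    (hx : x ∈ osp 𝒜 (prodGr 𝒩 𝓟) (orthSum qN qP)) (hP : blockP x = 0) :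
    x ∈ eospBar 𝒜 (prodGr 𝒩 𝓟) (orthSum qN qP) := by
  have hq := hqN.orthSum hqP
  rcases subsingleton_or_nontrivial A with hs | hs
  · have hN : Subsingleton (N × P) := Module.subsingleton A (N × P)
    rw [show x = 0 from AddMonoidHom.ext fun _ => Subsingleton.elim _ _]
    exact zero_mem _
  have hd := isDualFamily_inl (qP := qP) (𝓟 := 𝓟) hA h2 hqN hb
  -- The `N → N` block needs the expansion with `½` and the off-diagonal remainder the one without,
  -- so the two are treated separately.
  have h1 : (blockN x).prodMap 0 ∈ osp 𝒜 (prodGr 𝒩 𝓟) (orthSum qN qP) :=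
    (mem_osp_iff (𝒦 := 𝒜) hq).2
      (((mem_osp_iff (𝒦 := 𝒜) hq).1 hx).blockN.prodMap IsDer.zero)
  have h3 : (blockN x).prodMap 0 ∈ eospBar 𝒜 (prodGr 𝒩 𝓟) (orthSum qN qP) := by
    refine hd.mem_eospBar_of_block inl_basis_injective hA h2 hq h1 (fun p => ?_) fun p => ?_
    · simp [prodMap_eval]
    · simp [prodMap_eval]
  have h4 : x - (blockN x).prodMap 0 ∈ offEnd N P :=
    mem_offEnd_of_block (by rw [blockN_sub, blockN_prodMap, sub_self])
      (by rw [blockP_sub, blockP_prodMap, hP, sub_self])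
  have h5 : x - (blockN x).prodMap 0 ∈ eospBar 𝒜 (prodGr 𝒩 𝓟) (orthSum qN qP) := by
    refine hd.mem_summableClosure inl_basis_injective (sub_mem hx h1)
      (off_expand h4) fun i => eMap_mem_eosp _ _
  rw [← sub_add_cancel x ((blockN x).prodMap 0)]
  exact add_mem h5 h3

end ProdForm

/-! ### Transfer of Lie superalgebra structures -/

theorem isUnit_two_of_tower {K : Type*} [Ring K] {A : Type*} [Ring A] [Module K A]
    [IsScalarTower K A A] (h2 : IsUnit (2 : K)) : IsUnit (2 : A) := by
  obtain ⟨u, hu⟩ := h2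
  have e : (2 : A) = (u : K) • (1 : A) := by rw [hu, two_smul, one_add_one_eq_two]
  rw [e]
  refine ⟨⟨(u : K) • 1, (↑u⁻¹ : K) • 1, ?_, ?_⟩, rfl⟩ <;>
    rw [smul_mul_assoc, one_mul, smul_smul] <;> simp

section Transfer

variable {K : Type*} [Ring K] {𝒦 : ZMod 2 → AddSubgroup K} {V W : Type*} [AddCommGroup V]
  [Module K V] [AddCommGroup W] [Module K W]

/-- A bijection compatible with all the operations is an isomorphism of Lie superalgebras as soon
as its target is a Lie superalgebra and its source is closed under the operations. -/
theorem IsLieSuperIso.of_target {grV : ZMod 2 → AddSubgroup V} {L : AddSubgroup V}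
    {brV : V → V → V} {grW : ZMod 2 → AddSubgroup W} {L' : AddSubgroup W} {brW : W → W → W}
    {φ : V → W} (target : IsLieSuperalgebra 𝒦 grW L' brW) (bijOn : Set.BijOn φ L L')
    (smul_mem : ∀ k : K, ∀ x ∈ L, k • x ∈ L)
    (decompose : ∀ x ∈ L, ∃ y ∈ L, ∃ z ∈ L, y ∈ grV 0 ∧ z ∈ grV 1 ∧ x = y + z)
    (smul_degree : ∀ κ α, ∀ k ∈ 𝒦 κ, ∀ x ∈ L, x ∈ grV α → k • x ∈ grV (κ + α))
    (br_mem : ∀ x ∈ L, ∀ y ∈ L, brV x y ∈ L)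
    (br_degree : ∀ α β, ∀ x ∈ L, ∀ y ∈ L, x ∈ grV α → y ∈ grV β → brV x y ∈ grV (α + β))
    (map_add : ∀ x ∈ L, ∀ y ∈ L, φ (x + y) = φ x + φ y)
    (map_smul : ∀ k : K, ∀ x ∈ L, φ (k • x) = k • φ x)
    (map_degree : ∀ α, ∀ x ∈ L, x ∈ grV α → φ x ∈ grW α)
    (map_br : ∀ x ∈ L, ∀ y ∈ L, φ (brV x y) = brW (φ x) (φ y)) :
    IsLieSuperIso 𝒦 grV L brV grW L' brW φ := by
  let f : L →+ W := AddMonoidHom.mk' (fun x => φ x.1) fun x y => map_add _ x.2 _ y.2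
  have map_zsmul : ∀ (n : ℤ), ∀ x ∈ L, φ (n • x) = n • φ x := fun n x hx =>
    _root_.map_zsmul f n ⟨x, hx⟩
  have map_zero : φ 0 = 0 := _root_.map_zero f
  have maps : ∀ x ∈ L, φ x ∈ L' := fun x hx => bijOn.mapsTo hx
  have inj : ∀ {x y}, x ∈ L → y ∈ L → φ x = φ y → x = y := fun hx hy h => bijOn.injOn hx hy h
  have zs : ∀ (n : ℤ) {x}, x ∈ L → n • x ∈ L := fun n x hx => zsmul_mem hx n
  refine ⟨⟨smul_mem, decompose, fun x hx h0 h1 => ?_, smul_degree, br_mem, br_degree,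
    fun x hx y hy z hz => ?_, fun x hx y hy z hz => ?_, fun k x hx y hy => ?_,
    fun κ α k hk x hx hxd y hy => ?_, fun α β x hx y hy hxd hyd => ?_,
    fun α β γ x hx y hy z hz hxd hyd hzd => ?_⟩, target, bijOn, map_add, map_smul, map_degree,
    map_br⟩
  · refine inj hx (zero_mem _) ?_
    rw [map_zero]
    exact target.disjoint _ (maps x hx) (map_degree 0 x hx h0) (map_degree 1 x hx h1)
  · refine inj (br_mem _ (add_mem hx hy) _ hz) (add_mem (br_mem _ hx _ hz) (br_mem _ hy _ hz)) ?_
    rw [map_br _ (add_mem hx hy) _ hz, map_add _ hx _ hy,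
      map_add _ (br_mem _ hx _ hz) _ (br_mem _ hy _ hz), map_br _ hx _ hz, map_br _ hy _ hz,
      target.add_br _ (maps x hx) _ (maps y hy) _ (maps z hz)]
  · refine inj (br_mem _ hx _ (add_mem hy hz)) (add_mem (br_mem _ hx _ hy) (br_mem _ hx _ hz)) ?_
    rw [map_br _ hx _ (add_mem hy hz), map_add _ hy _ hz,
      map_add _ (br_mem _ hx _ hy) _ (br_mem _ hx _ hz), map_br _ hx _ hy, map_br _ hx _ hz,
      target.br_add _ (maps x hx) _ (maps y hy) _ (maps z hz)]
  · refine inj (br_mem _ (smul_mem k x hx) _ hy) (smul_mem k _ (br_mem _ hx _ hy)) ?_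
    rw [map_br _ (smul_mem k x hx) _ hy, map_smul k x hx, map_smul k _ (br_mem _ hx _ hy),
      map_br _ hx _ hy, target.smul_br k _ (maps x hx) _ (maps y hy)]
  · have h := smul_mem k _ (br_mem _ hx _ hy)
    refine inj (br_mem _ hx _ (smul_mem k y hy)) (zs _ h) ?_
    rw [map_br _ hx _ (smul_mem k y hy), map_smul k y hy, map_zsmul _ _ h,
      map_smul k _ (br_mem _ hx _ hy), map_br _ hx _ hy,
      target.br_smul κ α k hk _ (maps x hx) (map_degree α x hx hxd) _ (maps y hy)]
  · have h := br_mem _ hy _ hx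
    refine inj (br_mem _ hx _ hy) (neg_mem (zs _ h)) ?_
    rw [← neg_smul, map_zsmul _ _ h, map_br _ hx _ hy, map_br _ hy _ hx, neg_smul]
    exact target.skew α β _ (maps x hx) _ (maps y hy) (map_degree α x hx hxd)
      (map_degree β y hy hyd)
  · have h1 := br_mem _ (br_mem _ hx _ hy) _ hz
    have h2 := br_mem _ (br_mem _ hy _ hz) _ hx
    have h3 := br_mem _ (br_mem _ hz _ hx) _ hy
    refine inj (add_mem (add_mem (zs _ h1) (zs _ h2)) (zs _ h3)) (zero_mem _) ?_
    rw [map_add _ (add_mem (zs _ h1) (zs _ h2)) _ (zs _ h3), map_add _ (zs _ h1) _ (zs _ h2),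
      map_zsmul _ _ h1, map_zsmul _ _ h2, map_zsmul _ _ h3, map_br _ (br_mem _ hx _ hy) _ hz,
      map_br _ (br_mem _ hy _ hz) _ hx, map_br _ (br_mem _ hz _ hx) _ hy, map_br _ hx _ hy,
      map_br _ hy _ hz, map_br _ hz _ hx, map_zero]
    exact target.jacobi α β γ _ (maps x hx) _ (maps y hy) _ (maps z hz) (map_degree α x hx hxd)
      (map_degree β y hy hyd) (map_degree γ z hz hzd)

end Transfer

/-! ### The decomposition of `S^{(1)} ∩ S^{(2)}` for an orthogonal sum -/

section Split

variable {K : Type*} [Ring K] {𝒦 : ZMod 2 → AddSubgroup K} [GradedRing 𝒦]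
  {A : Type*} [Ring A] {𝒜 : ZMod 2 → AddSubgroup A} [GradedRing 𝒜]
  [Module K A] [SetLike.GradedSMul 𝒦 𝒜]
  {N P : Type*} [AddCommGroup N] [Module A N] [AddCommGroup P] [Module A P]
  [Module K N] [IsScalarTower K A N] [Module K P] [IsScalarTower K A P]
  {𝒩 : ZMod 2 → AddSubgroup N} [DirectSum.Decomposition 𝒩] [SetLike.GradedSMul 𝒜 𝒩]
  {𝓟 : ZMod 2 → AddSubgroup P} [DirectSum.Decomposition 𝓟] [SetLike.GradedSMul 𝒜 𝓟]
  {qN : N →+ N →+ A} {qP : P →+ P →+ A}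
  {I : Type*} {b : Module.Basis I A N} {bar : I → I}

/-- With the closures identified, membership in the direct sum becomes a condition on derivations,
and closedness under all operations reduces to that of `IsDer`. -/
theorem mem_splitSum_iff (hA : IsSupercommutative 𝒜) (h2 : IsUnit (2 : A))
    (hqN : IsQuadraticForm 𝒜 𝒩 qN) (hqP : IsQuadraticForm 𝒜 𝓟 qP) (hP : IsFaithful A P)
    (hb : IsAlmostDiagonal 𝒩 qN b bar) {t : (N →+ N) × (N × P →+ N × P) × (P →+ P)} :
    t ∈ splitSum 𝒜 𝒩 𝓟 qN qP (s12 (A := A) 𝒦 𝓟 qP) ↔ IsDer 𝒦 𝒜 𝒩 qN t.1 0 ∧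
      (IsDer 𝒦 𝒜 (prodGr 𝒩 𝓟) (orthSum qN qP) t.2.1 0 ∧ t.2.1 ∈ offEnd N P) ∧
      IsDer 𝒦 𝒜 𝓟 qP t.2.2 (adA A 𝓟 t.2.2) := by
  rw [splitSum, AddSubgroup.mem_prod, AddSubgroup.mem_prod, eospBar_eq_osp hA h2 hqN hb,
    summableClosure_eospMixed_eq hA h2 hqN hqP hb, mem_osp_iff (𝒦 := 𝒦) hqN,
    AddSubgroup.mem_inf, mem_osp_iff (𝒦 := 𝒦) (hqN.orthSum hqP)]
  refine and_congr Iff.rfl (and_congr Iff.rfl ⟨isDer_adA hP hqP, fun h => h.mem_s12 hqP⟩)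

theorem blockP_hat (S : P →+ P) : blockP (hat 𝓟 qN b bar S) = S := rfl

theorem IsDer.hat_mem_endGr (hA : IsSupercommutative 𝒜) (h2 : IsUnit (2 : A))
    (hP : IsFaithful A P) (hqN : IsQuadraticForm 𝒜 𝒩 qN) (hb : IsAlmostDiagonal 𝒩 qN b bar)
    {S : P →+ P} {Δ : A →+ A} {σ : ZMod 2} (hS : IsDer 𝒦 𝒜 𝓟 qP S Δ) (hd : S ∈ endGr 𝓟 σ) :
    OspDer.hat 𝓟 qN b bar S ∈ endGr (prodGr 𝒩 𝓟) σ := by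
  have h := hS.isSim hd (hS.degA hP hd)
  rw [OspDer.hat, hS.adA_eq hP]
  exact prodMap_mem_endGr (hb.derExt_isSim hA h2 hqN (h.isADer hP)).degree hd

theorem IsDer.hat_add (hP : IsFaithful A P) {S T : P →+ P} {Δ Θ : A →+ A}
    (hS : IsDer 𝒦 𝒜 𝓟 qP S Δ) (hT : IsDer 𝒦 𝒜 𝓟 qP T Θ) :
    OspDer.hat 𝓟 qN b bar (S + T) = OspDer.hat 𝓟 qN b bar S + OspDer.hat 𝓟 qN b bar T := by
  rw [OspDer.hat, OspDer.hat, OspDer.hat, (hS.add hT).adA_eq hP, hS.adA_eq hP, hT.adA_eq hP,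
    IsAlmostDiagonal.derExt_add, prodMap_add]

theorem IsDer.hat_ksmul [IsScalarTower K A A] (hK : IsSupercommutative 𝒦)
    (hA : IsSupercommutative 𝒜) (h2 : IsUnit (2 : A))
    (hqP : IsQuadraticForm 𝒜 𝓟 qP) (hP : IsFaithful A P) (k : K) {S : P →+ P} {Δ : A →+ A}
    (hS : IsDer 𝒦 𝒜 𝓟 qP S Δ) :
    OspDer.hat 𝓟 qN b bar (k • S) = k • OspDer.hat 𝓟 qN b bar S := by
  rw [OspDer.hat, OspDer.hat, (hS.ksmul hK hA hqP k).adA_eq hP, hS.adA_eq hP,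
    IsAlmostDiagonal.derExt_smul hA h2]
  rfl

/-- On `P` there is nothing to prove; on `N` this is the compatibility of `Δ ↦ Δ_N` with
superbrackets. -/
theorem IsDer.hat_sbr (hA : IsSupercommutative 𝒜) (h2 : IsUnit (2 : A)) (hP : IsFaithful A P)
    (hqN : IsQuadraticForm 𝒜 𝒩 qN) (hb : IsAlmostDiagonal 𝒩 qN b bar) {S T : P →+ P}
    {Δ Θ : A →+ A} (hS : IsDer 𝒦 𝒜 𝓟 qP S Δ) (hT : IsDer 𝒦 𝒜 𝓟 qP T Θ) :
    OspDer.hat 𝓟 qN b bar (OspDer.sbr 𝓟 S T) =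
      OspDer.sbr (prodGr 𝒩 𝓟) (OspDer.hat 𝓟 qN b bar S) (OspDer.hat 𝓟 qN b bar T) := by
  rw [OspDer.hat, OspDer.hat, OspDer.hat, (hS.sbr hT).adA_eq hP, hS.adA_eq hP, hT.adA_eq hP,
    hS.derExt_sbr hA h2 hP hqN hb hT, sbr_prodMap]

/-- It applies to the `P → P` block of a bracket of two off-diagonal elements, which has `Δ = 0`:
moving that block to the summand of the `S` adds nothing on `N`. -/
theorem IsDer.hat_of_linear (hP : IsFaithful A P) {S : P →+ P} (hS : IsDer 𝒦 𝒜 𝓟 qP S 0) :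
    OspDer.hat 𝓟 qN b bar S = (0 : N →+ N).prodMap S := by
  rw [OspDer.hat, hS.adA_eq hP, IsAlmostDiagonal.derExt_zero]

variable (hA : IsSupercommutative 𝒜) (h2 : IsUnit (2 : A)) (hqN : IsQuadraticForm 𝒜 𝒩 qN)
  (hqP : IsQuadraticForm 𝒜 𝓟 qP) (hP : IsFaithful A P) (hb : IsAlmostDiagonal 𝒩 qN b bar)

include hA h2 hqN hqP hP hb

theorem isDer_splitMap {t : (N →+ N) × (N × P →+ N × P) × (P →+ P)}
    (ht : t ∈ splitSum 𝒜 𝒩 𝓟 qN qP (s12 (A := A) 𝒦 𝓟 qP)) :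
    IsDer 𝒦 𝒜 (prodGr 𝒩 𝓟) (orthSum qN qP) (splitMap 𝓟 qN b bar t) (adA A 𝓟 t.2.2) := by
  obtain ⟨h1, ⟨h3, _⟩, h5⟩ := (mem_splitSum_iff hA h2 hqN hqP hP hb).1 ht
  have h := ((h1.prodMap (IsDer.zero (ℳ := 𝓟) (q := qP))).add h3).add (h5.hat hA h2 hP hqN hb)
  rwa [add_zero, zero_add] at h

/-- The three components are read off from the blocks of the image: `S` from `P → P`, then `x` from
`N → N`, then the off-diagonal rest. This gives injectivity and prescribes the preimage. -/
theorem bijOn_splitMap : Set.BijOn (splitMap 𝓟 qN b bar)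
    (splitSum 𝒜 𝒩 𝓟 qN qP (s12 (A := A) 𝒦 𝓟 qP))
    (s12 (A := A) 𝒦 (prodGr 𝒩 𝓟) (orthSum qN qP)) := by
  have hq := hqN.orthSum hqP
  refine ⟨fun t ht => (isDer_splitMap hA h2 hqN hqP hP hb ht).mem_s12 hq, ?_, ?_⟩
  · rintro ⟨x, y, S⟩ ht ⟨x', y', S'⟩ ht' h
    obtain ⟨h1, ⟨h3, h4⟩, h5⟩ := (mem_splitSum_iff hA h2 hqN hqP hP hb).1 ht
    obtain ⟨h1', ⟨h3', h4'⟩, h5'⟩ := (mem_splitSum_iff hA h2 hqN hqP hP hb).1 ht'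
    have e1 := congrArg blockP h
    simp only [splitMap, blockP_add, blockP_prodMap, blockP_hat, blockP_of_mem_offEnd h4,
      blockP_of_mem_offEnd h4', zero_add] at e1
    subst e1
    have e2 := congrArg blockN h
    simp only [splitMap, blockN_add, blockN_prodMap, blockN_of_mem_offEnd h4,
      blockN_of_mem_offEnd h4', add_zero, add_left_inj] at e2
    subst e2
    simp only [splitMap, add_left_inj, add_right_inj] at h
    rw [h]
  · intro T hT
    obtain ⟨Δ, hT⟩ := (mem_s12_iff hP.prod hq).1 hT
    have hS := hT.blockP
    have hR := hT.sub (hS.hat hA h2 hP hqN hb)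
    -- `T` and the extension of its `P → P` block induce the same `Δ`, so their difference `R`
    -- belongs to `osp(q)`.
    rw [sub_self] at hR
    set R := T - hat 𝓟 qN b bar (blockP T) with hRdef
    have hR1 := hR.sub (hR.blockN.prodMap (IsDer.zero (ℳ := 𝓟) (q := qP)))
    rw [sub_self] at hR1
    refine ⟨(blockN R, R - (blockN R).prodMap 0, blockP T),
      (mem_splitSum_iff hA h2 hqN hqP hP hb).2 ⟨hR.blockN, ⟨hR1, mem_offEnd_of_block ?_ ?_⟩, ?_⟩, ?_⟩
    · simp [blockN_sub]
    · simp [blockP_sub, hRdef, blockP_hat]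
    · rwa [hS.adA_eq hP]
    · simp only [splitMap, add_sub_cancel, hRdef, sub_add_cancel]

theorem splitBr_mem {t t' : (N →+ N) × (N × P →+ N × P) × (P →+ P)}
    (ht : t ∈ splitSum 𝒜 𝒩 𝓟 qN qP (s12 (A := A) 𝒦 𝓟 qP))
    (ht' : t' ∈ splitSum 𝒜 𝒩 𝓟 qN qP (s12 (A := A) 𝒦 𝓟 qP)) :
    splitBr 𝒩 𝓟 qN b bar t t' ∈ splitSum 𝒜 𝒩 𝓟 qN qP (s12 (A := A) 𝒦 𝓟 qP) := by
  obtain ⟨h1, ⟨h3, h4⟩, h5⟩ := (mem_splitSum_iff hA h2 hqN hqP hP hb).1 ht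
  obtain ⟨h1', ⟨h3', h4'⟩, h5'⟩ := (mem_splitSum_iff hA h2 hqN hqP hP hb).1 ht'
  have hD := h5.derExt hA h2 hP hqN hb
  have hD' := h5'.derExt hA h2 hP hqN hb
  have hH := h5.hat hA h2 hP hqN hb
  have hH' := h5'.hat hA h2 hP hqN hb
  have z := IsDer.zero (𝒦 := 𝒦) (𝒜 := 𝒜) (ℳ := 𝓟) (q := qP)
  refine (mem_splitSum_iff hA h2 hqN hqP hP hb).2 ⟨?_, ⟨?_, ?_⟩, ?_⟩
  · have h := (((h1.sbr h1').add (h3.sbr h3').blockN).add (hD.sbr h1')).add (h1.sbr hD')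
    simp only [sbr_zero_left, sbr_zero_right, add_zero] at h
    exact h
  · have h := ((((h1.prodMap z).sbr h3').add (h3.sbr (h1'.prodMap z))).add (hH.sbr h3')).add
      (h3.sbr hH')
    simp only [sbr_zero_left, sbr_zero_right, add_zero] at h
    exact h
  · exact add_mem (add_mem (add_mem (sbr_diag_off (prodMap_mem_diagEnd _ _) h4')
      (sbr_off_diag h4 (prodMap_mem_diagEnd _ _))) (sbr_diag_off (prodMap_mem_diagEnd _ _) h4'))
      (sbr_off_diag h4 (prodMap_mem_diagEnd _ _))
  · have h := (h5.sbr h5').add (h3.sbr h3').blockP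
    change IsDer 𝒦 𝒜 𝓟 qP (sbr 𝓟 t.2.2 t'.2.2 + blockP (sbr (prodGr 𝒩 𝓟) t.2.1 t'.2.1))
      (adA A 𝓟 (sbr 𝓟 t.2.2 t'.2.2 + blockP (sbr (prodGr 𝒩 𝓟) t.2.1 t'.2.1)))
    rwa [h.adA_eq hP]

/-- Expanding the bracket of the images gives nine terms. All but the bracket of the two
off-diagonal elements lie in a single summand. That one preserves both `N` and `P`; its blocks are
distributed by `splitBr` and reassembled by `splitMap`. -/
theorem splitMap_splitBr {t t' : (N →+ N) × (N × P →+ N × P) × (P →+ P)}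
    (ht : t ∈ splitSum 𝒜 𝒩 𝓟 qN qP (s12 (A := A) 𝒦 𝓟 qP))
    (ht' : t' ∈ splitSum 𝒜 𝒩 𝓟 qN qP (s12 (A := A) 𝒦 𝓟 qP)) :
    splitMap 𝓟 qN b bar (splitBr 𝒩 𝓟 qN b bar t t') =
      sbr (prodGr 𝒩 𝓟) (splitMap 𝓟 qN b bar t) (splitMap 𝓟 qN b bar t') := by
  obtain ⟨x, y, S⟩ := t
  obtain ⟨x', y', S'⟩ := t'
  obtain ⟨h1, ⟨h3, h4⟩, h5⟩ := (mem_splitSum_iff hA h2 hqN hqP hP hb).1 ht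
  obtain ⟨h1', ⟨h3', h4'⟩, h5'⟩ := (mem_splitSum_iff hA h2 hqN hqP hP hb).1 ht'
  have h6 := (h3.sbr h3').blockP
  rw [sbr_zero_left] at h6
  dsimp only [splitMap, splitBr] at *
  rw [(h5.sbr h5').hat_add hP h6, h5.hat_sbr hA h2 hP hqN hb h5', h6.hat_of_linear hP]
  simp only [sbr_add_left, sbr_add_right]
  have e1 : sbr (prodGr 𝒩 𝓟) (x.prodMap 0) (x'.prodMap 0) =
      (sbr 𝒩 x x').prodMap (0 : P →+ P) := by rw [sbr_prodMap, sbr_zero_left]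
  have e2 : sbr (prodGr 𝒩 𝓟) (hat 𝓟 qN b bar S) (x'.prodMap 0) =
      (sbr 𝒩 (derExt qN b bar (adA A 𝓟 S)) x').prodMap (0 : P →+ P) := by
    rw [hat, sbr_prodMap, sbr_zero_right]
  have e3 : sbr (prodGr 𝒩 𝓟) (x.prodMap 0) (hat 𝓟 qN b bar S') =
      (sbr 𝒩 x (derExt qN b bar (adA A 𝓟 S'))).prodMap (0 : P →+ P) := by
    rw [hat, sbr_prodMap, sbr_zero_left]
  have e4 := eq_prodMap_of_mem_diagEnd (sbr_off_off (𝒩 := 𝒩) (𝓟 := 𝓟) h4 h4')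
  rw [e1, e2, e3, e4]
  have e5 : ∀ (f₁ f₂ f₃ f₄ : N →+ N) (g : P →+ P), (f₁ + f₂ + f₃ + f₄).prodMap (0 : P →+ P) +
      (0 : N →+ N).prodMap g = f₁.prodMap 0 + f₂.prodMap g + f₃.prodMap 0 + f₄.prodMap 0 := by
    intros
    rw [← prodMap_add, ← prodMap_add, ← prodMap_add, ← prodMap_add]
    simp
  rw [blockN_prodMap, blockP_prodMap]
  have e6 := e5 (sbr 𝒩 x x') (blockN (sbr (prodGr 𝒩 𝓟) y y'))
    (sbr 𝒩 (derExt qN b bar (adA A 𝓟 S)) x') (sbr 𝒩 x (derExt qN b bar (adA A 𝓟 S')))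
    (blockP (sbr (prodGr 𝒩 𝓟) y y'))
  rw [← eq_sub_iff_add_eq] at e6
  rw [e6]
  abel

theorem isLieSuperIso_s12 [IsScalarTower K A A] (hK : IsSupercommutative 𝒦) :
    IsLieSuperIso 𝒦 (splitGr 𝒩 𝓟) (splitSum 𝒜 𝒩 𝓟 qN qP (s12 (A := A) 𝒦 𝓟 qP))
      (splitBr 𝒩 𝓟 qN b bar) (endGr (prodGr 𝒩 𝓟))
      (s12 (A := A) 𝒦 (prodGr 𝒩 𝓟) (orthSum qN qP)) (sbr (prodGr 𝒩 𝓟))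
      (splitMap 𝓟 qN b bar) := by
  have hq := hqN.orthSum hqP
  refine IsLieSuperIso.of_target (isLieSuperalgebra_s12 hK hA hP.prod hq)
    (bijOn_splitMap hA h2 hqN hqP hP hb) (fun k t ht => ?_) (fun t ht => ?_)
    (fun κ α k hk t _ hd => ⟨fun β m hm => ?_, fun β m hm => ?_, fun β m hm => ?_⟩)
    (fun t ht t' ht' => splitBr_mem hA h2 hqN hqP hP hb ht ht')
    (fun α β t ht t' ht' hd hd' => ?_) (fun t ht t' ht' => ?_) (fun k t ht => ?_)
    (fun α t ht hd => ?_) fun t ht t' ht' => splitMap_splitBr hA h2 hqN hqP hP hb ht ht'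
  · obtain ⟨h1, ⟨h3, h4⟩, h5⟩ := (mem_splitSum_iff hA h2 hqN hqP hP hb).1 ht
    have h1' := h1.ksmul hK hA hqN k
    have h3' := h3.ksmul hK hA hq k
    have h5' := h5.ksmul hK hA hqP k
    rw [smul_zero] at h1' h3'
    refine (mem_splitSum_iff hA h2 hqN hqP hP hb).2 ⟨h1', ⟨h3', fun n => ?_, fun p => ?_⟩, ?_⟩
    · simp [h4.1 n]
    · simp [h4.2 p]
    · change IsDer 𝒦 𝒜 𝓟 qP (k • t.2.2) (adA A 𝓟 (k • t.2.2))
      rwa [h5'.adA_eq hP]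
  · obtain ⟨h1, ⟨h3, h4⟩, h5⟩ := (mem_splitSum_iff hA h2 hqN hqP hP hb).1 ht
    have key : ∀ α, (endProj 𝒩 α t.1, endProj (prodGr 𝒩 𝓟) α t.2.1, endProj 𝓟 α t.2.2) ∈
        splitSum 𝒜 𝒩 𝓟 qN qP (s12 (A := A) 𝒦 𝓟 qP) := by
      intro α
      have h1' := (h1 α).isDer
      have h3' := (h3 α).isDer
      have h5' := (h5 α).isDer
      rw [map_zero] at h1' h3'
      refine (mem_splitSum_iff hA h2 hqN hqP hP hb).2
        ⟨h1', ⟨h3', endProj_mem_offEnd h4 α⟩, ?_⟩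
      rwa [h5'.adA_eq hP]
    refine ⟨_, key 0, _, key 1, ⟨endProj_mem _ _ _, endProj_mem _ _ _, endProj_mem _ _ _⟩,
      ⟨endProj_mem _ _ _, endProj_mem _ _ _, endProj_mem _ _ _⟩, ?_⟩
    rw [Prod.mk_add_mk, Prod.mk_add_mk, endProj_zero_add_endProj_one, endProj_zero_add_endProj_one,
      endProj_zero_add_endProj_one]
  · rw [add_assoc]; exact ksmul_mem_gr (𝒜 := 𝒜) hk (hd.1 β m hm)
  · rw [add_assoc]; exact ksmul_mem_gr (𝒜 := 𝒜) hk (hd.2.1 β m hm)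
  · rw [add_assoc]; exact ksmul_mem_gr (𝒜 := 𝒜) hk (hd.2.2 β m hm)
  · obtain ⟨h1, ⟨h3, h4⟩, h5⟩ := (mem_splitSum_iff hA h2 hqN hqP hP hb).1 ht
    obtain ⟨h1', ⟨h3', h4'⟩, h5'⟩ := (mem_splitSum_iff hA h2 hqN hqP hP hb).1 ht'
    obtain ⟨d1, d2, d3⟩ := hd
    obtain ⟨d1', d2', d3'⟩ := hd'
    have e := h5.hat_mem_endGr hA h2 hP hqN hb d3
    have e' := h5'.hat_mem_endGr hA h2 hP hqN hb d3'
    have z : ∀ γ, (0 : P →+ P) ∈ endGr 𝓟 γ := fun γ => zero_mem _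
    refine ⟨add_mem (add_mem (add_mem (sbr_mem_endGr 𝒩 d1 d1')
      (blockN_mem_endGr (sbr_mem_endGr _ d2 d2'))) (sbr_mem_endGr 𝒩 (blockN_mem_endGr e) d1'))
      (sbr_mem_endGr 𝒩 d1 (blockN_mem_endGr e')),
      add_mem (add_mem (add_mem (sbr_mem_endGr _ (prodMap_mem_endGr d1 (z α)) d2')
      (sbr_mem_endGr _ d2 (prodMap_mem_endGr d1' (z β)))) (sbr_mem_endGr _ e d2'))
      (sbr_mem_endGr _ d2 e'),
      add_mem (sbr_mem_endGr 𝓟 d3 d3') (blockP_mem_endGr (sbr_mem_endGr _ d2 d2'))⟩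
  · obtain ⟨_, _, h5⟩ := (mem_splitSum_iff hA h2 hqN hqP hP hb).1 ht
    obtain ⟨_, _, h5'⟩ := (mem_splitSum_iff hA h2 hqN hqP hP hb).1 ht'
    have e : (t.1 + t'.1).prodMap (0 : P →+ P) = t.1.prodMap 0 + t'.1.prodMap 0 := by
      rw [← prodMap_add, add_zero]
    simp only [splitMap, Prod.fst_add, Prod.snd_add, h5.hat_add hP h5', e]
    abel
  · obtain ⟨_, _, h5⟩ := (mem_splitSum_iff hA h2 hqN hqP hP hb).1 ht
    have e : (k • t.1).prodMap (0 : P →+ P) = k • t.1.prodMap 0 := by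
      refine AddMonoidHom.ext fun x => ?_
      simp [prodMap_eval]
    simp only [splitMap, Prod.smul_fst, Prod.smul_snd, h5.hat_ksmul hK hA h2 hqP hP, e, smul_add]
  · obtain ⟨_, _, h5⟩ := (mem_splitSum_iff hA h2 hqN hqP hP hb).1 ht
    exact add_mem (add_mem (prodMap_mem_endGr hd.1 (zero_mem _)) hd.2.1)
      (h5.hat_mem_endGr hA h2 hP hqN hb hd.2.2)

end Split

/-! ### The bracket of `E_∞` -/

section InfBracket

variable {K : Type*} [Ring K] {𝒦 : ZMod 2 → AddSubgroup K} [GradedRing 𝒦]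
  {A : Type*} [Ring A] {𝒜 : ZMod 2 → AddSubgroup A} [GradedRing 𝒜]
  [Module K A] [SetLike.GradedSMul 𝒦 𝒜]
  {M : Type*} [AddCommGroup M] [Module A M] [Module K M] [IsScalarTower K A M]
  {ℳ : ZMod 2 → AddSubgroup M}
  [DirectSum.Decomposition ℳ] [SetLike.GradedSMul 𝒜 ℳ] {q : M →+ M →+ A}

theorem mem_infGr {α : ZMod 2} {v : A × M × M × (M →+ M)} : v ∈ infGr 𝒜 ℳ α ↔
    v.1 ∈ 𝒜 α ∧ v.2.1 ∈ ℳ α ∧ v.2.2.1 ∈ ℳ α ∧ v.2.2.2 ∈ endGr ℳ α := Iff.rfl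

theorem mem_eInf {E : AddSubgroup (M →+ M)} {v : A × M × M × (M →+ M)} :
    v ∈ eInf A E ↔ v.2.2.2 ∈ E :=
  ⟨fun h => h.2.2.2, fun h => ⟨trivial, trivial, trivial, h⟩⟩

theorem infBr_mk (q : M →+ M →+ A) (a a' : A) (m n m' n' : M) (x x' : M →+ M) :
    infBr 𝒜 ℳ q (a, m, n, x) (a', m', n', x') = (q m n' - q n m',
      a • m' + x m' - rmul 𝒜 ℳ m a' - sapp ℳ x' m,
      -(a • n') + x n' + rmul 𝒜 ℳ n a' - sapp ℳ x' n,
      eMap 𝒜 ℳ q m n' + eMap 𝒜 ℳ q n m' + sbr ℳ x x') := rfl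

theorem infBr_of_mem (q : M →+ M →+ A) {β γ : ZMod 2} {a a' : A} {m n m' n' : M}
    {x x' : M →+ M} (hm : m ∈ ℳ β) (hn : n ∈ ℳ β) (ha' : a' ∈ 𝒜 γ) (hx' : x' ∈ endGr ℳ γ) :
    infBr 𝒜 ℳ q (a, m, n, x) (a', m', n', x') = (q m n' - q n m',
      a • m' + x m' - sgn γ β • a' • m - sgn γ β • x' m,
      -(a • n') + x n' + sgn γ β • a' • n - sgn γ β • x' n,
      eMap 𝒜 ℳ q m n' + eMap 𝒜 ℳ q n m' + sbr ℳ x x') := by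
  rw [infBr_mk, rmul_of_mem 𝒜 ℳ ha' hm, rmul_of_mem 𝒜 ℳ ha' hn, sapp_of_mem ℳ hx' hm,
    sapp_of_mem ℳ hx' hn]

theorem infBr_add_left (q : M →+ M →+ A) (s s' t : A × M × M × (M →+ M)) :
    infBr 𝒜 ℳ q (s + s') t = infBr 𝒜 ℳ q s t + infBr 𝒜 ℳ q s' t := by
  obtain ⟨a, m, n, x⟩ := s
  obtain ⟨a', m', n', x'⟩ := s'
  obtain ⟨b, p, r, y⟩ := t
  simp only [Prod.mk_add_mk, infBr_mk, map_add, AddMonoidHom.add_apply, add_smul, rmul_add,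
    sapp_add_right, eMap_add_left, sbr_add_left]
  refine Prod.ext ?_ (Prod.ext ?_ (Prod.ext ?_ ?_)) <;> dsimp only <;> abel

theorem infBr_add_right (q : M →+ M →+ A) (s t t' : A × M × M × (M →+ M)) :
    infBr 𝒜 ℳ q s (t + t') = infBr 𝒜 ℳ q s t + infBr 𝒜 ℳ q s t' := by
  obtain ⟨a, m, n, x⟩ := t
  obtain ⟨a', m', n', x'⟩ := t'
  obtain ⟨b, p, r, y⟩ := s
  simp only [Prod.mk_add_mk, infBr_mk, map_add, smul_add,
    sapp_add_left, eMap_add_right, sbr_add_right]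
  refine Prod.ext ?_ (Prod.ext ?_ (Prod.ext ?_ ?_)) <;> dsimp only <;> abel

variable (𝒜 ℳ q) in
/-- The bracket as a biadditive map. -/
noncomputable def infBrHom : (A × M × M × (M →+ M)) →+ (A × M × M × (M →+ M)) →+
    (A × M × M × (M →+ M)) :=
  AddMonoidHom.mk' (fun s => AddMonoidHom.mk' (infBr 𝒜 ℳ q s) (infBr_add_right q s))
    fun s t => AddMonoidHom.ext fun u => infBr_add_left q s t u

theorem infBrHom_apply (s t : A × M × M × (M →+ M)) :
    infBrHom 𝒜 ℳ q s t = infBr 𝒜 ℳ q s t := rfl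

theorem infBr_zsmul_right (s t : A × M × M × (M →+ M)) (k : ℤ) :
    infBr 𝒜 ℳ q s (k • t) = k • infBr 𝒜 ℳ q s t := map_zsmul (infBrHom 𝒜 ℳ q s) k t

theorem infBr_neg_right (s t : A × M × M × (M →+ M)) :
    infBr 𝒜 ℳ q s (-t) = -infBr 𝒜 ℳ q s t := map_neg (infBrHom 𝒜 ℳ q s) t

variable (𝒜 ℳ) in
/-- The component of degree `α` of an element of `E_∞`. -/
noncomputable def infProj (α : ZMod 2) (v : A × M × M × (M →+ M)) : A × M × M × (M →+ M) :=
  (proj 𝒜 α v.1, proj ℳ α v.2.1, proj ℳ α v.2.2.1, endProj ℳ α v.2.2.2)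

theorem infProj_mem (α : ZMod 2) (v : A × M × M × (M →+ M)) :
    infProj 𝒜 ℳ α v ∈ infGr 𝒜 ℳ α :=
  ⟨proj_mem _ _ _, proj_mem _ _ _, proj_mem _ _ _, endProj_mem _ _ _⟩

theorem infProj_zero_add_infProj_one (v : A × M × M × (M →+ M)) :
    infProj 𝒜 ℳ 0 v + infProj 𝒜 ℳ 1 v = v := by
  refine Prod.ext ?_ (Prod.ext ?_ (Prod.ext ?_ ?_))
  exacts [proj_zero_add_proj_one _ _, proj_zero_add_proj_one _ _, proj_zero_add_proj_one _ _,
    endProj_zero_add_endProj_one _ _]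

theorem IsStandard.infProj_mem {E : AddSubgroup (M →+ M)}
    (hq : IsQuadraticForm 𝒜 ℳ q) (hE : IsStandard 𝒜 ℳ q E) {v : A × M × M × (M →+ M)}
    (hv : v ∈ eInf A E) (α : ZMod 2) : infProj 𝒜 ℳ α v ∈ eInf A E :=
  mem_eInf.2 (hE.endProj_mem hq (mem_eInf.1 hv) α)

@[elab_as_elim]
theorem IsStandard.inf_induction {E : AddSubgroup (M →+ M)}
    (hq : IsQuadraticForm 𝒜 ℳ q) (hE : IsStandard 𝒜 ℳ q E) {p : A × M × M × (M →+ M) → Prop}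
    {v : A × M × M × (M →+ M)} (hv : v ∈ eInf A E) (hadd : ∀ u v, p u → p v → p (u + v))
    (hom : ∀ α, ∀ v ∈ infGr 𝒜 ℳ α, v ∈ eInf A E → p v) : p v := by
  rw [← infProj_zero_add_infProj_one (𝒜 := 𝒜) (ℳ := ℳ) v]
  exact hadd _ _ (hom 0 _ (OspDer.infProj_mem 0 v) (hE.infProj_mem hq hv 0))
    (hom 1 _ (OspDer.infProj_mem 1 v) (hE.infProj_mem hq hv 1))

theorem IsQuadraticForm.infBr_mem_infGr (hq : IsQuadraticForm 𝒜 ℳ q) {β γ : ZMod 2}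
    {s t : A × M × M × (M →+ M)} (hs : s ∈ infGr 𝒜 ℳ β) (ht : t ∈ infGr 𝒜 ℳ γ) :
    infBr 𝒜 ℳ q s t ∈ infGr 𝒜 ℳ (β + γ) := by
  obtain ⟨a, m, n, x⟩ := s
  obtain ⟨a', m', n', x'⟩ := t
  obtain ⟨h1, h2, h3, h4⟩ := mem_infGr.1 hs
  obtain ⟨h1', h2', h3', h4'⟩ := mem_infGr.1 ht
  dsimp only at *
  rw [infBr_of_mem q h2 h3 h1' h4']
  have c := add_comm β γ
  refine mem_infGr.2 ⟨sub_mem (hq.degree _ _ _ h2 _ h3') (hq.degree _ _ _ h3 _ h2'),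
    sub_mem (sub_mem (add_mem (smul_mem_gr 𝒜 ℳ h1 h2') (h4 _ _ h2'))
      (zsmul_mem (c ▸ smul_mem_gr 𝒜 ℳ h1' h2) _)) (zsmul_mem (c ▸ h4' _ _ h2) _),
    sub_mem (add_mem (add_mem (neg_mem (smul_mem_gr 𝒜 ℳ h1 h3')) (h4 _ _ h3'))
      (zsmul_mem (c ▸ smul_mem_gr 𝒜 ℳ h1' h3) _)) (zsmul_mem (c ▸ h4' _ _ h3) _),
    add_mem (add_mem (hq.eMap_mem_endGr h2 h3') (hq.eMap_mem_endGr h3 h2'))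
      (sbr_mem_endGr ℳ h4 h4')⟩

theorem IsStandard.infBr_mem {E : AddSubgroup (M →+ M)} (hA : IsSupercommutative 𝒜)
    (hq : IsQuadraticForm 𝒜 ℳ q) (hE : IsStandard 𝒜 ℳ q E) {s t : A × M × M × (M →+ M)}
    (hs : s ∈ eInf A E) (ht : t ∈ eInf A E) : infBr 𝒜 ℳ q s t ∈ eInf A E :=
  mem_eInf.2 (add_mem (add_mem (hE.eosp_le hA hq (eMap_mem_eosp _ _))
    (hE.eosp_le hA hq (eMap_mem_eosp _ _)))
    (hE.sbr_mem hq (hE.isDer (𝒦 := 𝒜) hA hq (mem_eInf.1 hs)) (mem_eInf.1 ht)))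

theorem IsQuadraticForm.infBr_skew (hq : IsQuadraticForm 𝒜 ℳ q) {β γ : ZMod 2}
    {s t : A × M × M × (M →+ M)} (hs : s ∈ infGr 𝒜 ℳ β) (ht : t ∈ infGr 𝒜 ℳ γ) :
    infBr 𝒜 ℳ q s t = -(sgn β γ • infBr 𝒜 ℳ q t s) := by
  obtain ⟨a, m, n, x⟩ := s
  obtain ⟨a', m', n', x'⟩ := t
  obtain ⟨h1, h2, h3, h4⟩ := mem_infGr.1 hs
  obtain ⟨h1', h2', h3', h4'⟩ := mem_infGr.1 ht
  dsimp only at *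
  rw [infBr_of_mem q h2 h3 h1' h4', infBr_of_mem q h2' h3' h1 h4]
  refine Prod.ext ?_ (Prod.ext ?_ (Prod.ext ?_ ?_))
  · change _ = -(sgn β γ • (q m' n - q n' m))
    dsimp only
    rw [hq.supersymm _ _ _ h2' _ h3, hq.supersymm _ _ _ h3' _ h2, smul_sub, sgn_comm γ β,
      sgn_smul_sgn_smul, sgn_smul_sgn_smul]
    abel
  · change _ = -(sgn β γ • (a' • m + x' m - sgn β γ • a • m' - sgn β γ • x m'))
    dsimp only
    rw [smul_sub, smul_sub, smul_add, sgn_smul_sgn_smul, sgn_smul_sgn_smul, sgn_comm γ β]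
    abel
  · change _ = -(sgn β γ • (-(a' • n) + x' n + sgn β γ • a • n' - sgn β γ • x n'))
    dsimp only
    rw [smul_sub, smul_add, smul_add, smul_neg, sgn_smul_sgn_smul, sgn_smul_sgn_smul,
      sgn_comm γ β]
    abel
  · change _ = -(sgn β γ • (eMap 𝒜 ℳ q m' n + eMap 𝒜 ℳ q n' m + sbr ℳ x' x))
    dsimp only
    rw [sbr_skew ℳ h4 h4', hq.eMap_skew h2 h3', hq.eMap_skew h3 h2', smul_add, smul_add]
    abel

/-! ### The maps `d_S` and the Leibniz rule -/

/-- The map `d_S` of `A × M × M × End M`. -/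
noncomputable def dsMap (ℳ : ZMod 2 → AddSubgroup M) [DirectSum.Decomposition ℳ] (S : M →+ M)
    (Δ : A →+ A) : (A × M × M × (M →+ M)) →+ (A × M × M × (M →+ M)) :=
  Δ.prodMap (S.prodMap (S.prodMap (sbrHom ℳ S)))

theorem dsMap_apply (S : M →+ M) (Δ : A →+ A) (v : A × M × M × (M →+ M)) :
    dsMap ℳ S Δ v = (Δ v.1, S v.2.1, S v.2.2.1, sbr ℳ S v.2.2.2) := rfl

theorem IsSim.dsMap_mem {σ β : ZMod 2} {S : M →+ M} {Δ : A →+ A} (hS : IsSim 𝒦 𝒜 ℳ q σ S Δ)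
    {t : A × M × M × (M →+ M)} (ht : t ∈ infGr 𝒜 ℳ β) : dsMap ℳ S Δ t ∈ infGr 𝒜 ℳ (σ + β) :=
  ⟨hS.degA _ _ ht.1, hS.degree _ _ ht.2.1, hS.degree _ _ ht.2.2.1,
    sbr_mem_endGr ℳ hS.degree ht.2.2.2⟩

/-- Every ingredient of the bracket of `E_∞` (form, scalar action, application of endomorphisms,
`E_{m,n}`, superbracket) satisfies a Leibniz rule under the pair `(S, Δ)`. -/
theorem dsMap_infBr (hq : IsQuadraticForm 𝒜 ℳ q) {σ β γ : ZMod 2} {S : M →+ M}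
    {Δ : A →+ A} (hS : IsSim 𝒦 𝒜 ℳ q σ S Δ) {t u : A × M × M × (M →+ M)}
    (ht : t ∈ infGr 𝒜 ℳ β) (hu : u ∈ infGr 𝒜 ℳ γ) :
    dsMap ℳ S Δ (infBr 𝒜 ℳ q t u) =
      infBr 𝒜 ℳ q (dsMap ℳ S Δ t) u + sgn σ β • infBr 𝒜 ℳ q t (dsMap ℳ S Δ u) := by
  obtain ⟨a, m, n, x⟩ := t
  obtain ⟨a', m', n', x'⟩ := u
  obtain ⟨h1, h2, h3, h4⟩ := mem_infGr.1 ht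
  obtain ⟨h1', h2', h3', h4'⟩ := mem_infGr.1 hu
  have hSt := hS.dsMap_mem ht
  have hSu := hS.dsMap_mem hu
  rw [dsMap_apply] at hSt hSu
  obtain ⟨k1, k2, k3, k4⟩ := mem_infGr.1 hSt
  obtain ⟨k1', k2', k3', k4'⟩ := mem_infGr.1 hSu
  rw [dsMap_apply, dsMap_apply, dsMap_apply]
  dsimp only at *
  rw [infBr_of_mem q h2 h3 h1' h4', infBr_of_mem q h2 h3 k1' k4', infBr_of_mem q k2 k3 h1' h4']
  refine Prod.ext ?_ (Prod.ext ?_ (Prod.ext ?_ ?_))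
  · change Δ (q m n' - q n m') = q (S m) n' - q (S n) m' + sgn σ β • (q m (S n') - q n (S m'))
    rw [map_sub, hS.form _ _ h2, hS.form _ _ h3, smul_sub]
    abel
  · change S (a • m' + x m' - sgn γ β • a' • m - sgn γ β • x' m) =
      Δ a • m' + sbr ℳ S x m' - sgn γ (σ + β) • a' • S m - sgn γ (σ + β) • x' (S m) +
        sgn σ β • (a • S m' + x (S m') - sgn (σ + γ) β • Δ a' • m - sgn (σ + γ) β • sbr ℳ S x' m)
    simp only [map_add, map_sub, map_zsmul, hS.smul _ _ h1, hS.smul _ _ h1',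
      sbr_of_mem ℳ hS.degree h4, sbr_of_mem ℳ hS.degree h4', AddMonoidHom.sub_apply,
      AddMonoidHom.smul_apply, AddMonoidHom.comp_apply]
    rcases zmod2_cases σ with rfl | rfl <;> rcases zmod2_cases β with rfl | rfl <;>
      rcases zmod2_cases γ with rfl | rfl <;>
      simp [one_add_one_zmod2, smul_sub, smul_add] <;> abel
  · change S (-(a • n') + x n' + sgn γ β • a' • n - sgn γ β • x' n) =
      -(Δ a • n') + sbr ℳ S x n' + sgn γ (σ + β) • a' • S n - sgn γ (σ + β) • x' (S n) +
        sgn σ β • (-(a • S n') + x (S n') + sgn (σ + γ) β • Δ a' • n -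
          sgn (σ + γ) β • sbr ℳ S x' n)
    simp only [map_add, map_sub, map_neg, map_zsmul, hS.smul _ _ h1, hS.smul _ _ h1',
      sbr_of_mem ℳ hS.degree h4, sbr_of_mem ℳ hS.degree h4', AddMonoidHom.sub_apply,
      AddMonoidHom.smul_apply, AddMonoidHom.comp_apply]
    rcases zmod2_cases σ with rfl | rfl <;> rcases zmod2_cases β with rfl | rfl <;>
      rcases zmod2_cases γ with rfl | rfl <;>
      simp [one_add_one_zmod2, smul_sub, smul_add] <;> abel
  · change sbr ℳ S (eMap 𝒜 ℳ q m n' + eMap 𝒜 ℳ q n m' + sbr ℳ x x') =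
      eMap 𝒜 ℳ q (S m) n' + eMap 𝒜 ℳ q (S n) m' + sbr ℳ (sbr ℳ S x) x' +
      sgn σ β • (eMap 𝒜 ℳ q m (S n') + eMap 𝒜 ℳ q n (S m') + sbr ℳ x (sbr ℳ S x'))
    rw [sbr_add_right, sbr_add_right, hS.sbr_eMap hq h2, hS.sbr_eMap hq h3,
      sbr_leibniz ℳ hS.degree h4, smul_add, smul_add]
    abel

/-- The inner derivation of an endomorphism is `d_x` with `Δ = 0`. This yields one case of the
Jacobi identity, and later the innerness of `d_R`. -/
theorem infBr_zero_zero_zero_left (q : M →+ M →+ A) (x : M →+ M) (v : A × M × M × (M →+ M)) :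
    infBr 𝒜 ℳ q (0, 0, 0, x) v = dsMap ℳ x 0 v := by
  obtain ⟨a', m', n', x'⟩ := v
  simp [infBr_mk, dsMap_apply]

/-- The automorphism `(a, m, n, x) ↦ (-a, n, m, x)` of `E_∞`. -/
def infSwap (v : A × M × M × (M →+ M)) : A × M × M × (M →+ M) := (-v.1, v.2.2.1, v.2.1, v.2.2.2)

theorem infSwap_infSwap (v : A × M × M × (M →+ M)) : infSwap (infSwap v) = v := by
  simp [infSwap]

theorem infSwap_add (u v : A × M × M × (M →+ M)) :
    infSwap (u + v) = infSwap u + infSwap v := by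
  simp [infSwap, add_comm]

theorem infSwap_zsmul (k : ℤ) (v : A × M × M × (M →+ M)) :
    infSwap (k • v) = k • infSwap v := by
  simp [infSwap]

theorem infSwap_mem_infGr {α : ZMod 2} {v : A × M × M × (M →+ M)} (hv : v ∈ infGr 𝒜 ℳ α) :
    infSwap v ∈ infGr 𝒜 ℳ α :=
  mem_infGr.2 ⟨neg_mem hv.1, hv.2.2.1, hv.2.1, hv.2.2.2⟩

theorem infSwap_infBr (q : M →+ M →+ A) (u v : A × M × M × (M →+ M)) :
    infSwap (infBr 𝒜 ℳ q u v) = infBr 𝒜 ℳ q (infSwap u) (infSwap v) := by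
  obtain ⟨a, m, n, x⟩ := u
  obtain ⟨a', m', n', x'⟩ := v
  simp only [infSwap, infBr_mk, neg_neg, neg_sub, neg_smul, map_neg, sub_neg_eq_add]
  refine Prod.ext rfl (Prod.ext rfl (Prod.ext ?_ ?_))
  · dsimp only
    abel
  · dsimp only
    abel

theorem IsSim.map_smul {σ κ : ZMod 2} {x : M →+ M} (hx : IsSim 𝒦 𝒜 ℳ q σ x 0) {a : A}
    (ha : a ∈ 𝒜 κ) (m : M) : x (a • m) = sgn σ κ • a • x m := by
  simpa using hx.smul κ a ha m

theorem IsSim.form_skew {σ β : ZMod 2} {x : M →+ M} (hx : IsSim 𝒦 𝒜 ℳ q σ x 0) {m : M}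
    (hm : m ∈ ℳ β) (n : M) : q m (x n) = -(sgn σ β • q (x m) n) := by
  have h := congrArg (fun z => sgn σ β • z) (hx.form β m hm n)
  simp only [AddMonoidHom.zero_apply, smul_zero, smul_add, sgn_smul_sgn_smul] at h
  exact eq_neg_of_add_eq_zero_right h.symm

theorem infBr_leibniz_scalar (hA : IsSupercommutative 𝒜) (hq : IsQuadraticForm 𝒜 ℳ q)
    {α β γ : ZMod 2} {a : A} (ha : a ∈ 𝒜 α) {t u : A × M × M × (M →+ M)}
    (ht : t ∈ infGr 𝒜 ℳ β) (hu : u ∈ infGr 𝒜 ℳ γ) (hx : IsSim 𝒦 𝒜 ℳ q β t.2.2.2 0)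
    (hy : IsSim 𝒦 𝒜 ℳ q γ u.2.2.2 0) :
    infBr 𝒜 ℳ q (a, 0, 0, 0) (infBr 𝒜 ℳ q t u) = infBr 𝒜 ℳ q (infBr 𝒜 ℳ q (a, 0, 0, 0) t) u +
      sgn α β • infBr 𝒜 ℳ q t (infBr 𝒜 ℳ q (a, 0, 0, 0) u) := by
  obtain ⟨b, m, n, x⟩ := t
  obtain ⟨c, p, r, y⟩ := u
  obtain ⟨h1, h2, h3, h4⟩ := mem_infGr.1 ht
  obtain ⟨k1, k2, k3, k4⟩ := mem_infGr.1 hu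
  dsimp only at *
  have e : ∀ (c : A) (p r : M) (y : M →+ M),
      infBr 𝒜 ℳ q (a, 0, 0, 0) (c, p, r, y) = (0, a • p, -(a • r), 0) := by
    intro c p r y
    simp [infBr_mk, sbr_zero_left]
  rw [infBr_of_mem q h2 h3 k1 k4, e, e, e, infBr_of_mem q (smul_mem_gr 𝒜 ℳ ha h2)
    (neg_mem (smul_mem_gr 𝒜 ℳ ha h3)) k1 k4, infBr_of_mem (𝒜 := 𝒜) (γ := 0) q h2 h3
    (zero_mem _) (zero_mem _)]
  refine Prod.ext ?_ (Prod.ext ?_ (Prod.ext ?_ ?_))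
  · change 0 = q (a • m) r - q (-(a • n)) p + sgn α β • (q m (-(a • r)) - q n (a • p))
    simp only [map_neg, AddMonoidHom.neg_apply, hq.smul_left hA, hq.smul_right hA ha h2,
      hq.smul_right hA ha h3, smul_sub, smul_neg, sgn_smul_sgn_smul]
    abel
  · change a • (b • p + x p - sgn γ β • c • m - sgn γ β • y m) =
      (0 : A) • p + (0 : M →+ M) p - sgn γ (α + β) • c • a • m - sgn γ (α + β) • y (a • m) +
        sgn α β • (b • a • p + x (a • p) - sgn 0 β • (0 : A) • m - sgn 0 β • (0 : M →+ M) m)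
    rw [hx.map_smul ha, hy.map_smul ha, smul_smul c a, hA.comm k1 ha, smul_smul b a,
      hA.comm h1 ha]
    rcases zmod2_cases α with rfl | rfl <;> rcases zmod2_cases β with rfl | rfl <;>
      rcases zmod2_cases γ with rfl | rfl <;>
      simp [one_add_one_zmod2, smul_sub, smul_add, mul_smul] <;> abel
  · change -(a • (-(b • r) + x r + sgn γ β • c • n - sgn γ β • y n)) =
      -((0 : A) • r) + (0 : M →+ M) r + sgn γ (α + β) • c • -(a • n) -
          sgn γ (α + β) • y (-(a • n)) +
        sgn α β • (-(b • -(a • r)) + x (-(a • r)) + sgn 0 β • (0 : A) • n -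
          sgn 0 β • (0 : M →+ M) n)
    simp only [map_neg, smul_neg]
    rw [hx.map_smul ha, hy.map_smul ha, smul_smul c a,
      hA.comm k1 ha, smul_smul b a, hA.comm h1 ha]
    rcases zmod2_cases α with rfl | rfl <;> rcases zmod2_cases β with rfl | rfl <;>
      rcases zmod2_cases γ with rfl | rfl <;>
      simp [one_add_one_zmod2, smul_sub, smul_add, mul_smul] <;> abel
  · change 0 = eMap 𝒜 ℳ q (a • m) r + eMap 𝒜 ℳ q (-(a • n)) p + sbr ℳ 0 y +
      sgn α β • (eMap 𝒜 ℳ q m (-(a • r)) + eMap 𝒜 ℳ q n (a • p) + sbr ℳ x 0)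
    rw [sbr_zero_left, sbr_zero_right, eMap_neg_left, eMap_neg_right, hq.eMap_smul_left hA,
      hq.eMap_smul_left hA, hq.eMap_smul_right hA ha h2, hq.eMap_smul_right hA ha h3, smul_add,
      smul_add, smul_neg, sgn_smul_sgn_smul, sgn_smul_sgn_smul]
    abel_nf

/-- The essential case of the Jacobi identity. In the components in `M` the terms coming from the
maps `E` must cancel against the scalar terms; this uses the shape of `E_{m,n}` and the
supersymmetry of `q`. -/
theorem infBr_leibniz_vector (hA : IsSupercommutative 𝒜) (hq : IsQuadraticForm 𝒜 ℳ q)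
    {α β γ : ZMod 2} {w : M} (hw : w ∈ ℳ α) {t u : A × M × M × (M →+ M)}
    (ht : t ∈ infGr 𝒜 ℳ β) (hu : u ∈ infGr 𝒜 ℳ γ) (hx : IsSim 𝒦 𝒜 ℳ q β t.2.2.2 0)
    (hy : IsSim 𝒦 𝒜 ℳ q γ u.2.2.2 0) :
    infBr 𝒜 ℳ q (0, w, 0, 0) (infBr 𝒜 ℳ q t u) = infBr 𝒜 ℳ q (infBr 𝒜 ℳ q (0, w, 0, 0) t) u +
      sgn α β • infBr 𝒜 ℳ q t (infBr 𝒜 ℳ q (0, w, 0, 0) u) := by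
  have hw' : (0, w, 0, 0) ∈ infGr 𝒜 ℳ α := mem_infGr.2 ⟨zero_mem _, hw, zero_mem _, zero_mem _⟩
  have e : ∀ (δ : ZMod 2) (v : A × M × M × (M →+ M)), v ∈ infGr 𝒜 ℳ δ →
      infBr 𝒜 ℳ q (0, w, 0, 0) v = (q w v.2.2.1, -(sgn δ α • v.1 • w) - sgn δ α • v.2.2.2 w, 0,
        eMap 𝒜 ℳ q w v.2.2.1) := by
    intro δ v hv
    obtain ⟨c, p, r, y⟩ := v
    obtain ⟨k1, k2, k3, k4⟩ := mem_infGr.1 hv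
    dsimp only at *
    rw [infBr_of_mem q hw (zero_mem (ℳ α)) k1 k4]
    simp [sbr_zero_left]
  have hwt := hq.infBr_mem_infGr hw' ht
  have hwu := hq.infBr_mem_infGr hw' hu
  rw [e _ _ (hq.infBr_mem_infGr ht hu), e _ _ ht, e _ _ hu]
  rw [e _ _ ht] at hwt
  rw [e _ _ hu] at hwu
  obtain ⟨b, m, n, x⟩ := t
  obtain ⟨c, p, r, y⟩ := u
  obtain ⟨h1, h2, h3, h4⟩ := mem_infGr.1 ht
  obtain ⟨k1, k2, k3, k4⟩ := mem_infGr.1 hu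
  dsimp only at *
  obtain ⟨h1', h2', h3', h4'⟩ := mem_infGr.1 hwt
  obtain ⟨k1', k2', k3', k4'⟩ := mem_infGr.1 hwu
  dsimp only at *
  rw [infBr_of_mem q h2 h3 k1 k4, infBr_of_mem q h2' h3' k1 k4, infBr_of_mem q h2 h3 k1' k4']
  refine Prod.ext ?_ (Prod.ext ?_ (Prod.ext ?_ ?_))
  · change q w (-(b • r) + x r + sgn γ β • c • n - sgn γ β • y n) =
      q (-(sgn β α • b • w) - sgn β α • x w) r - q 0 p +
        sgn α β • (q m 0 - q n (-(sgn γ α • c • w) - sgn γ α • y w))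
    simp only [map_add, map_sub, map_neg, map_zsmul, AddMonoidHom.sub_apply,
      AddMonoidHom.neg_apply, AddMonoidHom.smul_apply, hq.smul_left hA, hq.smul_right hA h1 hw,
      hq.smul_right hA k1 hw, hq.smul_right hA k1 h3, hx.form_skew hw, hy.form_skew hw,
      hq.supersymm _ _ _ h3 _ (hy.degree _ _ hw), hq.supersymm _ _ _ h3 _ hw]
    rcases zmod2_cases α with rfl | rfl <;> rcases zmod2_cases β with rfl | rfl <;>
      rcases zmod2_cases γ with rfl | rfl <;>
      simp [one_add_one_zmod2] <;> abel
  · change -(sgn (β + γ) α • (q m r - q n p) • w) -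
        sgn (β + γ) α • (eMap 𝒜 ℳ q m r + eMap 𝒜 ℳ q n p + sbr ℳ x y) w =
      q w n • p + eMap 𝒜 ℳ q w n p -
          sgn γ (α + β) • c • (-(sgn β α • b • w) - sgn β α • x w) -
          sgn γ (α + β) • y (-(sgn β α • b • w) - sgn β α • x w) +
        sgn α β • (b • (-(sgn γ α • c • w) - sgn γ α • y w) + x (-(sgn γ α • c • w) - sgn γ α • y w)
          - sgn (α + γ) β • q w r • m - sgn (α + γ) β • eMap 𝒜 ℳ q w r m)
    simp only [AddMonoidHom.add_apply, AddMonoidHom.sub_apply, AddMonoidHom.smul_apply,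
      AddMonoidHom.comp_apply, hq.eMap_apply h2 k3 hw, hq.eMap_apply h3 k2 hw,
      hq.eMap_apply hw h3 k2, hq.eMap_apply hw k3 h2, sbr_of_mem ℳ h4 k4, map_sub, map_neg,
      map_zsmul, hx.map_smul k1, hy.map_smul h1, smul_sub, smul_neg, smul_comm c (sgn _ _ : ℤ),
      smul_comm b (sgn _ _ : ℤ), smul_smul c b, hA.comm k1 h1, sub_smul,
      hq.supersymm _ _ _ h2 _ hw, hq.supersymm _ _ _ h3 _ hw, hq.supersymm _ _ _ k2 _ hw,
      hq.supersymm _ _ _ k3 _ hw, hq.supersymm _ _ _ k3 _ h2]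
    rcases zmod2_cases α with rfl | rfl <;> rcases zmod2_cases β with rfl | rfl <;>
      rcases zmod2_cases γ with rfl | rfl <;>
      simp [one_add_one_zmod2, mul_smul] <;> abel
  · change (0 : M) = -(q w n • r) + eMap 𝒜 ℳ q w n r + sgn γ (α + β) • c • (0 : M) -
        sgn γ (α + β) • y 0 +
      sgn α β • (-(b • (0 : M)) + x 0 + sgn (α + γ) β • q w r • n -
        sgn (α + γ) β • eMap 𝒜 ℳ q w r n)
    rw [hq.eMap_apply hw h3 k3, hq.eMap_apply hw k3 h3, hq.supersymm _ _ _ k3 _ h3]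
    rcases zmod2_cases α with rfl | rfl <;> rcases zmod2_cases β with rfl | rfl <;>
      rcases zmod2_cases γ with rfl | rfl <;>
      simp [one_add_one_zmod2] <;> abel
  · change eMap 𝒜 ℳ q w (-(b • r) + x r + sgn γ β • c • n - sgn γ β • y n) =
      eMap 𝒜 ℳ q (-(sgn β α • b • w) - sgn β α • x w) r + eMap 𝒜 ℳ q 0 p +
        sbr ℳ (eMap 𝒜 ℳ q w n) y + sgn α β • (eMap 𝒜 ℳ q m 0 +
        eMap 𝒜 ℳ q n (-(sgn γ α • c • w) - sgn γ α • y w) + sbr ℳ x (eMap 𝒜 ℳ q w r))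
    rw [sbr_skew ℳ (hq.eMap_mem_endGr hw h3) k4, hy.sbr_eMap hq hw, hx.sbr_eMap hq hw]
    simp only [eMap_add_right, eMap_sub_right, eMap_sub_left, eMap_neg_left, eMap_neg_right,
      eMap_zsmul_left, eMap_zsmul_right, eMap_zero_left, eMap_zero_right, hq.eMap_smul_left hA,
      hq.eMap_smul_right hA h1 hw, hq.eMap_smul_right hA k1 hw, hq.eMap_smul_right hA k1 h3,
      hq.eMap_skew h3 hw, hq.eMap_skew h3 (hy.degree _ _ hw)]
    rcases zmod2_cases α with rfl | rfl <;> rcases zmod2_cases β with rfl | rfl <;>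
      rcases zmod2_cases γ with rfl | rfl <;>
      simp [one_add_one_zmod2] <;> abel

/-- By additivity the first argument may be one of four types: a scalar, a vector in either copy of
`M`, or an endomorphism. The two vector cases are exchanged by `infSwap`, and the last is the
Leibniz rule for `d_x`. -/
theorem IsStandard.infBr_leibniz {E : AddSubgroup (M →+ M)} (hA : IsSupercommutative 𝒜)
    (hq : IsQuadraticForm 𝒜 ℳ q) (hE : IsStandard 𝒜 ℳ q E) {α β : ZMod 2}
    {s t u : A × M × M × (M →+ M)} (hs : s ∈ infGr 𝒜 ℳ α) (hsE : s ∈ eInf A E)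
    (ht : t ∈ infGr 𝒜 ℳ β) (htE : t ∈ eInf A E) (huE : u ∈ eInf A E) :
    infBr 𝒜 ℳ q s (infBr 𝒜 ℳ q t u) = infBr 𝒜 ℳ q (infBr 𝒜 ℳ q s t) u +
      sgn α β • infBr 𝒜 ℳ q t (infBr 𝒜 ℳ q s u) := by
  refine hE.inf_induction hq huE (fun u u' h h' => ?_) fun γ u hu huE => ?_
  · simp only [infBr_add_right, h, h', smul_add]; abel
  have sim : ∀ {δ : ZMod 2} {v : A × M × M × (M →+ M)}, v ∈ infGr 𝒜 ℳ δ → v ∈ eInf A E →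
      IsSim 𝒜 𝒜 ℳ q δ v.2.2.2 0 := fun hv hvE =>
    (hE.isDer hA hq (mem_eInf.1 hvE)).isSim hv.2.2.2 (zero_mem _)
  have hx := sim ht htE
  have hy := sim hu huE
  have hz := sim hs hsE
  obtain ⟨a, m, n, x⟩ := s
  obtain ⟨h1, h2, h3, h4⟩ := mem_infGr.1 hs
  dsimp only at *
  have e1 := infBr_leibniz_scalar hA hq h1 ht hu hx hy
  have e2 := infBr_leibniz_vector hA hq h2 ht hu hx hy
  have e3 := congrArg infSwap (infBr_leibniz_vector hA hq h3 (infSwap_mem_infGr ht)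
    (infSwap_mem_infGr hu) hx hy)
  have e4 := dsMap_infBr hq hz ht hu
  simp only [infSwap_infBr, infSwap_add, infSwap_zsmul, infSwap_infSwap] at e3
  simp only [← infBr_zero_zero_zero_left (𝒜 := 𝒜) q] at e4
  have e5 : (a, m, n, x) = (a, 0, 0, 0) + (0, m, 0, 0) + infSwap (0, n, 0, 0) + (0, 0, 0, x) := by
    simp [infSwap]
  rw [e5]
  simp only [infBr_add_left, infBr_add_right, e1, e2, e3, e4, smul_add]
  abel

end InfBracket

/-! ### The Lie superalgebra `E_∞` -/

section InfLie

variable {K : Type*} [Ring K] {𝒦 : ZMod 2 → AddSubgroup K} [GradedRing 𝒦]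
  {A : Type*} [Ring A] {𝒜 : ZMod 2 → AddSubgroup A} [GradedRing 𝒜]
  [Module K A] [IsScalarTower K A A] [SetLike.GradedSMul 𝒦 𝒜]
  {M : Type*} [AddCommGroup M] [Module A M] [Module K M] [IsScalarTower K A M]
  {ℳ : ZMod 2 → AddSubgroup M}
  [DirectSum.Decomposition ℳ] [SetLike.GradedSMul 𝒜 ℳ] {q : M →+ M →+ A}
  {E : AddSubgroup (M →+ M)}

theorem ksmul_eq_smul_one_smul (A : Type*) [Ring A] [Module K A] [Module A M]
    [IsScalarTower K A M] (k : K) (m : M) : k • m = (k • (1 : A)) • m := by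
  rw [smul_assoc, one_smul]

theorem rmul_smul (hA : IsSupercommutative 𝒜) (a : A) (m : M) (c : A) :
    rmul 𝒜 ℳ (a • m) c = a • rmul 𝒜 ℳ m c := by
  refine homog_induction 𝒜 a (fun x y hx hy => ?_) fun κ a ha => ?_
  · simp only [add_smul, rmul_add, AddMonoidHom.add_apply, hx, hy]
  refine homog_induction 𝒜 c (fun x y hx hy => ?_) fun γ c hc => ?_
  · simp only [map_add, hx, hy, smul_add]
  refine homog_induction ℳ m (fun x y hx hy => ?_) fun β m hm => ?_
  · simp only [smul_add, rmul_add, AddMonoidHom.add_apply, hx, hy]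
  rw [rmul_of_mem 𝒜 ℳ hc hm, rmul_of_mem 𝒜 ℳ hc (smul_mem_gr 𝒜 ℳ ha hm), smul_smul c a,
    hA.comm hc ha, sgn_add_right, smul_assoc, smul_smul, mul_smul a c,
    smul_comm a (sgn γ β), mul_right_comm, sgn_mul_self, one_mul]

theorem IsDer.sapp_ksmul {x : M →+ M} {Δ : A →+ A} (hx : IsDer 𝒦 𝒜 ℳ q x Δ) (k : K) (m : M) :
    sapp ℳ x (k • m) = k • sapp ℳ x m := by
  refine hx.induction (fun S Δ S' Δ' h h' => ?_) fun σ x Δ hx => ?_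
  · rw [sapp_add_left, sapp_add_left, h, h', smul_add]
  refine homog_induction 𝒦 k (fun x y hx hy => ?_) fun κ k hk => ?_
  · rw [add_smul, sapp_add_right, hx, hy, add_smul]
  refine homog_induction ℳ m (fun x y hx hy => ?_) fun β m hm => ?_
  · simp only [smul_add, sapp_add_right, hx, hy]
  rw [sapp_of_mem ℳ hx.degree hm, sapp_of_mem ℳ hx.degree (ksmul_mem_gr (𝒜 := 𝒜) hk hm),
    hx.linear κ k hk, sgn_add_right, smul_smul, mul_right_comm, sgn_mul_self, one_mul,
    smul_comm k (sgn σ β)]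

theorem infBr_ksmul_left (hA : IsSupercommutative 𝒜) (hq : IsQuadraticForm 𝒜 ℳ q) (k : K)
    (s : A × M × M × (M →+ M)) {t : A × M × M × (M →+ M)} (ht : IsDer 𝒦 𝒜 ℳ q t.2.2.2 0) :
    infBr 𝒜 ℳ q (k • s) t = k • infBr 𝒜 ℳ q s t := by
  obtain ⟨a, m, n, x⟩ := s
  obtain ⟨a', m', n', x'⟩ := t
  dsimp only at ht
  have e := ksmul_eq_smul_one_smul (K := K) (M := M) A
  have e' : ∀ a : A, (k • (1 : A)) * a = k • a := fun m => by rw [smul_mul_assoc, one_mul]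
  have h1 : ∀ m n : M, q (k • m) n = k • q m n := fun m n => by
    rw [e, hq.smul_left hA, e']
  have h2 : ∀ m n : M, eMap 𝒜 ℳ q (k • m) n = k • eMap 𝒜 ℳ q m n := fun m n => by
    rw [e, hq.eMap_smul_left hA]
    refine AddMonoidHom.ext fun p => ?_
    rw [AddMonoidHom.smul_apply, AddMonoidHom.smul_apply, e]
  have h3 : ∀ (m : M) (c : A), rmul 𝒜 ℳ (k • m) c = k • rmul 𝒜 ℳ m c := fun m c => by
    rw [e, rmul_smul hA, ← e]
  simp only [Prod.smul_mk, infBr_mk, h1, h2, h3, ht.sapp_ksmul, ht.sbr_ksmul_left,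
    AddMonoidHom.smul_apply, smul_assoc, smul_sub, smul_add, smul_neg]

theorem ksmul_mem_infGr {κ α : ZMod 2} {k : K} (hk : k ∈ 𝒦 κ) {s : A × M × M × (M →+ M)}
    (hs : s ∈ infGr 𝒜 ℳ α) : k • s ∈ infGr 𝒜 ℳ (κ + α) :=
  mem_infGr.2 ⟨smul_mem_gr 𝒦 𝒜 hk hs.1, ksmul_mem_gr (𝒜 := 𝒜) hk hs.2.1,
    ksmul_mem_gr (𝒜 := 𝒜) hk hs.2.2.1, fun β m hm => by
      rw [add_assoc]; exact ksmul_mem_gr (𝒜 := 𝒜) hk (hs.2.2.2 β m hm)⟩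

theorem IsStandard.ksmul_mem_eInf (hK : IsSupercommutative 𝒦) (hA : IsSupercommutative 𝒜)
    (hq : IsQuadraticForm 𝒜 ℳ q) (hE : IsStandard 𝒜 ℳ q E) (k : K)
    {s : A × M × M × (M →+ M)} (hs : s ∈ eInf A E) : k • s ∈ eInf A E :=
  mem_eInf.2 (hE.ksmul_mem hK hA hq k (mem_eInf.1 hs))

theorem IsStandard.infBr_ksmul_right (hA : IsSupercommutative 𝒜)
    (hq : IsQuadraticForm 𝒜 ℳ q) (hE : IsStandard 𝒜 ℳ q E) {κ α : ZMod 2} {k : K}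
    (hk : k ∈ 𝒦 κ) {s t : A × M × M × (M →+ M)} (hsE : s ∈ eInf A E) (hs : s ∈ infGr 𝒜 ℳ α)
    (htE : t ∈ eInf A E) :
    infBr 𝒜 ℳ q s (k • t) = sgn κ α • k • infBr 𝒜 ℳ q s t := by
  refine hE.inf_induction hq htE (fun u v hu hv => ?_) fun β t ht htE => ?_
  · simp only [smul_add, infBr_add_right, hu, hv]
  rw [hq.infBr_skew hs (ksmul_mem_infGr hk ht), infBr_ksmul_left hA hq k t
    (hE.isDer (𝒦 := 𝒦) hA hq (mem_eInf.1 hsE)), hq.infBr_skew hs ht, smul_neg, smul_neg, sgn_add_right,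
    sgn_comm α κ, mul_smul, smul_comm k (sgn α β)]

theorem IsStandard.isLieSuperalgebra_eInf (hK : IsSupercommutative 𝒦)
    (hA : IsSupercommutative 𝒜) (hq : IsQuadraticForm 𝒜 ℳ q) (hE : IsStandard 𝒜 ℳ q E) :
    IsLieSuperalgebra 𝒦 (infGr 𝒜 ℳ) (eInf A E) (infBr 𝒜 ℳ q) where
  smul_mem k x hx := hE.ksmul_mem_eInf hK hA hq k hx
  decompose x hx := ⟨_, hE.infProj_mem hq hx 0, _, hE.infProj_mem hq hx 1,
    OspDer.infProj_mem 0 x, OspDer.infProj_mem 1 x, (infProj_zero_add_infProj_one x).symm⟩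
  disjoint x _ h0 h1 := by
    refine Prod.ext ?_ (Prod.ext ?_ (Prod.ext ?_ ?_))
    · exact eq_zero_of_mem_mem 𝒜 h0.1 h1.1
    · exact eq_zero_of_mem_mem ℳ h0.2.1 h1.2.1
    · exact eq_zero_of_mem_mem ℳ h0.2.2.1 h1.2.2.1
    · change x.2.2.2 = 0
      rw [← endProj_same ℳ h0.2.2.2, endProj_of_mem ℳ h1.2.2.2, if_neg (by decide)]
  smul_degree κ α k hk x _ hx := ksmul_mem_infGr hk hx
  br_mem x hx y hy := hE.infBr_mem hA hq hx hy
  br_degree α β x _ y _ h h' := hq.infBr_mem_infGr h h'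
  add_br x _ y _ z _ := infBr_add_left q x y z
  br_add x _ y _ z _ := infBr_add_right q x y z
  smul_br k x _ y hy := infBr_ksmul_left hA hq k x (hE.isDer (𝒦 := 𝒦) hA hq (mem_eInf.1 hy))
  br_smul κ α k hk x hx hd y hy := hE.infBr_ksmul_right hA hq hk hx hd hy
  skew α β x _ y _ hx hy := hq.infBr_skew hx hy
  jacobi α β γ x hxE y hyE z hzE hx hy hz := by
    refine jacobi_of_leibniz (u := infBr 𝒜 ℳ q x (infBr 𝒜 ℳ q y z))
      (v := infBr 𝒜 ℳ q y (infBr 𝒜 ℳ q x z)) ?_ ?_ ?_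
    · rw [hE.infBr_leibniz hA hq hx hxE hy hyE hzE, add_sub_cancel_right]
    · exact hq.infBr_skew (hq.infBr_mem_infGr hy hz) hx
    · rw [hq.infBr_skew (hq.infBr_mem_infGr hz hx) hy, hq.infBr_skew hz hx, infBr_neg_right,
        infBr_zsmul_right, smul_neg, neg_neg]

/-! ### Derivations of `E_∞` -/

section Derivations

theorem IsHomDerivation.add {α : ZMod 2} {d d' : eInf A E →+ eInf A E}
    (h : IsHomDerivation 𝒦 𝒜 ℳ q E α d) (h' : IsHomDerivation 𝒦 𝒜 ℳ q E α d') :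
    IsHomDerivation 𝒦 𝒜 ℳ q E α (d + d') where
  degree β x hx := add_mem (h.degree β x hx) (h'.degree β x hx)
  linear κ k hk x y hy := by
    change (d y).1 + (d' y).1 = sgn α κ • k • ((d x).1 + (d' x).1)
    rw [h.linear κ k hk x y hy, h'.linear κ k hk x y hy, smul_add, smul_add]
  leibniz β x y z hx hz := by
    change (d z).1 + (d' z).1 = infBr 𝒜 ℳ q ((d x).1 + (d' x).1) y.1 +
      sgn α β • infBr 𝒜 ℳ q x.1 ((d y).1 + (d' y).1)
    rw [h.leibniz β x y z hx hz, h'.leibniz β x y z hx hz, infBr_add_left, infBr_add_right,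
      smul_add]
    abel

theorem IsHomDerivation.neg {α : ZMod 2} {d : eInf A E →+ eInf A E}
    (h : IsHomDerivation 𝒦 𝒜 ℳ q E α d) : IsHomDerivation 𝒦 𝒜 ℳ q E α (-d) where
  degree β x hx := neg_mem (h.degree β x hx)
  linear κ k hk x y hy := by
    change -(d y).1 = sgn α κ • k • -(d x).1
    rw [h.linear κ k hk x y hy, smul_neg, smul_neg]
  leibniz β x y z hx hz := by
    change -(d z).1 = infBr 𝒜 ℳ q (-(d x).1) y.1 + sgn α β • infBr 𝒜 ℳ q x.1 (-(d y).1)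
    rw [h.leibniz β x y z hx hz, ← infBrHom_apply, ← infBrHom_apply, ← infBrHom_apply,
      ← infBrHom_apply, map_neg, map_neg, AddMonoidHom.neg_apply, smul_neg, neg_add]

theorem IsDerivation.add {d d' : eInf A E →+ eInf A E}
    (h : IsDerivation 𝒦 𝒜 ℳ q E d) (h' : IsDerivation 𝒦 𝒜 ℳ q E d') :
    IsDerivation 𝒦 𝒜 ℳ q E (d + d') := by
  obtain ⟨d₀, d₁, h0, h1, rfl⟩ := h
  obtain ⟨d₀', d₁', h0', h1', rfl⟩ := h'
  exact ⟨_, _, h0.add h0', h1.add h1', add_add_add_comm _ _ _ _⟩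

/-- The restriction of an endomorphism to `E_∞`. -/
def infRestrict (D : (A × M × M × (M →+ M)) →+ (A × M × M × (M →+ M)))
    (h : ∀ v ∈ eInf A E, D v ∈ eInf A E) : eInf A E →+ eInf A E :=
  (D.comp (eInf A E).subtype).codRestrict (eInf A E) fun v => h v v.2

theorem infRestrict_coe (D : (A × M × M × (M →+ M)) →+ (A × M × M × (M →+ M)))
    (h : ∀ v ∈ eInf A E, D v ∈ eInf A E) (v : eInf A E) : (infRestrict D h v).1 = D v.1 := rfl

theorem IsStandard.infBrHom_mem (hA : IsSupercommutative 𝒜) (hq : IsQuadraticForm 𝒜 ℳ q)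
    (hE : IsStandard 𝒜 ℳ q E) {s t : A × M × M × (M →+ M)} (hs : s ∈ eInf A E)
    (ht : t ∈ eInf A E) : infBrHom 𝒜 ℳ q s t ∈ eInf A E := hE.infBr_mem hA hq hs ht

theorem IsStandard.isHomDerivation_infBr
    (hA : IsSupercommutative 𝒜) (hq : IsQuadraticForm 𝒜 ℳ q) (hE : IsStandard 𝒜 ℳ q E)
    {α : ZMod 2} {s : A × M × M × (M →+ M)} (hsE : s ∈ eInf A E) (hs : s ∈ infGr 𝒜 ℳ α) :
    IsHomDerivation 𝒦 𝒜 ℳ q E α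
      (infRestrict (infBrHom 𝒜 ℳ q s) fun _ hv => hE.infBrHom_mem hA hq hsE hv) where
  degree β x hx := hq.infBr_mem_infGr hs hx
  linear κ k hk x y hy := by
    change infBr 𝒜 ℳ q s y.1 = sgn α κ • k • infBr 𝒜 ℳ q s x.1
    rw [hy, hE.infBr_ksmul_right hA hq hk hsE hs x.2, sgn_comm]
  leibniz β x y z hx hz := by
    change infBr 𝒜 ℳ q s z.1 = infBr 𝒜 ℳ q (infBr 𝒜 ℳ q s x.1) y.1 +
      sgn α β • infBr 𝒜 ℳ q x.1 (infBr 𝒜 ℳ q s y.1)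
    rw [hz, hE.infBr_leibniz hA hq hs hsE hx x.2 y.2]

theorem IsStandard.isDerivation_of_isInner
    (hA : IsSupercommutative 𝒜) (hq : IsQuadraticForm 𝒜 ℳ q) (hE : IsStandard 𝒜 ℳ q E)
    {d : eInf A E →+ eInf A E} (hd : IsInner 𝒜 ℳ q E d) : IsDerivation 𝒦 𝒜 ℳ q E d := by
  obtain ⟨s, hs⟩ := hd
  refine ⟨_, _, hE.isHomDerivation_infBr hA hq (hE.infProj_mem hq s.2 0) (OspDer.infProj_mem 0 s.1),
    hE.isHomDerivation_infBr hA hq (hE.infProj_mem hq s.2 1) (OspDer.infProj_mem 1 s.1), ?_⟩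
  refine AddMonoidHom.ext fun v => Subtype.ext ?_
  rw [hs v]
  conv_lhs => rw [← infProj_zero_add_infProj_one (𝒜 := 𝒜) (ℳ := ℳ) s.1, infBr_add_left]
  rfl

theorem IsSim.isHomDerivation (hM : IsFaithful A M) (hq : IsQuadraticForm 𝒜 ℳ q)
    (hE : IsStandard 𝒜 ℳ q E) {σ : ZMod 2} {S : M →+ M} {Δ : A →+ A}
    (hS : IsSim 𝒦 𝒜 ℳ q σ S Δ) :
    IsHomDerivation 𝒦 𝒜 ℳ q E σ (infRestrict (dsMap ℳ S Δ) fun _ hv =>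
      mem_eInf.2 (hE.sbr_mem hq hS.isDer (mem_eInf.1 hv))) where
  degree β x hx := hS.dsMap_mem hx
  linear κ k hk x y hy := by
    rw [infRestrict_coe, infRestrict_coe, hy, dsMap_apply, dsMap_apply]
    refine Prod.ext ?_ (Prod.ext ?_ (Prod.ext ?_ ?_))
    · exact (hS.isADer hM).linear κ k hk _
    · exact hS.linear κ k hk _
    · exact hS.linear κ k hk _
    · rw [sgn_comm]; exact hS.sbr_ksmul_right hk _
  leibniz β x y z hx hz := by
    rw [infRestrict_coe, infRestrict_coe, infRestrict_coe, hz]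
    refine hE.inf_induction hq y.2 (fun u v hu hv => ?_) fun γ u hu huE => ?_
    · rw [infBr_add_right, infBr_add_right, map_add, map_add, infBr_add_right, hu, hv, smul_add]
      abel
    · exact dsMap_infBr hq hS hx hu

end Derivations

end InfLie

/-! ### Endomorphisms commuting with `eosp(q)` up to scalars -/

section RankTwo

variable {A : Type*} [Ring A] {𝒜 : ZMod 2 → AddSubgroup A} [GradedRing 𝒜]
  {M : Type*} [AddCommGroup M] [Module A M]
  {ℳ : ZMod 2 → AddSubgroup M}
  [DirectSum.Decomposition ℳ] [SetLike.GradedSMul 𝒜 ℳ] {q : M →+ M →+ A}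

variable (𝒜 ℳ q) in
/-- Up to scalars, `R` supercommutes with all endomorphisms `E_{m,n}`. -/
def IsScalarCentralizer (α : ZMod 2) (R : M →+ M) : Prop :=
  ∀ β γ, ∀ m ∈ ℳ β, ∀ n ∈ ℳ γ, ∃ a : A, ∀ p,
    R (eMap 𝒜 ℳ q m n p) = a • p + sgn α (β + γ) • eMap 𝒜 ℳ q m n (R p)

variable (𝒜 ℳ q) in
/-- `h` and `k` are even, orthogonal, of invertible norm, and their orthogonal complement has zero
annihilator. -/
structure IsRankTwoPair (h k : M) : Prop where
  mem_left : h ∈ ℳ 0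
  mem_right : k ∈ ℳ 0
  unit_left : IsUnit (q h h)
  unit_right : IsUnit (q k k)
  orth : q h k = 0
  orth' : q k h = 0
  faithful : ∀ a : A, (∀ m : M, q h m = 0 → q k m = 0 → a • m = 0) → a = 0

theorem IsRankTwoPair.symm {h k : M} (hk : IsRankTwoPair ℳ q h k) : IsRankTwoPair ℳ q k h :=
  ⟨hk.mem_right, hk.mem_left, hk.unit_right, hk.unit_left, hk.orth', hk.orth,
    fun a ha => hk.faithful a fun m h1 h2 => ha m h2 h1⟩

/-- An odd vector has norm `0` by supersymmetry and invertibility of `2`. If that is a unit, `A` is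
the zero ring and the vector is `0`, hence also even. -/
theorem HasRankTwoSummand.exists_pair (h2 : IsUnit (2 : A))
    (hq : IsQuadraticForm 𝒜 ℳ q) (h : HasRankTwoSummand ℳ q) : ∃ h k, IsRankTwoPair ℳ q h k := by
  obtain ⟨h, hh, hu, ho, hf⟩ := h
  have key : ∀ i, h i ∈ ℳ 0 := by
    intro i
    obtain ⟨α, hα⟩ := hh i
    rcases zmod2_cases α with rfl | rfl
    · exact hα
    · have h1 := hq.supersymm _ _ _ hα _ hα
      rw [sgn_one_one, neg_one_smul] at h1
      have h3 : q (h i) (h i) = 0 :=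
        eq_zero_of_add_self h2 (by nth_rewrite 1 [h1]; exact neg_add_cancel _)
      have h4 := hu i
      rw [h3, isUnit_zero_iff] at h4
      have h5 : h i = 0 := by rw [← one_smul A (h i), ← h4, zero_smul]
      rw [h5]
      exact zero_mem _
  exact ⟨h 0, h 1, key 0, key 1, hu 0, hu 1, ho 0 1 (by decide), ho 1 0 (by decide),
    fun a ha => hf a fun m hm => ha m (hm 0) (hm 1)⟩

theorem proj_form_right (hq : IsQuadraticForm 𝒜 ℳ q) {h : M} (hh : h ∈ ℳ 0) (m : M)
    (β : ZMod 2) : q h (proj ℳ β m) = proj 𝒜 β (q h m) := by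
  refine homog_induction ℳ m (fun x y hx hy => ?_) fun δ m hm => ?_
  · simp only [map_add, hx, hy]
  · have e := hq.degree _ _ _ hh _ hm
    rw [zero_add] at e
    rw [proj_of_mem ℳ hm, proj_of_mem 𝒜 e]
    split_ifs <;> simp

variable (hA : IsSupercommutative 𝒜) (hq : IsQuadraticForm 𝒜 ℳ q) {h k : M}
  (hk : IsRankTwoPair ℳ q h k) {α : ZMod 2} {R : M →+ M} (hR : IsScalarCentralizer 𝒜 ℳ q α R)
  (hd : R ∈ endGr ℳ α)

include hk hq in
theorem IsRankTwoPair.eMap_apply (p : M) : eMap 𝒜 ℳ q h k p = q k p • h - q h p • k := by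
  refine homog_induction ℳ p (fun x y hx hy => ?_) fun β p hp => ?_
  · simp only [map_add, add_smul, hx, hy]; abel
  · rw [hq.eMap_apply hk.mem_left hk.mem_right hp]
    simp

include hA hq hk hR in
-- `E_{h,k}` kills `c`, so `0 = a c + E_{h,k}(R c)`. Pairing with `h` and with `k` removes `a c` and
-- leaves the two claims times units.
theorem IsRankTwoPair.perp_mem {c : M} (h1 : q h c = 0) (h2 : q k c = 0) :
    q h (R c) = 0 ∧ q k (R c) = 0 := by
  obtain ⟨a, ha⟩ := hR 0 0 h hk.mem_left k hk.mem_right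
  have e := ha c
  rw [hk.eMap_apply hq, hk.eMap_apply hq, h1, h2, zero_smul, zero_smul, sub_zero, map_zero,
    add_zero, sgn_zero_right, one_smul] at e
  have e1 := congrArg (q h) e
  have e2 := congrArg (q k) e
  rw [map_zero, map_add, map_sub, hq.smul_right_of_mem_zero hA _ hk.mem_left,
    hq.smul_right_of_mem_zero hA _ hk.mem_left, hq.smul_right_of_mem_zero hA _ hk.mem_left, h1,
    hk.orth, mul_zero, mul_zero, zero_add, sub_zero] at e1
  rw [map_zero, map_add, map_sub, hq.smul_right_of_mem_zero hA _ hk.mem_right,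
    hq.smul_right_of_mem_zero hA _ hk.mem_right, hq.smul_right_of_mem_zero hA _ hk.mem_right, h2,
    hk.orth', mul_zero, mul_zero, zero_add, zero_sub, zero_eq_neg] at e2
  exact ⟨(hk.unit_right.mul_left_eq_zero).1 e2, (hk.unit_left.mul_left_eq_zero).1 e1.symm⟩

include hA hq hk hR in
-- For `E_{ah,k}` the error scalar vanishes: on the orthogonal complement of `h, k`, which `R`
-- preserves, it is the only term left, and that complement is faithful.
theorem IsRankTwoPair.commutes {κ : ZMod 2} {a : A} (ha : a ∈ 𝒜 κ) (p : M) :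
    R (a • (q k p • h - q h p • k)) = sgn α κ • a • (q k (R p) • h - q h (R p) • k) := by
  have hah : a • h ∈ ℳ κ := by
    have := smul_mem_gr 𝒜 ℳ ha hk.mem_left
    rwa [add_zero] at this
  obtain ⟨b, hb⟩ := hR κ 0 (a • h) hah k hk.mem_right
  have e : ∀ p, eMap 𝒜 ℳ q (a • h) k p = a • (q k p • h - q h p • k) := fun p => by
    rw [hq.eMap_smul_left hA, AddMonoidHom.smul_apply, hk.eMap_apply hq]
  simp only [e, add_zero] at hb
  have hb0 : b = 0 := by
    refine hk.faithful b fun m h1 h2 => ?_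
    have e := hb m
    obtain ⟨h3, h4⟩ := hk.perp_mem hA hq hR h1 h2
    rw [h1, h2, h3, h4] at e
    simpa using e.symm
  rw [hb p, hb0, zero_smul, zero_add]

include hA hq hk hR hd in
-- Uses `E_{h,c}`. Evaluation at `k`, which it kills, and pairing with `k` shows that the error
-- scalar is zero; evaluation at `k` then gives the first claim. Evaluation at `h` gives the second,
-- once pairing with `h` has removed the term `q(c, R h) h`.
theorem IsRankTwoPair.apply_perp_of_mem {γ : ZMod 2} {c : M} (hc : c ∈ ℳ γ) (h1 : q h c = 0)
    (h2 : q k c = 0) : q h (R k) • c = 0 ∧ R (q h h • c) = q h (R h) • c := by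
  obtain ⟨b, hb⟩ := hR 0 γ h hk.mem_left c hc
  have h1' : q c h = 0 := by rw [hq.supersymm _ _ _ hc _ hk.mem_left, h1, smul_zero]
  have h2' : q c k = 0 := by rw [hq.supersymm _ _ _ hc _ hk.mem_right, h2, smul_zero]
  have hRk : R k ∈ ℳ α := by have := hd _ _ hk.mem_right; rwa [add_zero] at this
  have hRh : R h ∈ ℳ α := by have := hd _ _ hk.mem_left; rwa [add_zero] at this
  have e : ∀ {δ : ZMod 2} {p : M}, p ∈ ℳ δ → eMap 𝒜 ℳ q h c p = q c p • h - sgn γ δ • q h p • c :=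
    fun hp => by rw [hq.eMap_apply hk.mem_left hc hp]; simp
  have hb0 : b = 0 := by
    have e1 := congrArg (q k) (hb k)
    rw [e hk.mem_right, e hRk, h2', hk.orth, zero_smul, zero_smul, smul_zero, sub_zero, map_zero,
      map_zero, map_add, map_zsmul, map_sub, map_zsmul, hq.smul_right_of_mem_zero hA _ hk.mem_right,
      hq.smul_right_of_mem_zero hA _ hk.mem_right, hq.smul_right_of_mem_zero hA _ hk.mem_right,
      h2, hk.orth', mul_zero, mul_zero, smul_zero, sub_zero, smul_zero, add_zero] at e1
    exact (hk.unit_right.mul_left_eq_zero).1 e1.symm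
  simp only [hb0, zero_smul, zero_add] at hb
  have e1 := hb k
  have e2 := hb h
  rw [e hk.mem_right, e hRk, h2', hk.orth, zero_smul, zero_smul, smul_zero, sub_zero, map_zero] at e1
  rw [e hk.mem_left, e hRh, h1', zero_smul, zero_sub, sgn_zero_right, one_smul, map_neg] at e2
  have e1' : (0 : M) = q c (R k) • h - sgn γ α • q h (R k) • c := by
    have := congrArg (fun z => sgn α γ • z) e1
    simpa using this
  have e3 := congrArg (q h) e1'
  rw [map_zero, map_sub, map_zsmul, hq.smul_right_of_mem_zero hA _ hk.mem_left,
    hq.smul_right_of_mem_zero hA _ hk.mem_left, h1, mul_zero, smul_zero, sub_zero] at e3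
  have e4 := (hk.unit_left.mul_left_eq_zero).1 e3.symm
  rw [e4, zero_smul, zero_sub, zero_eq_neg] at e1'
  have e5 : q h (R k) • c = 0 := by
    have := congrArg (fun z => sgn γ α • z) e1'
    simpa using this
  refine ⟨e5, ?_⟩
  have h6 : q h (R (q h h • c)) = 0 :=
    (hk.perp_mem hA hq hR (by rw [hq.smul_right_of_mem_zero hA _ hk.mem_left, h1, mul_zero])
      (by rw [hq.smul_right_of_mem_zero hA _ hk.mem_right, h2, mul_zero])).1
  have e6 := congrArg (q h) e2
  rw [map_neg, h6, neg_zero, map_zsmul, map_sub, map_zsmul,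
    hq.smul_right_of_mem_zero hA _ hk.mem_left, hq.smul_right_of_mem_zero hA _ hk.mem_left, h1,
    mul_zero, smul_zero, sub_zero] at e6
  have e7 : q c (R h) * q h h = 0 := by
    have := congrArg (fun z => sgn α γ • z) e6
    simp only [smul_zero, sgn_smul_sgn_smul] at this
    exact this.symm
  rw [(hk.unit_left.mul_left_eq_zero).1 e7, zero_smul, zero_sub, smul_neg, neg_inj, sgn_comm γ α,
    sgn_smul_sgn_smul] at e2
  exact e2

include hA hq hk hR hd in
theorem IsRankTwoPair.apply_perp {c : M} (h1 : q h c = 0) (h2 : q k c = 0) :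
    q h (R k) • c = 0 ∧ R (q h h • c) = q h (R h) • c := by
  have key : ∀ β, _ := fun β => hk.apply_perp_of_mem hA hq hR hd (proj_mem ℳ β c)
    (by rw [proj_form_right hq hk.mem_left, h1, map_zero])
    (by rw [proj_form_right hq hk.mem_right, h2, map_zero])
  rw [← proj_zero_add_proj_one ℳ c, smul_add, smul_add, smul_add, map_add, (key 0).1, (key 1).1,
    (key 0).2, (key 1).2, add_zero]
  exact ⟨rfl, rfl⟩

include hA hq hk hR hd in
theorem IsRankTwoPair.form_apply_eq_zero : q h (R k) = 0 :=
  hk.faithful _ fun _ h1 h2 => (hk.apply_perp hA hq hR hd h1 h2).1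

include hA hq hk hR hd in
theorem IsRankTwoPair.apply_perp_eq {c : M} (h1 : q h c = 0) (h2 : q k c = 0) :
    R c = (q h (R h) * Ring.inverse (q h h)) • c := by
  have e := (hk.apply_perp hA hq hR hd (c := Ring.inverse (q h h) • c)
    (by rw [hq.smul_right_of_mem_zero hA _ hk.mem_left, h1, mul_zero])
    (by rw [hq.smul_right_of_mem_zero hA _ hk.mem_right, h2, mul_zero])).2
  rwa [smul_smul, Ring.mul_inverse_cancel _ hk.unit_left, one_smul, smul_smul] at e

include hA hq hk hR hd in
-- Both scalars describe `R` on the orthogonal complement of `h, k`, which is faithful.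
theorem IsRankTwoPair.scalar_eq :
    q h (R h) * Ring.inverse (q h h) = q k (R k) * Ring.inverse (q k k) := by
  rw [← sub_eq_zero]
  refine hk.faithful _ fun c h1 h2 => ?_
  rw [sub_smul, ← hk.apply_perp_eq hA hq hR hd h1 h2, ← hk.symm.apply_perp_eq hA hq hR hd h2 h1,
    sub_self]

include hA hq hk hR hd in
theorem IsRankTwoPair.scalar_mem : q h (R h) * Ring.inverse (q h h) ∈ 𝒜 α := by
  have e1 := hq.degree _ _ _ hk.mem_left _ hk.mem_left
  have e2 := hq.degree _ _ _ hk.mem_left _ (hd _ _ hk.mem_left)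
  rw [add_zero] at e1
  rw [zero_add, add_zero] at e2
  have := mul_mem_gr e2 (inverse_mem_zero e1 hk.unit_left)
  rwa [add_zero] at this

include hA hq hk hR hd in
-- Apply `commutes` at `p = k` with the scalar `a q(k,k)⁻¹`, for which `E` takes `k` to `a h`.
theorem IsRankTwoPair.apply_smul_left {κ : ZMod 2} {a : A} (ha : a ∈ 𝒜 κ) :
    R (a • h) = (q h (R h) * Ring.inverse (q h h)) • a • h := by
  have hu : q k k ∈ 𝒜 0 := by
    have := hq.degree _ _ _ hk.mem_right _ hk.mem_right
    rwa [add_zero] at this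
  have hw := inverse_mem_zero hu hk.unit_right
  have haw := mul_mem_gr ha hw
  have e := hk.commutes hA hq hR haw k
  rw [add_zero] at e
  rw [hk.orth, zero_smul, sub_zero, smul_smul, mul_assoc, Ring.inverse_mul_cancel _ hk.unit_right,
    mul_one, hk.form_apply_eq_zero hA hq hR hd, zero_smul, sub_zero, smul_smul, mul_assoc,
    hA.comm_of_mem_zero hw, ← hk.scalar_eq hA hq hR hd,
    hA.comm ha (hk.scalar_mem hA hq hR hd), sgn_comm, smul_assoc, sgn_smul_sgn_smul] at e
  rw [e, smul_smul]

include hA hq hk hR hd in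
/-- In the presence of an invertibly diagonalizable summand of rank two, an endomorphism which
supercommutes with `eosp(q)` up to scalars is a scalar. -/
theorem IsRankTwoPair.eq_lmul : ∃ a ∈ 𝒜 α, R = lmul M a := by
  refine ⟨_, hk.scalar_mem hA hq hR hd, AddMonoidHom.ext fun m => ?_⟩
  set a := q h (R h) * Ring.inverse (q h h) with ha
  have e1 : ∀ c : A, R (c • h) = a • c • h := fun c => by
    refine homog_induction 𝒜 c (fun x y hx hy => ?_) fun κ c hc =>
      hk.apply_smul_left hA hq hR hd hc
    rw [add_smul, map_add, hx, hy, smul_add]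
  have e2 : ∀ c : A, R (c • k) = a • c • k := fun c => by
    refine homog_induction 𝒜 c (fun x y hx hy => ?_) fun κ c hc => ?_
    · rw [add_smul, map_add, hx, hy, smul_add]
    · rw [ha, hk.scalar_eq hA hq hR hd]
      exact hk.symm.apply_smul_left hA hq hR hd hc
  -- Orthogonal decomposition of `m` along `h`, `k` and their complement; `R` is already known to be
  -- the scalar `a` on each part.
  have e3 : m = (m - (q h m * Ring.inverse (q h h)) • h - (q k m * Ring.inverse (q k k)) • k) +
      (q h m * Ring.inverse (q h h)) • h + (q k m * Ring.inverse (q k k)) • k := by abel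
  change R m = a • m
  rw [e3, map_add, map_add, e1, e2, smul_add, smul_add,
    hk.apply_perp_eq hA hq hR hd (c := m - _ - _)]
  · rw [map_sub, map_sub, hq.smul_right_of_mem_zero hA _ hk.mem_left,
      hq.smul_right_of_mem_zero hA _ hk.mem_left, hk.orth, mul_assoc,
      Ring.inverse_mul_cancel _ hk.unit_left]
    simp
  · rw [map_sub, map_sub, hq.smul_right_of_mem_zero hA _ hk.mem_right,
      hq.smul_right_of_mem_zero hA _ hk.mem_right, hk.orth', mul_assoc (q k m),
      Ring.inverse_mul_cancel _ hk.unit_right]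
    simp

end RankTwo

/-! ### The classification of the derivations of `E_∞` -/

section Classification

variable {K : Type*} [Ring K] {𝒦 : ZMod 2 → AddSubgroup K} [GradedRing 𝒦]
  {A : Type*} [Ring A] {𝒜 : ZMod 2 → AddSubgroup A} [GradedRing 𝒜]
  [Module K A] [IsScalarTower K A A] [SetLike.GradedSMul 𝒦 𝒜]
  {M : Type*} [AddCommGroup M] [Module A M] [Module K M] [IsScalarTower K A M]
  {ℳ : ZMod 2 → AddSubgroup M}
  [DirectSum.Decomposition ℳ] [SetLike.GradedSMul 𝒜 ℳ] {q : M →+ M →+ A}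
  {E : AddSubgroup (M →+ M)}

/-- The elements `(a, 0, 0, 0)` of `E_∞`. -/
def infScalar (A : Type*) [Ring A] (E : AddSubgroup (M →+ M)) : A →+ eInf A E :=
  (AddMonoidHom.inl A (M × M × (M →+ M))).codRestrict (eInf A E) fun _ =>
    ⟨trivial, trivial, trivial, zero_mem E⟩

/-- The elements `(0, m, 0, 0)` of `E_∞`. -/
def infFst (A : Type*) [Ring A] (E : AddSubgroup (M →+ M)) : M →+ eInf A E :=
  ((AddMonoidHom.inr A _).comp (AddMonoidHom.inl M (M × (M →+ M)))).codRestrict (eInf A E)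
    fun _ => ⟨trivial, trivial, trivial, zero_mem E⟩

/-- The elements `(0, 0, n, 0)` of `E_∞`. -/
def infSnd (A : Type*) [Ring A] (E : AddSubgroup (M →+ M)) : M →+ eInf A E :=
  ((AddMonoidHom.inr A _).comp ((AddMonoidHom.inr M _).comp
    (AddMonoidHom.inl M (M →+ M)))).codRestrict (eInf A E) fun _ => ⟨trivial, trivial, trivial, zero_mem E⟩

/-- The elements `(0, 0, 0, x)` of `E_∞`. -/
def infEnd (A : Type*) [Ring A] (E : AddSubgroup (M →+ M)) : E →+ eInf A E :=
  (((AddMonoidHom.inr A _).comp ((AddMonoidHom.inr M _).comp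
    (AddMonoidHom.inr M (M →+ M)))).comp E.subtype).codRestrict (eInf A E) fun x =>
      ⟨trivial, trivial, trivial, x.2⟩

theorem infScalar_coe (a : A) : (infScalar A E a).1 = (a, 0, 0, 0) := rfl

theorem infFst_coe (m : M) : (infFst A E m).1 = (0, m, 0, 0) := rfl

theorem infSnd_coe (m : M) : (infSnd A E m).1 = (0, 0, m, 0) := rfl

theorem infEnd_coe (x : E) : (infEnd A E x).1 = (0, 0, 0, x.1) := rfl

theorem infFst_mem {β : ZMod 2} {m : M} (hm : m ∈ ℳ β) : (infFst A E m).1 ∈ infGr 𝒜 ℳ β :=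
  mem_infGr.2 ⟨zero_mem _, hm, zero_mem _, zero_mem _⟩

theorem infSnd_mem {β : ZMod 2} {m : M} (hm : m ∈ ℳ β) : (infSnd A E m).1 ∈ infGr 𝒜 ℳ β :=
  mem_infGr.2 ⟨zero_mem _, zero_mem _, hm, zero_mem _⟩

theorem infScalar_mem {β : ZMod 2} {a : A} (ha : a ∈ 𝒜 β) :
    (infScalar A E a).1 ∈ infGr 𝒜 ℳ β :=
  mem_infGr.2 ⟨ha, zero_mem _, zero_mem _, zero_mem _⟩

theorem infEnd_mem {β : ZMod 2} {x : E} (hx : x.1 ∈ endGr ℳ β) :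
    (infEnd A E x).1 ∈ infGr 𝒜 ℳ β :=
  mem_infGr.2 ⟨zero_mem _, zero_mem _, zero_mem _, hx⟩

theorem eInf_decompose (v : eInf A E) : v = infScalar A E v.1.1 + infFst A E v.1.2.1 +
    infSnd A E v.1.2.2.1 + infEnd A E ⟨v.1.2.2.2, mem_eInf.1 v.2⟩ := by
  refine Subtype.ext (Prod.ext ?_ (Prod.ext ?_ (Prod.ext ?_ ?_))) <;>
    simp [infScalar_coe, infFst_coe, infSnd_coe, infEnd_coe]

theorem infBr_fst (q : M →+ M →+ A) (a : A) (x : M →+ M) (m : M) :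
    infBr 𝒜 ℳ q (a, 0, 0, x) (0, m, 0, 0) = (0, a • m + x m, 0, 0) := by
  simp [infBr_mk, sbr_zero_right]

theorem infBr_snd (q : M →+ M →+ A) (a : A) (x : M →+ M) (n : M) :
    infBr 𝒜 ℳ q (a, 0, 0, x) (0, 0, n, 0) = (0, 0, -(a • n) + x n, 0) := by
  simp [infBr_mk, sbr_zero_right]

theorem infBr_fst_snd (q : M →+ M →+ A) (m n : M) :
    infBr 𝒜 ℳ q (0, m, 0, 0) (0, 0, n, 0) = (q m n, 0, 0, eMap 𝒜 ℳ q m n) := by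
  simp [infBr_mk, sbr_zero_right]

theorem infBr_one (q : M →+ M →+ A) (v : A × M × M × (M →+ M)) :
    infBr 𝒜 ℳ q (1, 0, 0, 0) v = (0, v.2.1, -v.2.2.1, 0) := by
  obtain ⟨a, m, n, x⟩ := v
  simp [infBr_mk, sbr_zero_left]

/-- `d` preserves the grading of `E_∞` by the eigenvalues `0, 1, -1` of `ad (1, 0, 0, 0)`, and acts
on the eigenspaces for `1` and `-1` by `S` and `T`. -/
structure IsEigenDerivation (E : AddSubgroup (M →+ M)) (d : eInf A E →+ eInf A E)
    (S T : M →+ M) : Prop where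
  fst : ∀ m, (d (infFst A E m)).1 = (0, S m, 0, 0)
  snd : ∀ n, (d (infSnd A E n)).1 = (0, 0, T n, 0)
  zero : ∀ v : eInf A E, v.1.2.1 = 0 → v.1.2.2.1 = 0 → (d v).1.2.1 = 0 ∧ (d v).1.2.2.1 = 0

variable {α : ZMod 2} {d : eInf A E →+ eInf A E}

/-- With `ζ = (1, 0, 0, 0)`, the assumption says that `d ζ` is again in the zero eigenspace, whose
bracket preserves each eigenspace. Comparing components in `d[ζ, y] = [dζ, y] + [ζ, dy]` shows that
`d` preserves them too. -/
theorem IsHomDerivation.exists_isEigenDerivation (h2 : IsUnit (2 : A))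
    (hd : IsHomDerivation 𝒦 𝒜 ℳ q E α d) (h1 : (d (infScalar A E 1)).1.2.1 = 0)
    (h3 : (d (infScalar A E 1)).1.2.2.1 = 0) : ∃ S T, IsEigenDerivation E d S T := by
  obtain ⟨a, x, hax⟩ : ∃ a x, (d (infScalar A E 1)).1 = (a, 0, 0, x) :=
    ⟨_, _, Prod.ext rfl (Prod.ext h1 (Prod.ext h3 rfl))⟩
  have key : ∀ y z : eInf A E, z.1 = (0, y.1.2.1, -y.1.2.2.1, 0) →
      (d z).1 = infBr 𝒜 ℳ q (a, 0, 0, x) y.1 + (0, (d y).1.2.1, -(d y).1.2.2.1, 0) := by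
    intro y z hz
    have h := hd.leibniz 0 (infScalar A E 1) y z (infScalar_mem one_mem_zero)
      (by rw [infScalar_coe, infBr_one, hz])
    rw [h, hax, sgn_zero_right, one_smul, infScalar_coe, infBr_one]
  -- A component in the opposite eigenspace satisfies `m = -m`, so it vanishes as `2` is invertible.
  have self_neg : ∀ {m : M}, m = -m → m = 0 := fun h =>
    eq_zero_of_add_self h2 (by nth_rewrite 1 [h]; exact neg_add_cancel _)
  have e1 : ∀ m, (d (infFst A E m)).1 = (0, (d (infFst A E m)).1.2.1, 0, 0) := by
    intro m
    have h := key (infFst A E m) (infFst A E m) (by simp [infFst_coe])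
    rw [infFst_coe, infBr_fst] at h
    have c1 := congrArg Prod.fst h
    have c3 := congrArg (fun v => v.2.2.1) h
    have c4 := congrArg (fun v => v.2.2.2) h
    simp only [Prod.fst_add, Prod.snd_add, zero_add] at c1 c3 c4
    exact Prod.ext c1 (Prod.ext rfl (Prod.ext (self_neg c3) c4))
  have e2 : ∀ n, (d (infSnd A E n)).1 = (0, 0, (d (infSnd A E n)).1.2.2.1, 0) := by
    intro n
    have h := key (infSnd A E n) (-infSnd A E n) (by
      change -(infSnd A E n).1 = _
      simp [infSnd_coe])
    rw [infSnd_coe, infBr_snd, map_neg] at h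
    change -(d (infSnd A E n)).1 = _ at h
    have c1 := congrArg Prod.fst h
    have c2 := congrArg (fun v => v.2.1) h
    have c4 := congrArg (fun v => v.2.2.2) h
    simp only [Prod.fst_add, Prod.snd_add, zero_add, Prod.fst_neg, Prod.snd_neg, neg_eq_zero]
      at c1 c2 c4
    exact Prod.ext c1 (Prod.ext (self_neg c2.symm) (Prod.ext rfl c4))
  refine ⟨AddMonoidHom.mk' (fun m => (d (infFst A E m)).1.2.1) fun m m' => ?_,
    AddMonoidHom.mk' (fun m => (d (infSnd A E m)).1.2.2.1) fun m m' => ?_, e1, e2,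
    fun v hv hv' => ?_⟩
  · rw [map_add, map_add]; rfl
  · rw [map_add, map_add]; rfl
  · have h := key v 0 (by rw [hv, hv', neg_zero]; rfl)
    rw [map_zero] at h
    obtain ⟨⟨b, m, n, y⟩, hvE⟩ := v
    dsimp only at hv hv'
    subst hv hv'
    have e : infBr 𝒜 ℳ q (a, 0, 0, x) (b, 0, 0, y) = (0, 0, 0, sbr ℳ x y) := by simp [infBr_mk]
    rw [e] at h
    have c2 := congrArg (fun v => v.2.1) h
    have c3 := congrArg (fun v => v.2.2.1) h
    simp only [Prod.snd_add, Prod.fst_add, zero_add] at c2 c3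
    exact ⟨c2.symm, neg_eq_zero.1 c3.symm⟩

section Eigen

variable {S T : M →+ M} (hd : IsHomDerivation 𝒦 𝒜 ℳ q E α d) (h : IsEigenDerivation E d S T)

include hd h

theorem IsEigenDerivation.apply_fst {β : ZMod 2} (v : eInf A E) (hv : v.1 ∈ infGr 𝒜 ℳ β)
    (h1 : v.1.2.1 = 0) (h3 : v.1.2.2.1 = 0) (m : M) :
    S (v.1.1 • m + v.1.2.2.2 m) = (d v).1.1 • m + (d v).1.2.2.2 m +
      sgn α β • (v.1.1 • S m + v.1.2.2.2 (S m)) := by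
  have e : v.1 = (v.1.1, 0, 0, v.1.2.2.2) := Prod.ext rfl (Prod.ext h1 (Prod.ext h3 rfl))
  obtain ⟨h4, h5⟩ := h.zero v h1 h3
  have e' : (d v).1 = ((d v).1.1, 0, 0, (d v).1.2.2.2) :=
    Prod.ext rfl (Prod.ext h4 (Prod.ext h5 rfl))
  have l := hd.leibniz β v (infFst A E m) (infFst A E (v.1.1 • m + v.1.2.2.2 m)) hv (by
    rw [e, infFst_coe, infFst_coe, infBr_fst])
  rw [h.fst, h.fst, e', e, infFst_coe, infBr_fst, infBr_fst] at l
  exact congrArg (fun v => v.2.1) l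

theorem IsEigenDerivation.apply_snd {β : ZMod 2} (v : eInf A E) (hv : v.1 ∈ infGr 𝒜 ℳ β)
    (h1 : v.1.2.1 = 0) (h3 : v.1.2.2.1 = 0) (n : M) :
    T (-(v.1.1 • n) + v.1.2.2.2 n) = -((d v).1.1 • n) + (d v).1.2.2.2 n +
      sgn α β • (-(v.1.1 • T n) + v.1.2.2.2 (T n)) := by
  have e : v.1 = (v.1.1, 0, 0, v.1.2.2.2) := Prod.ext rfl (Prod.ext h1 (Prod.ext h3 rfl))
  obtain ⟨h4, h5⟩ := h.zero v h1 h3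
  have e' : (d v).1 = ((d v).1.1, 0, 0, (d v).1.2.2.2) :=
    Prod.ext rfl (Prod.ext h4 (Prod.ext h5 rfl))
  have l := hd.leibniz β v (infSnd A E n) (infSnd A E (-(v.1.1 • n) + v.1.2.2.2 n)) hv (by
    rw [e, infSnd_coe, infSnd_coe, infBr_snd])
  rw [h.snd, h.snd, e', e, infSnd_coe, infBr_snd, infBr_snd] at l
  exact congrArg (fun v => v.2.2.1) l

theorem IsEigenDerivation.isScalarCentralizer (hA : IsSupercommutative 𝒜)
    (hq : IsQuadraticForm 𝒜 ℳ q) (hE : IsStandard 𝒜 ℳ q E) :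
    IsScalarCentralizer 𝒜 ℳ q α (S - T) := by
  intro β γ m hm n hn
  let x : E := ⟨eMap 𝒜 ℳ q m n, hE.eosp_le hA hq (eMap_mem_eosp m n)⟩
  have hx : (infEnd A E x).1 ∈ infGr 𝒜 ℳ (β + γ) := infEnd_mem (hq.eMap_mem_endGr hm hn)
  -- The scalar part of `d(0, 0, 0, x)` acts with opposite signs on the two copies of `M`, so it
  -- occurs twice in the difference, while the endomorphism part cancels.
  refine ⟨(d (infEnd A E x)).1.1 + (d (infEnd A E x)).1.1, fun p => ?_⟩
  have e1 := h.apply_fst hd _ hx rfl rfl p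
  have e2 := h.apply_snd hd _ hx rfl rfl p
  simp only [infEnd_coe, zero_smul, neg_zero, zero_add] at e1 e2
  change (S - T) (x.1 p) = _ + sgn α (β + γ) • x.1 ((S - T) p)
  rw [AddMonoidHom.sub_apply, AddMonoidHom.sub_apply, e1, e2, map_sub, smul_sub, add_smul]
  abel

theorem IsEigenDerivation.degree_fst : S ∈ endGr ℳ α := fun β m hm => by
  have := hd.degree β _ (infFst_mem (E := E) (𝒜 := 𝒜) hm)
  rw [h.fst] at this
  exact this.2.1

theorem IsEigenDerivation.degree_snd : T ∈ endGr ℳ α := fun β m hm => by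
  have := hd.degree β _ (infSnd_mem (E := E) (𝒜 := 𝒜) hm)
  rw [h.snd] at this
  exact this.2.2.1

end Eigen

/-- A derivation which acts by the same map `S` on the two eigenspaces is `d_S`. -/
theorem IsEigenDerivation.exists_isSim (h2 : IsUnit (2 : A))
    (hA : IsSupercommutative 𝒜) (hM : IsFaithful A M)
    (hq : IsQuadraticForm 𝒜 ℳ q) (hE : IsStandard 𝒜 ℳ q E) {S : M →+ M}
    (hd : IsHomDerivation 𝒦 𝒜 ℳ q E α d) (h : IsEigenDerivation E d S S) :
    ∃ Δ, IsSim 𝒦 𝒜 ℳ q α S Δ ∧ ∀ v : eInf A E, (d v).1 = dsMap ℳ S Δ v.1 := by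
  let Δ : A →+ A := AddMonoidHom.mk' (fun a => (d (infScalar A E a)).1.1) fun a b => by
    rw [map_add, map_add]; rfl
  have hΔ : ∀ a, (d (infScalar A E a)).1.1 = Δ a := fun _ => rfl
  have hsmul : ∀ κ, ∀ a ∈ 𝒜 κ, ∀ m, S (a • m) = Δ a • m + sgn α κ • a • S m ∧
      (d (infScalar A E a)).1.2.2.2 m = 0 := by
    intro κ a ha m
    have e1 := h.apply_fst hd _ (infScalar_mem (E := E) (ℳ := ℳ) ha) rfl rfl m
    have e2 := h.apply_snd hd _ (infScalar_mem (E := E) (ℳ := ℳ) ha) rfl rfl m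
    simp only [infScalar_coe, AddMonoidHom.zero_apply, add_zero, hΔ, map_neg, smul_neg] at e1 e2
    -- The scalar part of `d(a, 0, 0, 0)` changes sign between the two copies and the endomorphism
    -- part does not. As `S` is the same on both, twice the endomorphism part is zero.
    have e3 : (d (infScalar A E a)).1.2.2.2 m = 0 := by
      refine eq_zero_of_add_self h2 ?_
      rw [e1] at e2
      have := add_eq_zero_iff_eq_neg.2 (neg_eq_iff_eq_neg.1 e2)
      rw [← this]
      abel
    exact ⟨by rw [e1, e3, add_zero], e3⟩
  have hscal : ∀ a, (d (infScalar A E a)).1 = (Δ a, 0, 0, 0) := fun a => by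
    obtain ⟨h4, h5⟩ := h.zero (infScalar A E a) rfl rfl
    refine Prod.ext rfl (Prod.ext h4 (Prod.ext h5 (AddMonoidHom.ext fun m => ?_)))
    change (d (infScalar A E a)).1.2.2.2 m = 0
    refine homog_induction 𝒜 a (fun x y hx hy => ?_) fun κ a ha => (hsmul κ a ha m).2
    rw [map_add, map_add]
    change (d (infScalar A E x)).1.2.2.2 m + (d (infScalar A E y)).1.2.2.2 m = 0
    rw [hx, hy, add_zero]
  have hdeg := h.degree_fst hd
  have hend : ∀ x : E, (d (infEnd A E x)).1 = (0, 0, 0, sbr ℳ S x.1) := by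
    have hom : ∀ β, ∀ x : E, x.1 ∈ endGr ℳ β → (d (infEnd A E x)).1 = (0, 0, 0, sbr ℳ S x.1) := by
      intro β x hx
      have e1 := fun m => h.apply_fst hd _ (infEnd_mem (A := A) (𝒜 := 𝒜) hx) rfl rfl m
      have e2 := fun m => h.apply_snd hd _ (infEnd_mem (A := A) (𝒜 := 𝒜) hx) rfl rfl m
      simp only [infEnd_coe, zero_smul, neg_zero, zero_add] at e1 e2
      -- Dually to the case of scalars, here twice the scalar part acts by zero on `M`, so it
      -- vanishes by faithfulness.
      have e3 : (d (infEnd A E x)).1.1 = 0 := by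
        refine hM _ fun m => eq_zero_of_add_self h2 ?_
        have := (e1 m).symm.trans (e2 m)
        rw [← sub_eq_zero] at this
        rw [← this]
        abel
      obtain ⟨h4, h5⟩ := h.zero (infEnd A E x) rfl rfl
      refine Prod.ext e3 (Prod.ext h4 (Prod.ext h5 (AddMonoidHom.ext fun m => ?_)))
      change (d (infEnd A E x)).1.2.2.2 m = sbr ℳ S x.1 m
      have := e1 m
      rw [e3, zero_smul, zero_add] at this
      rw [sbr_of_mem ℳ hdeg hx]
      exact (sub_eq_of_eq_add this).symm
    intro x
    let y : ZMod 2 → E := fun β => ⟨endProj ℳ β x.1, hE.endProj_mem hq x.2 β⟩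
    have e : x = y 0 + y 1 := Subtype.ext (endProj_zero_add_endProj_one ℳ x.1).symm
    have e' : (d (infEnd A E x)).1 = (d (infEnd A E (y 0))).1 + (d (infEnd A E (y 1))).1 := by
      rw [e, map_add, map_add]; rfl
    rw [e', hom 0 _ (endProj_mem ℳ _ _), hom 1 _ (endProj_mem ℳ _ _), Prod.mk_add_mk,
      Prod.mk_add_mk, Prod.mk_add_mk, ← sbr_add_right]
    simp only [add_zero]
    rw [show (y 0).1 + (y 1).1 = x.1 from endProj_zero_add_endProj_one ℳ x.1]
  refine ⟨Δ, ⟨hdeg, fun β a ha => ?_, fun κ k hk m => ?_, fun κ a ha m => (hsmul κ a ha m).1,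
    fun β m hm n => ?_⟩, fun v => ?_⟩
  · have := hd.degree β _ (infScalar_mem (E := E) (ℳ := ℳ) ha)
    exact this.1
  · have := hd.linear κ k hk (infFst A E m) (infFst A E (k • m)) (by
      simp [infFst_coe])
    rw [h.fst, h.fst] at this
    exact congrArg (fun v => v.2.1) this
  -- The bracket of `(0, m, 0, 0)` and `(0, 0, n, 0)` is `(q(m,n), 0, 0, E_{m,n})`; the first
  -- component of the Leibniz rule for it is the rule for the form.
  · let x : E := ⟨eMap 𝒜 ℳ q m n, hE.eosp_le hA hq (eMap_mem_eosp m n)⟩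
    have := hd.leibniz β (infFst A E m) (infSnd A E n) (infScalar A E (q m n) + infEnd A E x)
      (infFst_mem hm) (by
        rw [infFst_coe, infSnd_coe, infBr_fst_snd]
        change (infScalar A E (q m n)).1 + (infEnd A E x).1 = _
        simp [infScalar_coe, infEnd_coe, x])
    rw [map_add] at this
    change (d (infScalar A E (q m n))).1 + (d (infEnd A E x)).1 = _ at this
    rw [hscal, hend, h.fst, h.snd, infFst_coe, infSnd_coe, infBr_fst_snd, infBr_fst_snd] at this
    have c := congrArg Prod.fst this
    simpa using c
  · conv_lhs => rw [eInf_decompose v]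
    simp only [map_add]
    change (d (infScalar A E v.1.1)).1 + (d (infFst A E v.1.2.1)).1 +
      (d (infSnd A E v.1.2.2.1)).1 + (d (infEnd A E ⟨v.1.2.2.2, mem_eInf.1 v.2⟩)).1 = _
    rw [hscal, h.fst, h.snd, hend, dsMap_apply]
    simp

/-- Two inner corrections suffice: one puts `d(1, 0, 0, 0)` into the zero eigenspace, the other
equalizes the actions on the two copies of `M`. -/
theorem IsHomDerivation.exists_eq (h2 : IsUnit (2 : A)) (hA : IsSupercommutative 𝒜)
    (hM : IsFaithful A M) (hq : IsQuadraticForm 𝒜 ℳ q) (hE : IsStandard 𝒜 ℳ q E)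
    (hr : HasRankTwoSummand ℳ q) (hd : IsHomDerivation 𝒦 𝒜 ℳ q E α d) :
    ∃ s ∈ eInf A E, ∃ S Δ, IsSim 𝒦 𝒜 ℳ q α S Δ ∧
      ∀ v : eInf A E, (d v).1 = infBr 𝒜 ℳ q s v.1 + dsMap ℳ S Δ v.1 := by
  obtain ⟨h, k, hk⟩ := hr.exists_pair h2 hq
  have hζ := hd.degree 0 _ (infScalar_mem (E := E) (ℳ := ℳ) (one_mem_zero (𝒜 := 𝒜)))
  rw [add_zero] at hζ
  set m := (d (infScalar A E 1)).1.2.1 with hm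
  set n := (d (infScalar A E 1)).1.2.2.1 with hn
  -- Chosen so that its bracket with `(1, 0, 0, 0)` is exactly the unwanted part `(0, m, n, 0)`.
  let s : A × M × M × (M →+ M) := (0, -m, n, 0)
  have hs : s ∈ infGr 𝒜 ℳ α := mem_infGr.2 ⟨zero_mem _, neg_mem hζ.2.1, hζ.2.2.1, zero_mem _⟩
  have hsE : s ∈ eInf A E := mem_eInf.2 (zero_mem E)
  have hd' := hd.add (hE.isHomDerivation_infBr (𝒦 := 𝒦) hA hq hsE hs).neg
  set d' := d + -(infRestrict (infBrHom 𝒜 ℳ q s) fun _ hv => hE.infBrHom_mem hA hq hsE hv)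
    with hd'def
  have ev : ∀ v, (d' v).1 = (d v).1 - infBr 𝒜 ℳ q s v.1 := fun v => by
    rw [hd'def, sub_eq_add_neg]; rfl
  have es : infBr 𝒜 ℳ q s (1, 0, 0, 0) = (0, m, n, 0) := by
    rw [infBr_mk, rmul_of_left_mem_zero 𝒜 ℳ _ one_mem_zero, rmul_of_left_mem_zero 𝒜 ℳ _ one_mem_zero]
    simp [sbr_zero_left]
  obtain ⟨S, T, hST⟩ := hd'.exists_isEigenDerivation h2
    (by rw [ev, infScalar_coe, es]; exact sub_self m)
    (by rw [ev, infScalar_coe, es]; exact sub_self n)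
  obtain ⟨a, ha, hR⟩ := hk.eq_lmul hA hq (hST.isScalarCentralizer hd' hA hq hE)
    (sub_mem (hST.degree_fst hd') (hST.degree_snd hd'))
  set c := Ring.inverse (2 : A) * a with hc
  have hcα : c ∈ 𝒜 α := by
    have := mul_mem_gr (inverse_mem_zero (two_mem_zero (𝒜 := 𝒜)) h2) ha
    rwa [zero_add] at this
  have hcc : ∀ m : M, c • m + c • m = a • m := fun m => by
    rw [hc, mul_smul, ← smul_add, inverse_two_smul_add_self h2]
  let t : A × M × M × (M →+ M) := (c, 0, 0, 0)
  have ht : t ∈ infGr 𝒜 ℳ α := mem_infGr.2 ⟨hcα, zero_mem _, zero_mem _, zero_mem _⟩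
  have htE : t ∈ eInf A E := mem_eInf.2 (zero_mem E)
  have hd'' := hd'.add (hE.isHomDerivation_infBr (𝒦 := 𝒦) hA hq htE ht).neg
  set d'' := d' + -(infRestrict (infBrHom 𝒜 ℳ q t) fun _ hv => hE.infBrHom_mem hA hq htE hv)
    with hd''def
  have ev' : ∀ v, (d'' v).1 = (d' v).1 - infBr 𝒜 ℳ q t v.1 := fun v => by
    rw [hd''def, sub_eq_add_neg]; rfl
  -- The bracket with `(c, 0, 0, 0)` is `c` on the first copy of `M` and `-c` on the second, so the
  -- corrected maps are `S - c` and `T + c`; these agree because `S - T = 2c`.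
  have hS : IsEigenDerivation E d'' (S - lmul M c) (S - lmul M c) := by
    refine ⟨fun m => ?_, fun n => ?_, fun v h1 h3 => ?_⟩
    · rw [ev', hST.fst, infFst_coe, infBr_fst]
      simp [lmul]
      rfl
    · rw [ev', hST.snd, infSnd_coe, infBr_snd]
      have e : S n - T n = c • n + c • n := by
        rw [hcc]; exact DFunLike.congr_fun hR n
      rw [sub_eq_iff_eq_add] at e
      simp [lmul, e]
      abel
    · obtain ⟨h4, h5⟩ := hST.zero v h1 h3
      have e : v.1 = (v.1.1, 0, 0, v.1.2.2.2) := Prod.ext rfl (Prod.ext h1 (Prod.ext h3 rfl))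
      have e' : infBr 𝒜 ℳ q t v.1 = 0 := by
        rw [e, infBr_mk]
        simp [sbr_zero_left]
      rw [ev', e', sub_zero]
      exact ⟨h4, h5⟩
  obtain ⟨Δ, hΔ, hv⟩ := hS.exists_isSim h2 hA hM hq hE hd''
  refine ⟨s + t, add_mem hsE htE, _, Δ, hΔ, fun v => ?_⟩
  rw [← hv, ev', ev, infBr_add_left]
  abel

end Classification

/-! ### Locally inner derivations -/

section Local

variable {K : Type*} [Ring K] {𝒦 : ZMod 2 → AddSubgroup K} [GradedRing 𝒦]
  {A : Type*} [Ring A] {𝒜 : ZMod 2 → AddSubgroup A} [GradedRing 𝒜]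
  [Module K A] [IsScalarTower K A A] [SetLike.GradedSMul 𝒦 𝒜]
  {M : Type*} [AddCommGroup M] [Module A M] [Module K M] [IsScalarTower K A M]
  {ℳ : ZMod 2 → AddSubgroup M}
  [DirectSum.Decomposition ℳ] [SetLike.GradedSMul 𝒜 ℳ] {q : M →+ M →+ A}
  {E : AddSubgroup (M →+ M)}

/-- The bracket of an element of `osp(q)` with a given element of `eosp(q)` depends on finitely
many values only. -/
theorem exists_finset_sbr_eq_zero (hq : IsQuadraticForm 𝒜 ℳ q) {z : M →+ M}
    (hz : z ∈ eosp 𝒜 ℳ q) : ∃ G : Finset M, ∀ R : M →+ M, IsDer 𝒜 𝒜 ℳ q R 0 →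
      (∀ p ∈ G, R p = 0) → sbr ℳ R z = 0 := by
  classical
  let X : AddSubgroup (M →+ M) :=
    { carrier := {z | ∃ G : Finset M, ∀ R : M →+ M, IsDer 𝒜 𝒜 ℳ q R 0 →
        (∀ p ∈ G, R p = 0) → sbr ℳ R z = 0}
      zero_mem' := ⟨∅, fun R _ _ => sbr_zero_right ℳ R⟩
      add_mem' := by
        rintro y z ⟨G, hG⟩ ⟨H, hH⟩
        refine ⟨G ∪ H, fun R hR h => ?_⟩
        rw [sbr_add_right, hG R hR fun p hp => h p (Finset.mem_union_left _ hp),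
          hH R hR fun p hp => h p (Finset.mem_union_right _ hp), add_zero]
      neg_mem' := by
        rintro z ⟨G, hG⟩
        exact ⟨G, fun R hR h => by rw [sbr_neg_right, hG R hR h, neg_zero]⟩ }
  refine (eosp_le (X := X) fun β γ m hm n hn => ⟨{m, n}, fun R hR h => ?_⟩) hz
  have key : ∀ α, sbr ℳ (endProj ℳ α R) (eMap 𝒜 ℳ q m n) = 0 := by
    intro α
    rw [(hR α).sbr_eMap hq hm, endProj_apply_of_mem ℳ R α hm, endProj_apply_of_mem ℳ R α hn,
      h m (by simp), h n (by simp)]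
    simp
  rw [← endProj_zero_add_endProj_one ℳ R, sbr_add_left, key, key, add_zero]

/-- For finitely many elements of `E_∞`, the values of `d_R` depend on finitely many values of `R`,
and on those `R` agrees with a partial sum in `eosp(q)`. -/
theorem exists_dsMap_eq (hA : IsSupercommutative 𝒜) (hq : IsQuadraticForm 𝒜 ℳ q) {R : M →+ M}
    (hR : R ∈ eospBar 𝒜 ℳ q) (F : Finset (eInf A (eosp 𝒜 ℳ q))) :
    ∃ x ∈ eosp 𝒜 ℳ q, ∀ v ∈ F, dsMap ℳ R (0 : A →+ A) v.1 = dsMap ℳ x 0 v.1 := by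
  classical
  choose G hG using fun v : eInf A (eosp 𝒜 ℳ q) =>
    exists_finset_sbr_eq_zero hq (mem_eInf.1 v.2)
  obtain ⟨x, hx, h⟩ := summableClosure_approx hR
    (F.biUnion fun v => G v ∪ {v.1.2.1, v.1.2.2.1})
  refine ⟨x, hx, fun v hv => ?_⟩
  have hv' : ∀ p ∈ G v ∪ {v.1.2.1, v.1.2.2.1}, R p = x p := fun p hp =>
    h p (Finset.mem_biUnion.2 ⟨v, hv, hp⟩)
  have hD := ((mem_osp_iff (𝒦 := 𝒜) hq).1 (eospBar_le_osp hA hq hR)).sub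
    ((mem_osp_iff (𝒦 := 𝒜) hq).1 (eosp_le_osp hA hq hx))
  rw [sub_zero] at hD
  rw [dsMap_apply, dsMap_apply]
  refine Prod.ext rfl (Prod.ext (hv' _ (by simp)) (Prod.ext (hv' _ (by simp)) ?_))
  rw [← sub_eq_zero, ← sbr_sub_left]
  refine hG v _ hD fun p hp => ?_
  rw [AddMonoidHom.sub_apply, hv' p (Finset.mem_union_left _ hp), sub_self]

theorem dsMap_add (S T : M →+ M) (Δ Θ : A →+ A) (v : A × M × M × (M →+ M)) :
    dsMap ℳ (S + T) (Δ + Θ) v = dsMap ℳ S Δ v + dsMap ℳ T Θ v := by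
  simp only [dsMap_apply, sbr_add_left, AddMonoidHom.add_apply, Prod.mk_add_mk]

theorem dsMap_sbr {α β : ZMod 2} {S T : M →+ M} {Δ Θ : A →+ A} (hS : S ∈ endGr ℳ α)
    (hT : T ∈ endGr ℳ β) (hΔ : Δ ∈ endGr 𝒜 α) (hΘ : Θ ∈ endGr 𝒜 β)
    (v : A × M × M × (M →+ M)) :
    dsMap ℳ (sbr ℳ S T) (sbr 𝒜 Δ Θ) v = dsMap ℳ S Δ (dsMap ℳ T Θ v) -
      sgn α β • dsMap ℳ T Θ (dsMap ℳ S Δ v) := by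
  simp only [dsMap_apply]
  rw [sbr_leibniz ℳ hS hT, sbr_of_mem ℳ hS hT, sbr_of_mem 𝒜 hΔ hΘ]
  refine Prod.ext rfl (Prod.ext rfl (Prod.ext rfl ?_))
  simp

theorem IsDer.isDerivation (hM : IsFaithful A M) (hq : IsQuadraticForm 𝒜 ℳ q)
    (hE : IsStandard 𝒜 ℳ q E) {S : M →+ M} {Δ : A →+ A}
    (hS : IsDer 𝒦 𝒜 ℳ q S Δ) {d : eInf A E →+ eInf A E}
    (hd : ∀ v, (d v).1 = dsMap ℳ S Δ v.1) : IsDerivation 𝒦 𝒜 ℳ q E d := by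
  refine ⟨_, _, (hS 0).isHomDerivation hM hq hE, (hS 1).isHomDerivation hM hq hE,
    AddMonoidHom.ext fun v => Subtype.ext ?_⟩
  rw [hd]
  change _ = dsMap ℳ (endProj ℳ 0 S) (endProj 𝒜 0 Δ) v.1 +
    dsMap ℳ (endProj ℳ 1 S) (endProj 𝒜 1 Δ) v.1
  rw [← dsMap_add, endProj_zero_add_endProj_one, endProj_zero_add_endProj_one]

theorem IsDerivation.exists_eq (h2 : IsUnit (2 : A)) (hA : IsSupercommutative 𝒜)
    (hM : IsFaithful A M) (hq : IsQuadraticForm 𝒜 ℳ q) (hE : IsStandard 𝒜 ℳ q E)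
    (hr : HasRankTwoSummand ℳ q) {d : eInf A E →+ eInf A E} (hd : IsDerivation 𝒦 𝒜 ℳ q E d) :
    ∃ s ∈ eInf A E, ∃ S Δ, IsDer 𝒦 𝒜 ℳ q S Δ ∧
      ∀ v : eInf A E, (d v).1 = infBr 𝒜 ℳ q s v.1 + dsMap ℳ S Δ v.1 := by
  obtain ⟨d₀, d₁, h0, h1, rfl⟩ := hd
  obtain ⟨s, hs, S, Δ, hS, e0⟩ := h0.exists_eq h2 hA hM hq hE hr
  obtain ⟨t, ht, T, Θ, hT, e1⟩ := h1.exists_eq h2 hA hM hq hE hr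
  refine ⟨s + t, add_mem hs ht, S + T, Δ + Θ, hS.isDer.add hT.isDer, fun v => ?_⟩
  change (d₀ v).1 + (d₁ v).1 = _
  rw [e0, e1, infBr_add_left, dsMap_add]
  abel

end Local

/-! ### Derivations of `E_∞` for an orthogonal sum -/

section SplitInf

variable {K : Type*} [Ring K] {𝒦 : ZMod 2 → AddSubgroup K} [GradedRing 𝒦]
  {A : Type*} [Ring A] {𝒜 : ZMod 2 → AddSubgroup A} [GradedRing 𝒜]
  [Module K A] [IsScalarTower K A A] [SetLike.GradedSMul 𝒦 𝒜]
  {N P : Type*} [AddCommGroup N] [Module A N] [AddCommGroup P] [Module A P]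
  [Module K N] [IsScalarTower K A N] [Module K P] [IsScalarTower K A P]
  {𝒩 : ZMod 2 → AddSubgroup N} [DirectSum.Decomposition 𝒩] [SetLike.GradedSMul 𝒜 𝒩]
  {𝓟 : ZMod 2 → AddSubgroup P} [DirectSum.Decomposition 𝓟] [SetLike.GradedSMul 𝒜 𝓟]
  {qN : N →+ N →+ A} {qP : P →+ P →+ A}
  {I : Type*} {b : Module.Basis I A N} {bar : I → I}
  {E : AddSubgroup (N × P →+ N × P)}
  (hK : IsSupercommutative 𝒦)
  (hA : IsSupercommutative 𝒜) (h2 : IsUnit (2 : A)) (hqN : IsQuadraticForm 𝒜 𝒩 qN)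
  (hqP : IsQuadraticForm 𝒜 𝓟 qP) (hP : IsFaithful A P) (hb : IsAlmostDiagonal 𝒩 qN b bar)
  (hE : IsStandard 𝒜 (prodGr 𝒩 𝓟) (orthSum qN qP) E)
  (hr : HasRankTwoSummand (prodGr 𝒩 𝓟) (orthSum qN qP))

include hK hA h2 hqN hqP hP hb hE hr

/-- The part common to all choices of `E`. What varies is only which derivations `J` include the
sums of an inner derivation and `d_R`, with `R` in the closure of `eosp(q)`; this is the hypothesis
`hJ'`. -/
theorem derivationsEqSum_s12 {J : (eInf A E →+ eInf A E) → Prop}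
    (hJ : ∀ e, J e → IsDerivation 𝒦 𝒜 (prodGr 𝒩 𝓟) (orthSum qN qP) E e)
    (hJ' : ∀ s ∈ eInf A E, ∀ R ∈ eospBar 𝒜 (prodGr 𝒩 𝓟) (orthSum qN qP),
      ∀ e : eInf A E →+ eInf A E, (∀ v, (e v).1 = infBr 𝒜 (prodGr 𝒩 𝓟) (orthSum qN qP) s v.1 +
        dsMap (prodGr 𝒩 𝓟) R (0 : A →+ A) v.1) → J e) :
    DerivationsEqSum 𝒦 𝒜 𝒩 𝓟 qN qP b bar E J (s12 (A := A) 𝒦 𝓟 qP) := by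
  have hq := hqN.orthSum hqP
  have hM := hP.prod (N := N)
  have hS : ∀ S ∈ s12 (A := A) 𝒦 𝓟 qP, IsDer 𝒦 𝒜 𝓟 qP S (adA A 𝓟 S) := fun S h =>
    isDer_adA hP hqP h
  have hH : ∀ S ∈ s12 (A := A) 𝒦 𝓟 qP, IsDer 𝒦 𝒜 (prodGr 𝒩 𝓟) (orthSum qN qP)
      (hat 𝓟 qN b bar S) (adA A 𝓟 S) := fun S h => (hS S h).hat hA h2 hP hqN hb
  let ψ : s12 (A := A) 𝒦 𝓟 qP →+ (eInf A E →+ eInf A E) := AddMonoidHom.mk'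
    (fun S => infRestrict (dsMap (prodGr 𝒩 𝓟) (hat 𝓟 qN b bar S.1) (adA A 𝓟 S.1)) fun _ hv =>
      mem_eInf.2 (hE.sbr_mem hq (hH _ S.2) (mem_eInf.1 hv))) fun S T => by
    refine AddMonoidHom.ext fun v => Subtype.ext ?_
    change dsMap (prodGr 𝒩 𝓟) (hat 𝓟 qN b bar (S.1 + T.1)) (adA A 𝓟 (S.1 + T.1)) v.1 =
      dsMap (prodGr 𝒩 𝓟) (hat 𝓟 qN b bar S.1) (adA A 𝓟 S.1) v.1 +
      dsMap (prodGr 𝒩 𝓟) (hat 𝓟 qN b bar T.1) (adA A 𝓟 T.1) v.1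
    rw [(hS _ S.2).hat_add hP (hS _ T.2), ((hS _ S.2).add (hS _ T.2)).adA_eq hP,
      dsMap_add]
  have hψ : ∀ S v, (ψ S v).1 =
      dsMap (prodGr 𝒩 𝓟) (hat 𝓟 qN b bar S.1) (adA A 𝓟 S.1) v.1 := fun _ _ => rfl
  clear_value ψ
  refine ⟨hE.isLieSuperalgebra_eInf hK hA hq, isLieSuperalgebra_s12 hK hA hP hqP, ψ, ?_,
    fun S v => ?_, fun k S S' hk v => ?_, fun α S hd β v hv => ?_,
    fun α β S S' S'' hd hd' h => ?_, fun d => ⟨fun hd => ?_, ?_⟩⟩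
  · refine (injective_iff_map_eq_zero ψ).2 fun S h0 => Subtype.ext (AddMonoidHom.ext fun p => ?_)
    -- The values of `S` are recovered from those of `d` on the elements `(0, (0, p), 0, 0)`.
    have h := hψ S (infFst A E (0, p))
    rw [h0] at h
    exact (congrArg (fun v => v.2.1.2) h).symm
  · rw [hψ, (hH _ S.2).adA_eq hM]
    rfl
  · have hv := hE.isDer (𝒦 := 𝒦) hA hq (mem_eInf.1 v.2)
    rw [hψ, hψ, hk, (hS _ S.2).hat_ksmul hK hA h2 hqP hP,
      ((hS _ S.2).ksmul hK hA hqP k).adA_eq hP, dsMap_apply, dsMap_apply, hv.sbr_ksmul_left]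
    rfl
  · rw [hψ]
    exact ((hH _ S.2).isSim ((hS _ S.2).hat_mem_endGr hA h2 hP hqN hb hd)
      ((hS _ S.2).degA hP hd)).dsMap_mem hv
  · refine AddMonoidHom.ext fun v => Subtype.ext ?_
    rw [AddMonoidHom.sub_apply, AddMonoidHom.smul_apply, AddMonoidHom.comp_apply,
      AddMonoidHom.comp_apply, AddSubgroup.coe_sub, AddSubgroup.coe_zsmul, hψ, hψ, hψ, hψ, hψ, h,
      (hS _ S.2).hat_sbr hA h2 hP hqN hb (hS _ S'.2), ((hS _ S.2).sbr (hS _ S'.2)).adA_eq hP]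
    exact dsMap_sbr ((hS _ S.2).hat_mem_endGr hA h2 hP hqN hb hd)
      ((hS _ S'.2).hat_mem_endGr hA h2 hP hqN hb hd') ((hS _ S.2).degA hP hd)
      ((hS _ S'.2).degA hP hd') v.1
  · obtain ⟨s, hs, T, Δ, hT, hv⟩ := hd.exists_eq h2 hA hM hq hE hr
    have hTP := hT.blockP
    have hR := hT.sub (hTP.hat hA h2 hP hqN hb)
    rw [sub_self] at hR
    -- `T` and the extension of its `P → P` block have the same `Δ`, so the difference is in
    -- `osp(q)` without `P → P` block, hence in the closure of `eosp(q)`.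
    have hRb := mem_eospBar_of_blockP_eq_zero hA h2 hqN hqP hb
      ((mem_osp_iff hq).2 hR)
      (by rw [blockP_sub, blockP_hat, sub_self])
    let S : s12 (A := A) 𝒦 𝓟 qP := ⟨blockP T, hTP.mem_s12 hqP⟩
    refine ⟨d - ψ S, hJ' s hs _ hRb _ fun v => ?_, S, (sub_add_cancel _ _).symm⟩
    change (d v).1 - (ψ S v).1 = _
    rw [hv, hψ, hTP.adA_eq hP]
    simp only [dsMap_apply, sbr_sub_left, AddMonoidHom.sub_apply, add_sub_assoc, Prod.mk_sub_mk,
      sub_self, AddMonoidHom.zero_apply]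
    rfl
  · rintro ⟨e, he, S, rfl⟩
    exact (hJ e he).add ((hH _ S.2).isDerivation hM hq hE (hψ S))

theorem derivationsEqSum_isLocallyInner
    (hE' : E = eosp 𝒜 (prodGr 𝒩 𝓟) (orthSum qN qP)) :
    DerivationsEqSum 𝒦 𝒜 𝒩 𝓟 qN qP b bar E
      (IsLocallyInner 𝒦 𝒜 (prodGr 𝒩 𝓟) (orthSum qN qP) E) (s12 (A := A) 𝒦 𝓟 qP) := by
  have hq := hqN.orthSum hqP
  refine derivationsEqSum_s12 hK hA h2 hqN hqP hP hb hE hr (fun e he => he.1)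
    fun s hs R hR e he => ?_
  subst hE'
  refine ⟨?_, fun F => ?_⟩
  · have h1 : IsInner 𝒜 (prodGr 𝒩 𝓟) (orthSum qN qP) _
        (infRestrict (infBrHom 𝒜 (prodGr 𝒩 𝓟) (orthSum qN qP) s) fun _ hv =>
          hE.infBrHom_mem hA hq hs hv) := ⟨⟨s, hs⟩, fun y => rfl⟩
    have h3 := (mem_osp_iff (𝒦 := 𝒦) hq).1 (eospBar_le_osp hA hq hR)
    have h4 := (hE.isDerivation_of_isInner (𝒦 := 𝒦) hA hq h1).add (h3.isDerivation hP.prod hq hE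
      (d := infRestrict (dsMap (prodGr 𝒩 𝓟) R 0) fun _ hv =>
        mem_eInf.2 (hE.sbr_mem hq h3 (mem_eInf.1 hv))) fun v => rfl)
    convert h4
    exact AddMonoidHom.ext fun v => Subtype.ext (he v)
  -- `R` itself need not belong to `eosp(q)`; on a finite set it is replaced by a partial sum `x`,
  -- and `d_x` is inner.
  · obtain ⟨x, hx, h⟩ := exists_dsMap_eq hA hq hR F
    refine ⟨⟨s + (0, 0, 0, x), add_mem hs (mem_eInf.2 hx)⟩, fun v hv => ?_⟩
    rw [he, infBr_add_left, infBr_zero_zero_zero_left, h v hv]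

theorem derivationsEqSum_isInner
    (hE' : eospBar 𝒜 (prodGr 𝒩 𝓟) (orthSum qN qP) ≤ E) :
    DerivationsEqSum 𝒦 𝒜 𝒩 𝓟 qN qP b bar E
      (IsInner 𝒜 (prodGr 𝒩 𝓟) (orthSum qN qP) E) (s12 (A := A) 𝒦 𝓟 qP) := by
  have hq := hqN.orthSum hqP
  refine derivationsEqSum_s12 hK hA h2 hqN hqP hP hb hE hr
    (fun e he => hE.isDerivation_of_isInner hA hq he) fun s hs R hR e he => ?_
  refine ⟨⟨s + (0, 0, 0, R), add_mem hs (mem_eInf.2 (hE' hR))⟩, fun v => ?_⟩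
  rw [he, infBr_add_left, infBr_zero_zero_zero_left]

end SplitInf

end OspDer

theorem corollary4p6
    {K : Type*} [Ring K] (𝒦 : ZMod 2 → AddSubgroup K) [GradedRing 𝒦]
    (hK : OspDer.IsSupercommutative 𝒦) (h2 : IsUnit (2 : K))
    {A : Type*} [Ring A] (𝒜 : ZMod 2 → AddSubgroup A) [GradedRing 𝒜]
    (hA : OspDer.IsSupercommutative 𝒜)
    [Module K A] [IsScalarTower K A A] [SetLike.GradedSMul 𝒦 𝒜]
    {N P : Type*} [AddCommGroup N] [Module A N] [AddCommGroup P] [Module A P]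
    [Module K N] [IsScalarTower K A N] [Module K P] [IsScalarTower K A P]
    (𝒩 : ZMod 2 → AddSubgroup N) [DirectSum.Decomposition 𝒩] [SetLike.GradedSMul 𝒜 𝒩]
    (𝓟 : ZMod 2 → AddSubgroup P) [DirectSum.Decomposition 𝓟] [SetLike.GradedSMul 𝒜 𝓟]
    (qN : N →+ N →+ A) (hqN : OspDer.IsQuadraticForm 𝒜 𝒩 qN)
    (qP : P →+ P →+ A) (hqP : OspDer.IsQuadraticForm 𝒜 𝓟 qP)
    (hP : OspDer.IsFaithful A P)
    {I : Type*} (b : Module.Basis I A N) (bar : I → I)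
    (hb : OspDer.IsAlmostDiagonal 𝒩 qN b bar) :
    OspDer.IsLieSuperIso 𝒦
        (OspDer.splitGr 𝒩 𝓟)
        (OspDer.splitSum 𝒜 𝒩 𝓟 qN qP (OspDer.s12 𝒦 𝓟 qP))
        (OspDer.splitBr 𝒩 𝓟 qN b bar)
        (OspDer.endGr (OspDer.prodGr 𝒩 𝓟))
        (OspDer.s12 𝒦 (OspDer.prodGr 𝒩 𝓟) (OspDer.orthSum qN qP))
        (OspDer.sbr (OspDer.prodGr 𝒩 𝓟))
        (OspDer.splitMap 𝓟 qN b bar) ∧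
    (∀ E EP, OspDer.IsStandard 𝒜 (OspDer.prodGr 𝒩 𝓟) (OspDer.orthSum qN qP) E →
      OspDer.IsStandard 𝒜 𝓟 qP EP →
      OspDer.IsLieSuperIso 𝒦
        (OspDer.splitGr 𝒩 𝓟)
        (OspDer.splitSum 𝒜 𝒩 𝓟 qN qP (OspDer.sE 𝒦 𝓟 qP EP))
        (OspDer.splitBr 𝒩 𝓟 qN b bar)
        (OspDer.endGr (OspDer.prodGr 𝒩 𝓟))
        (OspDer.sE 𝒦 (OspDer.prodGr 𝒩 𝓟) (OspDer.orthSum qN qP) E)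
        (OspDer.sbr (OspDer.prodGr 𝒩 𝓟))
        (OspDer.splitMap 𝓟 qN b bar)) ∧
    (OspDer.HasRankTwoSummand (OspDer.prodGr 𝒩 𝓟) (OspDer.orthSum qN qP) →
      ∀ EP, OspDer.IsStandard 𝒜 𝓟 qP EP →
        (∀ E, E = OspDer.eosp 𝒜 (OspDer.prodGr 𝒩 𝓟) (OspDer.orthSum qN qP) →
          OspDer.DerivationsEqSum 𝒦 𝒜 𝒩 𝓟 qN qP b bar E
            (OspDer.IsLocallyInner 𝒦 𝒜 (OspDer.prodGr 𝒩 𝓟) (OspDer.orthSum qN qP) E)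
            (OspDer.sE 𝒦 𝓟 qP EP)) ∧
        (∀ E, E = OspDer.eospBar 𝒜 (OspDer.prodGr 𝒩 𝓟) (OspDer.orthSum qN qP) ∨
            E = OspDer.osp 𝒜 (OspDer.prodGr 𝒩 𝓟) (OspDer.orthSum qN qP) →
          OspDer.DerivationsEqSum 𝒦 𝒜 𝒩 𝓟 qN qP b bar E
            (OspDer.IsInner 𝒜 (OspDer.prodGr 𝒩 𝓟) (OspDer.orthSum qN qP) E)
            (OspDer.sE 𝒦 𝓟 qP EP))) := by
  have h2A : IsUnit (2 : A) := OspDer.isUnit_two_of_tower h2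
  have hq := hqN.orthSum hqP
  refine ⟨OspDer.isLieSuperIso_s12 hA h2A hqN hqP hP hb hK, fun E EP hE hEP => ?_,
    fun hr EP hEP => ⟨fun E hE => ?_, fun E hE => ?_⟩⟩
  -- Both superalgebras coincide with the intersection of the first two conditions, for every
  -- standard choice; this is why `E` and `EP` can be chosen independently.
  · rw [OspDer.sE_eq_s12 hP hqP hEP, OspDer.sE_eq_s12 hP.prod hq hE]
    exact OspDer.isLieSuperIso_s12 hA h2A hqN hqP hP hb hK
  · rw [OspDer.sE_eq_s12 hP hqP hEP]
    exact OspDer.derivationsEqSum_isLocallyInner hK hA h2A hqN hqP hP hb (Or.inl hE) hr hE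
  · rw [OspDer.sE_eq_s12 hP hqP hEP]
    refine OspDer.derivationsEqSum_isInner hK hA h2A hqN hqP hP hb (Or.inr hE) hr ?_
    rcases hE with rfl | rfl
    exacts [le_rfl, OspDer.eospBar_le_osp hA hq]
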